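/- Let $(M,g)$ be an oriented $n$-dimensional smooth Riemannian manifold (Hausdorff, second countable, without boundary; neither connectedness nor completeness is assumed), let $0\le k\le n$, let $1<p<\infty$ and let $p'$ be defined by $\frac1p+\frac1{p'}=1$. For $1\le r\le\infty$ and $0\le j\le n$ let $L^r(M,\Lambda^j)$ be the Banach space of (a.e. classes of) measurable differential $j$-forms $\omega$ with $\|\omega\|_r=\big(\int_M|\omega|^r\,d\mathrm{vol}_g\big)^{1/r}<\infty$ (essential supremum if $r=\infty$), where $|\omega|$ is the pointwise Euclidean norm induced by $g$ and $\mathrm{vol}_g$ is the Riemannian measure. Let $\mathcal D^j$ be the space of smooth $j$-forms with compact support ($\mathcal D^{-1}=0$). Let $Z^j_r(M)\subset L^r(M,\Lambda^j)$ be the subspace of weakly closed forms, i.e. of forms $\omega$ whose weak exterior differential is $0$, where $\theta$ is the weak exterior differential of $\omega$ if $\int_M\theta\wedge\eta=(-1)^{j+1}\int_M\omega\wedge d\eta$ for all $\eta\in\mathcal D^{n-j-1}$ (every form is weakly closed if $j=n$). The reduced $(\mathrm{comp},r)$-cohomology of $M$ is the quotient, with the quotient norm, $$\overline H^j_{\mathrm{comp},r}(M)=Z^j_r(M)/\overline{d\mathcal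 D^{j-1}},$$ where the closure is taken in $L^r(M,\Lambda^j)$. Then $\int_M\omega\wedge\varphi$ converges absolutely for all $\omega\in Z^k_p(M)$ and $\varphi\in Z^{n-k}_{p'}(M)$ and depends only on the classes of $\omega$ and $\varphi$, and the integration pairing $\langle[\omega],[\varphi]\rangle=\int_M\omega\wedge\varphi$ induces an isomorphism (linear, bounded, with bounded inverse) $$\overline H^k_{\mathrm{comp},p}(M)\;\longrightarrow\;\big(\overline H^{n-k}_{\mathrm{comp},p'}(M)\big)^{*},\qquad [\omega]\mapsto\big([\varphi]\mapsto\langle[\omega],[\varphi]\rangle\big)$$ onto the space of continuous linear functionals on $\overline H^{n-k}_{\mathrm{comp},p'}(M)$. -/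

import Mathlib

open Bundle Manifold MeasureTheory
open scoped ContDiff Topology ENNReal

noncomputable section

namespace RiemannianForms

/-- A (not necessarily continuous) differential `k`-form on `M`: an alternating `k`-linear form on
each tangent space. -/
abbrev FormField (n : ℕ) (M : Type*) [TopologicalSpace M]
    [ChartedSpace (EuclideanSpace ℝ (Fin n)) M] (k : ℕ) : Type _ :=
  ∀ x : M, TangentSpace (𝓡 n) x [⋀^Fin k]→L[ℝ] ℝ

theorem sum_sq_eq_gram {n k : ℕ} {V : Type*} [NormedAddCommGroup V] [InnerProductSpace ℝ V]
    (e : OrthonormalBasis (Fin n) ℝ V) (b : Module.Basis (Fin n) ℝ V)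
    (α : V [⋀^Fin k]→L[ℝ] ℝ) :
    ∑ m : Fin k → Fin n, α (fun a => e (m a)) ^ 2 =
      ∑ i : Fin k → Fin n, ∑ j : Fin k → Fin n,
        (∏ a, (Matrix.of fun s t => inner ℝ (b s) (b t))⁻¹ (i a) (j a)) *
          (α (fun a => b (i a)) * α (fun a => b (j a))) := by
  classical
  set A : Matrix (Fin n) (Fin n) ℝ := Matrix.of fun m i => b.repr (e m) i with hA
  have he : ∀ m, e m = ∑ i, A m i • b i := fun m => (b.sum_repr (e m)).symm
  set G : Matrix (Fin n) (Fin n) ℝ := Matrix.of fun s t => inner ℝ (b s) (b t) with hG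
  have h1 : A * (G * A.transpose) = 1 := by
    ext m m'
    have := orthonormal_iff_ite.mp e.orthonormal m m'
    rw [he m, he m', sum_inner] at this
    simp only [inner_sum, real_inner_smul_left, real_inner_smul_right] at this
    rw [Matrix.one_apply, ← this]
    simp only [Matrix.mul_apply, Matrix.transpose_apply, hG, Matrix.of_apply, Finset.mul_sum]
    refine Finset.sum_congr rfl fun i _ => Finset.sum_congr rfl fun j _ => by ring
  have h2 : G * (A.transpose * A) = 1 := by
    rw [← Matrix.mul_assoc]; exact mul_eq_one_comm.mp h1
  have h3 : G⁻¹ = A.transpose * A := Matrix.inv_eq_right_inv h2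
  rw [h3]
  have hα : ∀ m : Fin k → Fin n, α (fun a => e (m a)) =
      ∑ i : Fin k → Fin n, (∏ a, A (m a) (i a)) * α (fun a => b (i a)) := by
    intro m
    simp_rw [he]
    have := α.toMultilinearMap.map_sum (fun a i => A (m a) i • b i)
    refine this.trans (Finset.sum_congr rfl fun i _ => ?_)
    exact α.toMultilinearMap.map_smul_univ (fun a => A (m a) (i a)) (fun a => b (i a))
  simp_rw [hα, sq, Finset.sum_mul_sum]
  rw [Finset.sum_comm]
  refine Finset.sum_congr rfl fun i _ => ?_
  rw [Finset.sum_comm]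
  refine Finset.sum_congr rfl fun j _ => ?_
  simp only [Matrix.mul_apply, Matrix.transpose_apply]
  rw [Finset.prod_univ_sum, Finset.sum_mul]
  simp only [Fintype.piFinset_univ, Finset.prod_mul_distrib]
  refine Finset.sum_congr rfl fun m _ => by ring

section Smooth

variable {n : ℕ} {M : Type*} [TopologicalSpace M] [ChartedSpace (EuclideanSpace ℝ (Fin n)) M]
  [IsManifold (𝓡 n) ∞ M] {k l m : ℕ}

/-- The coordinate vector fields of the preferred chart at `x₀` (at points `x` of its domain). -/
def chartFrame (x₀ x : M) (i : Fin n) : TangentSpace (𝓡 n) x :=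
  (trivializationAt (EuclideanSpace ℝ (Fin n)) (TangentSpace (𝓡 n) : M → Type _) x₀).symmL ℝ x
    (EuclideanSpace.basisFun (Fin n) ℝ i)

/-- The coordinate expression, in the preferred chart at `x₀`, of a differential form at the point
`x` of the domain of that chart. -/
def inChart (α : FormField n M k) (x₀ x : M) : EuclideanSpace ℝ (Fin n) [⋀^Fin k]→L[ℝ] ℝ :=
  (α x).compContinuousLinearMap
    ((trivializationAt (EuclideanSpace ℝ (Fin n)) (TangentSpace (𝓡 n) : M → Type _) x₀).symmL ℝ x)

/-- Smoothness of a differential form: its coordinate expressions are smooth. -/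
def IsSmoothForm (α : FormField n M k) : Prop :=
  ∀ x₀ : M, ContMDiffOn (𝓡 n) 𝓘(ℝ, EuclideanSpace ℝ (Fin n) [⋀^Fin k]→L[ℝ] ℝ) ∞
    (inChart α x₀) (chartAt (EuclideanSpace ℝ (Fin n)) x₀).source

/-- The exterior differential of a differential form, computed at `x` in the preferred chart at `x`
(for smooth forms any other chart around `x` gives the same value). -/
def extD (α : FormField n M k) : FormField n M (k + 1) := fun x =>
  (extDeriv (fun y => inChart α x ((extChartAt (𝓡 n) x).symm y))
    (extChartAt (𝓡 n) x x)).compContinuousLinearMap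
    ((trivializationAt (EuclideanSpace ℝ (Fin n)) (TangentSpace (𝓡 n) : M → Type _)
      x).continuousLinearMapAt ℝ x)

theorem inChart_add (α β : FormField n M k) (x₀ : M) :
    inChart (α + β) x₀ = inChart α x₀ + inChart β x₀ := rfl

theorem inChart_smul (c : ℝ) (α : FormField n M k) (x₀ : M) :
    inChart (c • α) x₀ = c • inChart α x₀ := rfl

theorem inChart_zero (x₀ : M) : inChart (0 : FormField n M k) x₀ = 0 := rfl

theorem IsSmoothForm.differentiableAt {α : FormField n M k} (h : IsSmoothForm α) (x : M) :
    DifferentiableAt ℝ (fun y => inChart α x ((extChartAt (𝓡 n) x).symm y))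
      (extChartAt (𝓡 n) x x) := by
  have h1 : ContMDiffAt (𝓡 n) 𝓘(ℝ, EuclideanSpace ℝ (Fin n) [⋀^Fin k]→L[ℝ] ℝ) ∞
      (inChart α x) x :=
    (h x).contMDiffAt ((chartAt (EuclideanSpace ℝ (Fin n)) x).open_source.mem_nhds
      (mem_chart_source _ x))
  have h2 := (contMDiffAt_iff.mp h1).2
  have h3 : ContDiffWithinAt ℝ ∞ (fun y => inChart α x ((extChartAt (𝓡 n) x).symm y))
      (Set.range (𝓡 n)) (extChartAt (𝓡 n) x x) := by
    rw [extChartAt_model_space_eq_id] at h2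
    exact h2
  rw [modelWithCornersSelf_coe, Set.range_id, contDiffWithinAt_univ] at h3
  exact h3.differentiableAt (by simp)

theorem extD_add {α β : FormField n M k} (hα : IsSmoothForm α) (hβ : IsSmoothForm β) :
    extD (α + β) = extD α + extD β := by
  funext x
  have := extDeriv_fun_add (hα.differentiableAt x) (hβ.differentiableAt x)
  simp only [extD, inChart_add, Pi.add_apply]
  rw [this]
  rfl

theorem extD_smul (c : ℝ) (α : FormField n M k) : extD (c • α) = c • extD α := by
  funext x
  have : extDeriv (fun y => inChart (c • α) x ((extChartAt (𝓡 n) x).symm y))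
      (extChartAt (𝓡 n) x x) = c • extDeriv (fun y => inChart α x ((extChartAt (𝓡 n) x).symm y))
      (extChartAt (𝓡 n) x x) :=
    extDeriv_smul (x := extChartAt (𝓡 n) x x) c
      (fun y => inChart α x ((extChartAt (𝓡 n) x).symm y))
  simp only [extD, Pi.smul_apply]
  rw [this]
  rfl

/-- The space `𝓓ᵏ` of smooth differential `k`-forms with compact support. -/
def testForms (n : ℕ) (M : Type*) [TopologicalSpace M]
    [ChartedSpace (EuclideanSpace ℝ (Fin n)) M] [IsManifold (𝓡 n) ∞ M] (k : ℕ) :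
    Submodule ℝ (FormField n M k) where
  carrier := {α | IsSmoothForm α ∧ ∃ K : Set M, IsCompact K ∧ ∀ x ∉ K, α x = 0}
  add_mem' := by
    rintro α β ⟨hα, K, hK, hK'⟩ ⟨hβ, L, hL, hL'⟩
    refine ⟨fun x₀ => (hα x₀).add (hβ x₀), K ∪ L, hK.union hL, fun x hx => ?_⟩
    rw [Set.mem_union, not_or] at hx
    simp [hK' x hx.1, hL' x hx.2]
  zero_mem' := ⟨fun x₀ => (contMDiffOn_const (c := 0)), ∅, isCompact_empty, fun _ _ => rfl⟩
  smul_mem' := by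
    rintro c α ⟨hα, K, hK, hK'⟩
    refine ⟨fun x₀ => ContMDiffOn.smul (f := fun _ => c)
      (contMDiffOn_const (I' := 𝓘(ℝ, ℝ))) (hα x₀), K, hK,
      fun x hx => ?_⟩
    simp [hK' x hx]

end Smooth

section Norm

variable {n : ℕ} {M : Type*} [TopologicalSpace M] [ChartedSpace (EuclideanSpace ℝ (Fin n)) M]

instance (x : M) : FiniteDimensional ℝ (TangentSpace (𝓡 n) x) :=
  inferInstanceAs (FiniteDimensional ℝ (EuclideanSpace ℝ (Fin n)))

theorem finrank_tangentSpace (x : M) : Module.finrank ℝ (TangentSpace (𝓡 n) x) = n :=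
  finrank_euclideanSpace_fin (𝕜 := ℝ)

instance (x : M) : Fact (Module.finrank ℝ (TangentSpace (𝓡 n) x) = n) := ⟨finrank_tangentSpace x⟩

variable [RiemannianBundle (fun x : M => TangentSpace (𝓡 n) x)] {k : ℕ}

/-- An orthonormal basis of the tangent space at `x`. -/
def tangentONB (x : M) : OrthonormalBasis (Fin n) ℝ (TangentSpace (𝓡 n) x) :=
  (stdOrthonormalBasis ℝ (TangentSpace (𝓡 n) x)).reindex (finCongr (finrank_tangentSpace x))

/-- The Euclidean norm on `Λᵏ Tₓ*M` induced by the Riemannian metric. The square of the norm is the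
sum of `α(e_{i₁}, …, e_{iₖ})²` over `i₁ < ⋯ < iₖ`, i.e. `1 / k!` times the sum over all indices;
it does not depend on the orthonormal basis `e`. -/
def formNorm {x : M} (α : TangentSpace (𝓡 n) x [⋀^Fin k]→L[ℝ] ℝ) : ℝ :=
  √((∑ i : Fin k → Fin n, α (fun a => tangentONB x (i a)) ^ 2) / (k.factorial : ℝ))

theorem formNorm_eq {x : M} (α : TangentSpace (𝓡 n) x [⋀^Fin k]→L[ℝ] ℝ) :
    formNorm α = ‖WithLp.toLp 2 (fun i : Fin k → Fin n => α (fun a => tangentONB x (i a)))‖ /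
      √(k.factorial : ℝ) := by
  simp [formNorm, EuclideanSpace.norm_eq, Real.sqrt_div' _ (Nat.cast_nonneg _)]

theorem formNorm_nonneg {x : M} (α : TangentSpace (𝓡 n) x [⋀^Fin k]→L[ℝ] ℝ) : 0 ≤ formNorm α :=
  Real.sqrt_nonneg _

theorem formNorm_add_le {x : M} (α β : TangentSpace (𝓡 n) x [⋀^Fin k]→L[ℝ] ℝ) :
    formNorm (α + β) ≤ formNorm α + formNorm β := by
  simp only [formNorm_eq, ← add_div]
  gcongr
  exact norm_add_le (WithLp.toLp 2 (fun i : Fin k → Fin n => α (fun a => tangentONB x (i a))))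
    (WithLp.toLp 2 (fun i : Fin k → Fin n => β (fun a => tangentONB x (i a))))

theorem formNorm_smul {x : M} (c : ℝ) (α : TangentSpace (𝓡 n) x [⋀^Fin k]→L[ℝ] ℝ) :
    formNorm (c • α) = ‖c‖ * formNorm α := by
  simp only [formNorm_eq, ← mul_div_assoc]
  congr 1
  exact norm_smul c (WithLp.toLp 2 (fun i : Fin k → Fin n => α (fun a => tangentONB x (i a))))

theorem formNorm_zero (x : M) : formNorm (0 : TangentSpace (𝓡 n) x [⋀^Fin k]→L[ℝ] ℝ) = 0 := by
  simp [formNorm]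

end Norm

section Volume

variable {n : ℕ} {M : Type*} [TopologicalSpace M] [ChartedSpace (EuclideanSpace ℝ (Fin n)) M]
  [IsManifold (𝓡 n) ∞ M] [RiemannianBundle (fun x : M => TangentSpace (𝓡 n) x)]

/-- The Gram matrix `(g_{ij})` of the Riemannian metric in the preferred chart at `x₀`. -/
def chartGram (x₀ x : M) : Matrix (Fin n) (Fin n) ℝ :=
  Matrix.of fun i j => inner ℝ (chartFrame x₀ x i) (chartFrame x₀ x j)

/-- The Riemannian measure of the domain of the preferred chart at `x₀`, extended by zero:
it is `√det(g_{ij}) dy` in coordinates. -/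
def chartVolume [MeasurableSpace M] (x₀ : M) : Measure M :=
  ((volume.restrict (extChartAt (𝓡 n) x₀).target).withDensity fun y =>
    ENNReal.ofReal √(chartGram (n := n) x₀ ((extChartAt (𝓡 n) x₀).symm y)).det).map
    (extChartAt (𝓡 n) x₀).symm

variable (n M) in
/-- The Riemannian measure `vol_g`: the least measure that dominates all the chart measures. (By the
change of variables formula the chart measures agree on overlaps, so this is the measure obtained
by glueing them.) -/
def riemannianVolume [MeasurableSpace M] : Measure M := ⨆ x₀ : M, chartVolume (n := n) x₀

end Volume

section Lebesgue

variable {n : ℕ} {M : Type*} [TopologicalSpace M] [ChartedSpace (EuclideanSpace ℝ (Fin n)) M]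
  [IsManifold (𝓡 n) ∞ M] [RiemannianBundle (fun x : M => TangentSpace (𝓡 n) x)] {k : ℕ}

theorem sum_sq_eq_chartGram (α : FormField n M k) {x₀ x : M}
    (hx : x ∈ (chartAt (EuclideanSpace ℝ (Fin n)) x₀).source) :
    ∑ m : Fin k → Fin n, α x (fun a => tangentONB x (m a)) ^ 2 =
      ∑ i : Fin k → Fin n, ∑ j : Fin k → Fin n, (∏ a, (chartGram x₀ x)⁻¹ (i a) (j a)) *
          (inChart α x₀ x (fun a => EuclideanSpace.basisFun (Fin n) ℝ (i a)) *
           inChart α x₀ x (fun a => EuclideanSpace.basisFun (Fin n) ℝ (j a))) := by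
  have hx' : x ∈ (trivializationAt (EuclideanSpace ℝ (Fin n))
      (TangentSpace (𝓡 n) : M → Type _) x₀).baseSet := hx
  let L := (trivializationAt (EuclideanSpace ℝ (Fin n))
      (TangentSpace (𝓡 n) : M → Type _) x₀).continuousLinearEquivAt ℝ x hx'
  let b : Module.Basis (Fin n) ℝ (TangentSpace (𝓡 n) x) :=
    (EuclideanSpace.basisFun (Fin n) ℝ).toBasis.map L.symm.toLinearEquiv
  have hb : ∀ i, b i = chartFrame x₀ x i := by
    intro i
    have : b i = L.symm (EuclideanSpace.basisFun (Fin n) ℝ i) := by simp [b]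
    rw [this, Trivialization.symm_continuousLinearEquivAt_eq, chartFrame]
  have h := sum_sq_eq_gram (tangentONB x) b (α x)
  simp only [hb] at h
  exact h

theorem continuousOn_chartGram
    [IsContMDiffRiemannianBundle (𝓡 n) ∞ (EuclideanSpace ℝ (Fin n))
      (fun x : M => TangentSpace (𝓡 n) x)] (x₀ : M) :
    ContinuousOn (fun x => chartGram (n := n) x₀ x)
      (chartAt (EuclideanSpace ℝ (Fin n)) x₀).source := by
  have hf : ∀ i, ContMDiffOn (𝓡 n) ((𝓡 n).prod 𝓘(ℝ, EuclideanSpace ℝ (Fin n))) ∞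
      (fun x => (⟨x, chartFrame x₀ x i⟩ : TangentBundle (𝓡 n) M))
      (chartAt (EuclideanSpace ℝ (Fin n)) x₀).source := by
    intro i
    have h := (trivializationAt (EuclideanSpace ℝ (Fin n))
      (TangentSpace (𝓡 n) : M → Type _) x₀).contMDiffOn_localFrame_baseSet (I := 𝓡 n) ∞
      (EuclideanSpace.basisFun (Fin n) ℝ).toBasis i
    refine ContMDiffOn.congr (f := _) h fun x hx => ?_
    have hx' : x ∈ (trivializationAt (EuclideanSpace ℝ (Fin n))
      (TangentSpace (𝓡 n) : M → Type _) x₀).baseSet := hx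
    rw [Trivialization.localFrame_apply_of_mem_baseSet _ _ hx']
    simp only [Trivialization.basisAt, Module.Basis.map_apply, OrthonormalBasis.coe_toBasis]
    congr 1
    exact Trivialization.symmL_apply _ hx' _
  refine continuousOn_pi.mpr fun i => continuousOn_pi.mpr fun j => ?_
  exact (ContMDiffOn.inner_bundle (hf i) (hf j)).continuousOn

variable [MeasurableSpace M]

/-- Measurability of a differential form with respect to the (completed) Riemannian measure: its
coordinate expressions are measurable. -/
def IsMeasurableForm (α : FormField n M k) : Prop :=
  ∀ x₀ : M, AEStronglyMeasurable (inChart α x₀)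
    ((riemannianVolume n M).restrict (chartAt (EuclideanSpace ℝ (Fin n)) x₀).source)

theorem IsMeasurableForm.add {α β : FormField n M k} (hα : IsMeasurableForm α)
    (hβ : IsMeasurableForm β) : IsMeasurableForm (α + β) :=
  fun x₀ => AEStronglyMeasurable.add (hα x₀) (hβ x₀)

theorem IsMeasurableForm.smul (c : ℝ) {α : FormField n M k} (hα : IsMeasurableForm α) :
    IsMeasurableForm (c • α) :=
  fun x₀ => AEStronglyMeasurable.const_smul (hα x₀) c

theorem IsMeasurableForm.zero : IsMeasurableForm (0 : FormField n M k) :=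
  fun _ => aestronglyMeasurable_const (b := 0)

variable [IsContMDiffRiemannianBundle (𝓡 n) ∞ (EuclideanSpace ℝ (Fin n))
  (fun x : M => TangentSpace (𝓡 n) x)]

theorem IsMeasurableForm.aestronglyMeasurable_formNorm [BorelSpace M] [SecondCountableTopology M]
    {α : FormField n M k} (hα : IsMeasurableForm α) :
    AEStronglyMeasurable (fun x => formNorm (α x)) (riemannianVolume n M) := by
  obtain ⟨s, hs, hs'⟩ := TopologicalSpace.countable_cover_nhds
    (fun x : M => chart_source_mem_nhds (EuclideanSpace ℝ (Fin n)) x)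
  have : Countable s := hs
  rw [← Measure.restrict_univ (μ := riemannianVolume n M), ← hs', Set.biUnion_eq_iUnion,
    aestronglyMeasurable_iUnion_iff]
  rintro ⟨x₀, -⟩
  set U := (chartAt (EuclideanSpace ℝ (Fin n)) x₀).source
  have hU : MeasurableSet U := (chartAt (EuclideanSpace ℝ (Fin n)) x₀).open_source.measurableSet
  have hG := continuousOn_chartGram (n := n) x₀
  have hinv : ∀ i j, AEMeasurable (fun x => (chartGram (n := n) x₀ x)⁻¹ i j)
      ((riemannianVolume n M).restrict U) := by
    intro i j
    have hdet : ContinuousOn (fun x => (chartGram (n := n) x₀ x).det) U := by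
      exact (Continuous.matrix_det continuous_id).comp_continuousOn hG
    have hadj : ContinuousOn (fun x => (chartGram (n := n) x₀ x).adjugate i j) U :=
      ((Continuous.matrix_adjugate continuous_id).matrix_elem i j).comp_continuousOn hG
    have := (hdet.aemeasurable (μ := riemannianVolume n M) hU).inv.mul
      (hadj.aemeasurable (μ := riemannianVolume n M) hU)
    refine this.congr (Filter.Eventually.of_forall fun x => ?_)
    simp [Matrix.inv_def]
  have hev : ∀ v : Fin k → EuclideanSpace ℝ (Fin n), AEMeasurable (fun x => inChart α x₀ x v)
      ((riemannianVolume n M).restrict U) := by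
    intro v
    exact ((ContinuousAlternatingMap.apply ℝ (EuclideanSpace ℝ (Fin n)) ℝ v).continuous
      |>.comp_aestronglyMeasurable (hα x₀)).aemeasurable
  have hsum : AEMeasurable (fun x => ∑ m : Fin k → Fin n, α x (fun a => tangentONB x (m a)) ^ 2)
      ((riemannianVolume n M).restrict U) := by
    have : AEMeasurable (fun x => ∑ i : Fin k → Fin n, ∑ j : Fin k → Fin n,
          (∏ a, (chartGram x₀ x)⁻¹ (i a) (j a)) *
          (inChart α x₀ x (fun a => EuclideanSpace.basisFun (Fin n) ℝ (i a)) *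
           inChart α x₀ x (fun a => EuclideanSpace.basisFun (Fin n) ℝ (j a))))
        ((riemannianVolume n M).restrict U) := by
      refine Finset.aemeasurable_fun_sum _ fun i _ => Finset.aemeasurable_fun_sum _ fun j _ => ?_
      exact (Finset.aemeasurable_fun_prod _ fun a _ => hinv _ _).mul ((hev _).mul (hev _))
    refine this.congr ?_
    filter_upwards [ae_restrict_mem hU] with x hx
    exact (sum_sq_eq_chartGram α hx).symm
  exact (hsum.div_const _).sqrt.aestronglyMeasurable

end Lebesgue

section Wedge

/-- The exterior product of alternating forms of complementary degrees `k + l = n`,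
`(α ∧ β)(v) = ∑ sign(σ) α(v_{σ(1)}, …, v_{σ(k)}) β(v_{σ(k+1)}, …, v_{σ(n)})`, the sum being over
the `(k, l)`-shuffles `σ`. -/
def wedge {V : Type*} [AddCommGroup V] [Module ℝ V] {k l n : ℕ} (h : k + l = n)
    (α : V [⋀^Fin k]→ₗ[ℝ] ℝ) (β : V [⋀^Fin l]→ₗ[ℝ] ℝ) : V [⋀^Fin n]→ₗ[ℝ] ℝ :=
  ((LinearMap.mul' ℝ ℝ).compAlternatingMap (α.domCoprod β)).domDomCongr
    (finSumFinEquiv.trans (finCongr h))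

theorem wedge_add_left {V : Type*} [AddCommGroup V] [Module ℝ V] {k l n : ℕ} (h : k + l = n)
    (α α' : V [⋀^Fin k]→ₗ[ℝ] ℝ) (β : V [⋀^Fin l]→ₗ[ℝ] ℝ) :
    wedge h (α + α') β = wedge h α β + wedge h α' β := by
  ext v
  simp only [wedge, ← AlternatingMap.domCoprod'_apply, TensorProduct.add_tmul, map_add]
  simp

theorem wedge_smul_left {V : Type*} [AddCommGroup V] [Module ℝ V] {k l n : ℕ} (h : k + l = n)
    (c : ℝ) (α : V [⋀^Fin k]→ₗ[ℝ] ℝ) (β : V [⋀^Fin l]→ₗ[ℝ] ℝ) :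
    wedge h (c • α) β = c • wedge h α β := by
  ext v
  simp only [wedge, ← AlternatingMap.domCoprod'_apply, ← TensorProduct.smul_tmul', map_smul]
  simp

variable {n : ℕ} {M : Type*} [TopologicalSpace M] [ChartedSpace (EuclideanSpace ℝ (Fin n)) M]
  [IsManifold (𝓡 n) ∞ M]

variable (n M) in
/-- An orientation of the manifold `M`: an orientation of every tangent space, which is locally
constant when read in the charts. -/
structure ManifoldOrientation where
  /-- The orientation of the tangent space at a point. -/
  at' (x : M) : Orientation ℝ (TangentSpace (𝓡 n) x) (Fin n)
  locally_constant (x₀ : M) : ∃ o : Orientation ℝ (EuclideanSpace ℝ (Fin n)) (Fin n),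
    ∀ᶠ x in 𝓝 x₀, ∀ hx : x ∈ (trivializationAt (EuclideanSpace ℝ (Fin n))
      (TangentSpace (𝓡 n) : M → Type _) x₀).baseSet,
      Orientation.map (Fin n) ((trivializationAt (EuclideanSpace ℝ (Fin n))
        (TangentSpace (𝓡 n) : M → Type _) x₀).continuousLinearEquivAt ℝ x hx).toLinearEquiv
        (at' x) = o

variable [RiemannianBundle (fun x : M => TangentSpace (𝓡 n) x)] {k l m : ℕ}

/-- The function `f` such that `α ∧ β = f · vol`, where `vol` is the Riemannian volume form of the
oriented manifold `M`. -/
def wedgeDensity (o : ManifoldOrientation n M) (h : k + l = n) (α : FormField n M k)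
    (β : FormField n M l) (x : M) : ℝ :=
  wedge h (α x).toAlternatingMap (β x).toAlternatingMap (tangentONB x) *
    (o.at' x).volumeForm (tangentONB x)

theorem wedgeDensity_add_left (o : ManifoldOrientation n M) (h : k + l = n)
    (α α' : FormField n M k) (β : FormField n M l) :
    wedgeDensity o h (α + α') β = wedgeDensity o h α β + wedgeDensity o h α' β := by
  funext x
  have := wedge_add_left h (α x).toAlternatingMap (α' x).toAlternatingMap (β x).toAlternatingMap
  change wedge h ((α x).toAlternatingMap + (α' x).toAlternatingMap) (β x).toAlternatingMap
    (tangentONB x) * _ = _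
  rw [this, AlternatingMap.add_apply, add_mul]
  rfl

theorem wedgeDensity_smul_left (o : ManifoldOrientation n M) (h : k + l = n) (c : ℝ)
    (α : FormField n M k) (β : FormField n M l) :
    wedgeDensity o h (c • α) β = c • wedgeDensity o h α β := by
  funext x
  have := wedge_smul_left h c (α x).toAlternatingMap (β x).toAlternatingMap
  change wedge h (c • (α x).toAlternatingMap) (β x).toAlternatingMap (tangentONB x) * _ = _
  rw [this, AlternatingMap.smul_apply, smul_eq_mul, mul_assoc]
  rfl

theorem wedgeDensity_zero_left (o : ManifoldOrientation n M) (h : k + l = n)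
    (β : FormField n M l) : wedgeDensity o h (0 : FormField n M k) β = 0 := by
  simpa using wedgeDensity_smul_left o h 0 (0 : FormField n M k) β

end Wedge

section Spaces

variable {n : ℕ} {M : Type*} [TopologicalSpace M] [ChartedSpace (EuclideanSpace ℝ (Fin n)) M]
  [IsManifold (𝓡 n) ∞ M] [SecondCountableTopology M] [MeasurableSpace M] [BorelSpace M]
  [RiemannianBundle (fun x : M => TangentSpace (𝓡 n) x)]
  [IsContMDiffRiemannianBundle (𝓡 n) ∞ (EuclideanSpace ℝ (Fin n))
    (fun x : M => TangentSpace (𝓡 n) x)]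

variable (n M) in
/-- The vector space of measurable `k`-forms `α` on `M` with `∫ |α|^p dvol < ∞`
(essentially bounded ones if `p = ∞`). -/
def integrableForms (k : ℕ) (p : ℝ≥0∞) :
    Submodule ℝ (FormField n M k) where
  carrier := {α | IsMeasurableForm α ∧
    eLpNorm (fun x => formNorm (α x)) p (riemannianVolume n M) < ⊤}
  add_mem' := by
    rintro α β ⟨hα, hα'⟩ ⟨hβ, hβ'⟩
    refine ⟨hα.add hβ, ?_⟩
    have h1 : MemLp (fun x => formNorm (α x)) p (riemannianVolume n M) :=
      ⟨hα.aestronglyMeasurable_formNorm, hα'⟩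
    have h2 : MemLp (fun x => formNorm (β x)) p (riemannianVolume n M) :=
      ⟨hβ.aestronglyMeasurable_formNorm, hβ'⟩
    refine lt_of_le_of_lt (eLpNorm_mono_real fun x => ?_) (h1.add h2).2
    rw [Real.norm_of_nonneg (formNorm_nonneg _)]
    exact formNorm_add_le _ _
  zero_mem' := by
    refine ⟨IsMeasurableForm.zero, ?_⟩
    simp [formNorm_zero]
  smul_mem' := by
    rintro c α ⟨hα, hα'⟩
    refine ⟨hα.smul c, ?_⟩
    have : (fun x => formNorm ((c • α) x)) = ‖c‖ • fun x => formNorm (α x) := by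
      funext x; exact formNorm_smul c (α x)
    change eLpNorm (fun x => formNorm ((c • α) x)) p (riemannianVolume n M) < ⊤
    rw [this, eLpNorm_const_smul]
    exact ENNReal.mul_lt_top (by simp) hα'

variable (n M) in
/-- The vector space of `p`-integrable `k`-forms, as a type carrying the `L^p` seminorm
(two forms which agree almost everywhere are not identified yet). -/
def PreLpForms (k : ℕ) (p : ℝ≥0∞) : Type _ :=
  integrableForms n M k p

variable {k l : ℕ} {p q : ℝ≥0∞}

instance : AddCommGroup (PreLpForms n M k p) :=
  inferInstanceAs (AddCommGroup (integrableForms n M k p))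

instance : Module ℝ (PreLpForms n M k p) :=
  inferInstanceAs (Module ℝ (integrableForms n M k p))

/-- The underlying differential form. -/
def PreLpForms.form : PreLpForms n M k p →ₗ[ℝ] FormField n M k := (integrableForms n M k p).subtype

theorem PreLpForms.memLp (α : PreLpForms n M k p) :
    MemLp (fun x => formNorm (α.form x)) p (riemannianVolume n M) :=
  ⟨α.2.1.aestronglyMeasurable_formNorm, α.2.2⟩

/-- The `L^p` seminorm `‖α‖_p = (∫ |α|^p dvol)^{1/p}`. -/
instance : Norm (PreLpForms n M k p) :=
  ⟨fun α => (eLpNorm (fun x => formNorm (α.form x)) p (riemannianVolume n M)).toReal⟩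

theorem PreLpForms.norm_def (α : PreLpForms n M k p) :
    ‖α‖ = (eLpNorm (fun x => formNorm (α.form x)) p (riemannianVolume n M)).toReal := rfl

theorem PreLpForms.norm_smul (c : ℝ) (α : PreLpForms n M k p) : ‖c • α‖ = ‖c‖ * ‖α‖ := by
  have : (fun x => formNorm ((c • α).form x)) = ‖c‖ • fun x => formNorm (α.form x) := by
    funext x
    rw [map_smul]
    exact formNorm_smul c (α.form x)
  rw [norm_def, this, eLpNorm_const_smul, ENNReal.toReal_mul, ← norm_def]
  simp

variable [Fact (1 ≤ p)] [Fact (1 ≤ q)]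

theorem PreLpForms.norm_add_le (α β : PreLpForms n M k p) : ‖α + β‖ ≤ ‖α‖ + ‖β‖ := by
  rw [norm_def, norm_def, norm_def,
    ← ENNReal.toReal_add α.memLp.eLpNorm_ne_top β.memLp.eLpNorm_ne_top]
  refine ENNReal.toReal_mono
    (ENNReal.add_ne_top.mpr ⟨α.memLp.eLpNorm_ne_top, β.memLp.eLpNorm_ne_top⟩) ?_
  refine le_trans (eLpNorm_mono_real fun x => ?_) (eLpNorm_add_le α.memLp.1 β.memLp.1 Fact.out)
  rw [Real.norm_of_nonneg (formNorm_nonneg _), map_add]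
  exact formNorm_add_le _ _

instance : SeminormedAddCommGroup (PreLpForms n M k p) :=
  AddGroupSeminorm.toSeminormedAddCommGroup
    { toFun := fun α => ‖α‖
      map_zero' := by simpa using PreLpForms.norm_smul (0 : ℝ) (0 : PreLpForms n M k p)
      add_le' := PreLpForms.norm_add_le
      neg' := fun α => by simpa using PreLpForms.norm_smul (-1 : ℝ) α }

instance : NormedSpace ℝ (PreLpForms n M k p) where
  norm_smul_le c α := (PreLpForms.norm_smul c α).le

variable (n M) in
/-- The Banach space `L^p(M, Λᵏ)`: the space of `p`-integrable `k`-forms, in which forms at `L^p`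
distance zero (i.e. which agree almost everywhere) are identified. -/
abbrev LpForms (k : ℕ) (p : ℝ≥0∞) [Fact (1 ≤ p)] : Type _ :=
  SeparationQuotient (PreLpForms n M k p)

/-- The class in `L^p(M, Λᵏ)` of a `p`-integrable form. -/
def toLpForms : PreLpForms n M k p →L[ℝ] LpForms n M k p :=
  SeparationQuotient.mkCLM ℝ (PreLpForms n M k p)

/-- `θ` is the weak exterior differential of the `k`-form `φ`:
`∫_M θ ∧ η = (-1)^{k+1} ∫_M φ ∧ dη` for all smooth `(n-k-1)`-forms `η` with compact support
(the integrals being required to exist). -/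
def IsWeakExtD (o : ManifoldOrientation n M) (φ : FormField n M k) (θ : FormField n M (k + 1)) :
    Prop :=
  ∀ (m : ℕ) (h : k + 1 + m = n) (h' : k + (m + 1) = n), ∀ η ∈ testForms n M m,
    Integrable (wedgeDensity o h θ η) (riemannianVolume n M) ∧
    Integrable (wedgeDensity o h' φ (extD η)) (riemannianVolume n M) ∧
    ∫ x, wedgeDensity o h θ η x ∂(riemannianVolume n M) =
      (-1) ^ (k + 1) * ∫ x, wedgeDensity o h' φ (extD η) x ∂(riemannianVolume n M)

/-- The subspace of weakly closed forms: those which have weak exterior differential `0`. -/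
def preClosedForms (o : ManifoldOrientation n M) (k : ℕ) (p : ℝ≥0∞) [Fact (1 ≤ p)] :
    Submodule ℝ (PreLpForms n M k p) where
  carrier := {α | IsWeakExtD o α.form 0}
  add_mem' := by
    intro α β hα hβ m h h' η hη
    obtain ⟨-, a2, a3⟩ := hα m h h' η hη
    obtain ⟨-, b2, b3⟩ := hβ m h h' η hη
    simp only [wedgeDensity_zero_left, map_add, wedgeDensity_add_left, integrable_zero] at *
    refine ⟨trivial, a2.add b2, ?_⟩
    rw [integral_add' a2 b2, mul_add, ← a3, ← b3]
    simp
  zero_mem' := by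
    intro m h h' η hη
    simp only [map_zero, wedgeDensity_zero_left]
    exact ⟨integrable_zero _ _ _, integrable_zero _ _ _, by simp⟩
  smul_mem' := by
    intro c α hα m h h' η hη
    obtain ⟨-, a2, a3⟩ := hα m h h' η hη
    simp only [wedgeDensity_zero_left, map_smul, wedgeDensity_smul_left] at *
    refine ⟨integrable_zero _ _ _, a2.smul c, ?_⟩
    simp only [Pi.smul_apply, smul_eq_mul, integral_const_mul]
    rw [mul_left_comm, ← a3]
    simp

/-- The space `Z^k_p(M) ⊆ L^p(M, Λᵏ)` of weakly closed `p`-integrable `k`-forms. -/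
def closedForms (o : ManifoldOrientation n M) (k : ℕ) (p : ℝ≥0∞) [Fact (1 ≤ p)] :
    Submodule ℝ (LpForms n M k p) :=
  (preClosedForms o k p).map (toLpForms (n := n) (M := M) (k := k) (p := p)).toLinearMap

/-- The space of forms `dη` where `η` is a smooth `(k-1)`-form with compact support
(it is zero if `k = 0`). -/
def exactTestForms (n : ℕ) (M : Type*) [TopologicalSpace M]
    [ChartedSpace (EuclideanSpace ℝ (Fin n)) M] [IsManifold (𝓡 n) ∞ M] :
    (k : ℕ) → Submodule ℝ (FormField n M k)
  | 0 => ⊥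
  | k + 1 =>
    { carrier := {α | ∃ η ∈ testForms n M k, extD η = α}
      add_mem' := by
        rintro _ _ ⟨η, hη, rfl⟩ ⟨ζ, hζ, rfl⟩
        exact ⟨η + ζ, add_mem hη hζ, extD_add hη.1 hζ.1⟩
      zero_mem' := ⟨0, zero_mem _, by simpa using extD_smul (0 : ℝ) (0 : FormField n M k)⟩
      smul_mem' := by
        rintro c _ ⟨η, hη, rfl⟩
        exact ⟨c • η, Submodule.smul_mem _ c hη, extD_smul c η⟩ }

variable (n M) in
/-- The closure of `d𝓓^{k-1}` in `L^p(M, Λᵏ)`. -/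
def exactClosure (k : ℕ) (p : ℝ≥0∞) [Fact (1 ≤ p)] :
    Submodule ℝ (LpForms n M k p) :=
  (((exactTestForms n M k).comap PreLpForms.form).map
    (toLpForms (n := n) (M := M) (k := k) (p := p)).toLinearMap).topologicalClosure

/-- The reduced `(comp, p)`-cohomology `Z^k_p(M) / closure(d𝓓^{k-1})`, with the quotient norm. -/
abbrev ReducedCompCohomology (o : ManifoldOrientation n M) (k : ℕ) (p : ℝ≥0∞) [Fact (1 ≤ p)] :
    Type _ :=
  closedForms o k p ⧸ (exactClosure n M k p).submoduleOf (closedForms o k p)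

/-- The cohomology class of a weakly closed `p`-integrable form. -/
def cohomologyClass (o : ManifoldOrientation n M) (α : preClosedForms o k p) :
    ReducedCompCohomology o k p :=
  Submodule.Quotient.mk ⟨toLpForms α.1, Submodule.mem_map_of_mem α.2⟩

end Spaces

end RiemannianForms

end

open RiemannianForms

/-! The theorem is a statement about annihilators. By Hölder and the duality of Lebesgue spaces, `∫
ω ∧ φ` puts `X = L^p(M, Λᵏ)` and `Y = L^q(M, Λˡ)`, `k + l = n`, in perfect duality: every functional
on either space is given by an element of the other (`exists_integral_pairing`). Let `E_X` and `E_Y`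
be the subspaces of differentials of test forms. Being weakly closed is being orthogonal to the
differentials of test forms, so `Z_X = E_Y^⊥` and `Z_Y = E_X^⊥` (`mem_closedForms_iff`); the sign in
the definition of the weak differential plays no role because that differential is zero. Stokes'
theorem says that `E_X` and `E_Y` are orthogonal, hence `E_X ⊆ Z_X` and `E_Y ⊆ Z_Y`
(`integral_wedgeDensity_exact`).

The rest is Hahn–Banach (`exists_annihilator_quotient_equiv_dual`). A functional on `Z_Y` vanishing
on `E_Y` extends to `Y` and is represented by some `x`, which lies in `E_Y^⊥ = Z_X`. If `x` pairs to
zero with all of `Z_Y = E_X^⊥`, then every functional vanishing on `E_X` vanishes at `x`, so `x`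
lies in the closure of `E_X`.

The duality of spaces of forms is reduced to that of vector valued functions by a measurable frame
that is uniformly comparable to orthonormal frames (`nonempty_boundedFrame`,
`BoundedFrame.exists_lpEquiv`). In such a frame the exterior product is a constant bilinear form,
which is nondegenerate by linear algebra, times the inverse volume of the frame
(`wedgeDensity_eq_coords`). The scalar case rests on Radon–Nikodym (`lpPairing_mul_surjective`).

Stokes' theorem `∫ dη ∧ dζ = 0` is proved on `ℝⁿ` by one integration by parts and the symmetry of
second derivatives (`integral_wedge_extDeriv_extDeriv`), and carried to `M` by a partition of unity.
In a chart the measure is `√det(g_{ij}) dy` (`riemannianVolume_restrict_source`), and a locally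
constant orientation gives the volume form of the chart frame a locally constant sign. -/

noncomputable section

namespace RiemannianForms

/-! ### Exterior products on a vector space. -/

section WedgeAlgebra

variable {V V' : Type*} [AddCommGroup V] [Module ℝ V] [AddCommGroup V'] [Module ℝ V'] {k l n : ℕ}

/-- The order preserving identification of `Fin k ⊕ Fin l` with `Fin n` used by `wedge`. -/
def sumFinEquiv (h : k + l = n) : Fin k ⊕ Fin l ≃ Fin n := finSumFinEquiv.trans (finCongr h)

/-- The exterior product as an alternating sum over all permutations. -/
theorem factorial_mul_wedge (h : k + l = n) (α : V [⋀^Fin k]→ₗ[ℝ] ℝ) (β : V [⋀^Fin l]→ₗ[ℝ] ℝ)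
    (v : Fin n → V) :
    ((k.factorial * l.factorial : ℕ) : ℝ) * wedge h α β v =
      ∑ σ : Equiv.Perm (Fin k ⊕ Fin l), ((Equiv.Perm.sign σ : ℤ) : ℝ) *
        (α (fun i => v (sumFinEquiv h (σ (Sum.inl i)))) *
          β (fun j => v (sumFinEquiv h (σ (Sum.inr j))))) := by
  -- Each class of permutations modulo those preserving the two blocks has `k! l!` elements.
  -- Clearing this factor replaces the sum over shuffles by one over a whole group, where reindexing
  -- is free.
  have key := congrArg (fun f => LinearMap.mul' ℝ ℝ (f (fun s => v (sumFinEquiv h s))))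
    (MultilinearMap.domCoprod_alternization_eq α β)
  simp only [Fintype.card_fin, AlternatingMap.smul_apply, map_nsmul,
    MultilinearMap.alternatization_apply, map_sum] at key
  rw [← nsmul_eq_mul]
  refine Eq.trans key.symm (Finset.sum_congr rfl fun σ _ => ?_)
  rw [Units.smul_def, map_zsmul, zsmul_eq_mul]
  rfl

theorem factorial_mul_ne_zero (k l : ℕ) : ((k.factorial * l.factorial : ℕ) : ℝ) ≠ 0 :=
  Nat.cast_ne_zero.mpr (Nat.mul_ne_zero (Nat.factorial_ne_zero _) (Nat.factorial_ne_zero _))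

theorem wedge_add_right (h : k + l = n) (α : V [⋀^Fin k]→ₗ[ℝ] ℝ) (β β' : V [⋀^Fin l]→ₗ[ℝ] ℝ) :
    wedge h α (β + β') = wedge h α β + wedge h α β' := by
  ext v
  refine mul_left_cancel₀ (factorial_mul_ne_zero k l) ?_
  simp only [AlternatingMap.add_apply, mul_add, factorial_mul_wedge, ← Finset.sum_add_distrib]

theorem wedge_smul_right (h : k + l = n) (c : ℝ) (α : V [⋀^Fin k]→ₗ[ℝ] ℝ)
    (β : V [⋀^Fin l]→ₗ[ℝ] ℝ) : wedge h α (c • β) = c • wedge h α β := by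
  ext v
  refine mul_left_cancel₀ (factorial_mul_ne_zero k l) ?_
  rw [AlternatingMap.smul_apply, smul_eq_mul, mul_left_comm, factorial_mul_wedge,
    factorial_mul_wedge, Finset.mul_sum]
  refine Finset.sum_congr rfl fun σ _ => ?_
  simp only [AlternatingMap.smul_apply, smul_eq_mul]
  ring

theorem wedge_compLinearMap (h : k + l = n) (T : V' →ₗ[ℝ] V) (α : V [⋀^Fin k]→ₗ[ℝ] ℝ)
    (β : V [⋀^Fin l]→ₗ[ℝ] ℝ) :
    wedge h (α.compLinearMap T) (β.compLinearMap T) = (wedge h α β).compLinearMap T := by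
  ext v
  refine mul_left_cancel₀ (factorial_mul_ne_zero k l) ?_
  rw [AlternatingMap.compLinearMap_apply, factorial_mul_wedge, factorial_mul_wedge]
  rfl

/-- The exterior product is commutative up to a sign that depends only on the degrees. -/
theorem exists_wedge_comm (h : k + l = n) (h' : l + k = n) :
    ∃ ε : ℝ, ε * ε = 1 ∧ ∀ (α : V [⋀^Fin k]→ₗ[ℝ] ℝ) (β : V [⋀^Fin l]→ₗ[ℝ] ℝ),
      wedge h α β = ε • wedge h' β α := by
  classical
  -- The permutation exchanging the two blocks. Its sign is `(-1)^(kl)`, but only `ε² = 1` is ever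
  -- needed.
  let τ : Equiv.Perm (Fin n) :=
    (sumFinEquiv h').symm.trans ((Equiv.sumComm (Fin l) (Fin k)).trans (sumFinEquiv h))
  refine ⟨((Equiv.Perm.sign τ : ℤ) : ℝ), ?_, fun α β => ?_⟩
  · rw [← Int.cast_mul, ← Units.val_mul, Int.units_mul_self]; simp
  · ext v
    have hτ : ((Equiv.Perm.sign τ : ℤ) : ℝ) * wedge h' β α v = wedge h' β α (v ∘ τ) := by
      rw [AlternatingMap.map_perm, Units.smul_def, zsmul_eq_mul]
    rw [AlternatingMap.smul_apply, smul_eq_mul, hτ]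
    refine mul_left_cancel₀ (factorial_mul_ne_zero k l) ?_
    rw [factorial_mul_wedge, mul_comm k.factorial, factorial_mul_wedge]
    -- Conjugation by the exchange of the summands matches the two sums and preserves signs.
    refine Fintype.sum_equiv (Equiv.permCongr (Equiv.sumComm (Fin k) (Fin l))) _ _ fun σ => ?_
    rw [Equiv.Perm.sign_permCongr, mul_comm (α _)]
    simp [τ, Equiv.permCongr_apply]

/-- If every vector of a family is killed either by `α` or by `β` whenever it is one of the
arguments, except for the first `k` vectors in `α` and the last `l` ones in `β`, then only
the term `α(v₁, …, v_k) β(v_{k+1}, …, v_n)` of the exterior product survives. -/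
theorem exists_wedge_eq_mul (h : k + l = n) (α : V [⋀^Fin k]→ₗ[ℝ] ℝ)
    (β : V [⋀^Fin l]→ₗ[ℝ] ℝ) (v : Fin n → V)
    (hβ : ∀ w : Fin l → V, (∃ (j : Fin l) (i : Fin k), w j = v (sumFinEquiv h (Sum.inl i))) →
      β w = 0) :
    ∃ c : ℝ, c ≠ 0 ∧ wedge h α β v = c * (α (fun i => v (sumFinEquiv h (Sum.inl i))) *
      β (fun j => v (sumFinEquiv h (Sum.inr j)))) := by
  classical
  set a := α (fun i => v (sumFinEquiv h (Sum.inl i)))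
  set b := β (fun j => v (sumFinEquiv h (Sum.inr j)))
  -- The permutations preserving both blocks. On them the signs from `α` and `β` cancel the sign of
  -- `σ`, so each contributes `a * b`; any other `σ` feeds a vector of the first block to `β`. The
  -- resulting constant is in fact `1`, but only its nonvanishing matters.
  let S : Finset (Equiv.Perm (Fin k ⊕ Fin l)) :=
    Finset.univ.filter fun σ => σ ∈ (Equiv.Perm.sumCongrHom (Fin k) (Fin l)).range
  have hS : (S.card : ℝ) ≠ 0 := by
    refine Nat.cast_ne_zero.mpr (Finset.card_ne_zero_of_mem (a := 1) ?_)
    simp only [S, Finset.mem_filter, Finset.mem_univ, true_and]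
    exact one_mem _
  refine ⟨S.card / ((k.factorial * l.factorial : ℕ) : ℝ),
    div_ne_zero hS (factorial_mul_ne_zero k l), ?_⟩
  rw [div_mul_eq_mul_div, eq_div_iff (factorial_mul_ne_zero k l), mul_comm,
    factorial_mul_wedge]
  have : ∀ σ : Equiv.Perm (Fin k ⊕ Fin l), ((Equiv.Perm.sign σ : ℤ) : ℝ) *
        (α (fun i => v (sumFinEquiv h (σ (Sum.inl i)))) *
          β (fun j => v (sumFinEquiv h (σ (Sum.inr j))))) = if σ ∈ S then a * b else 0 := by
    intro σ
    split_ifs with hσ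
    · obtain ⟨⟨s, t⟩, rfl⟩ := (Finset.mem_filter.mp hσ).2
      simp only [Equiv.Perm.sumCongrHom_apply, Equiv.Perm.sumCongr_apply, Sum.map_inl,
        Sum.map_inr, Equiv.Perm.sign_sumCongr]
      have h1 : α (fun i => v (sumFinEquiv h (Sum.inl (s i)))) =
          ((Equiv.Perm.sign s : ℤ) : ℝ) * a := by
        have := α.map_perm (fun i => v (sumFinEquiv h (Sum.inl i))) s
        rw [Units.smul_def, zsmul_eq_mul] at this
        exact this
      have h2 : β (fun i => v (sumFinEquiv h (Sum.inr (t i)))) =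
          ((Equiv.Perm.sign t : ℤ) : ℝ) * b := by
        have := β.map_perm (fun i => v (sumFinEquiv h (Sum.inr i))) t
        rw [Units.smul_def, zsmul_eq_mul] at this
        exact this
      rw [h1, h2]
      have e1 : ((Equiv.Perm.sign s : ℤ) : ℝ) * ((Equiv.Perm.sign s : ℤ) : ℝ) = 1 := by
        rw [← Int.cast_mul, ← Units.val_mul, Int.units_mul_self]; simp
      have e2 : ((Equiv.Perm.sign t : ℤ) : ℝ) * ((Equiv.Perm.sign t : ℤ) : ℝ) = 1 := by
        rw [← Int.cast_mul, ← Units.val_mul, Int.units_mul_self]; simp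
      push_cast
      linear_combination
        (((Equiv.Perm.sign t : ℤ) : ℝ) * ((Equiv.Perm.sign t : ℤ) : ℝ) * a * b) * e1
        + a * b * e2
    · have hσ' : ¬ Set.MapsTo σ (Set.range Sum.inl) (Set.range Sum.inl) := fun hm =>
        hσ (Finset.mem_filter.mpr ⟨Finset.mem_univ _,
          Equiv.Perm.mem_sumCongrHom_range_of_perm_mapsTo_inl hm⟩)
      have : ∃ (j : Fin l) (i : Fin k), σ (Sum.inr j) = Sum.inl i := by
        by_contra! hcon
        refine hσ' ?_
        have hr : Set.MapsTo σ (Set.range Sum.inr)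
            (Set.range (Sum.inr : Fin l → Fin k ⊕ Fin l)) := by
          rintro _ ⟨j, rfl⟩
          rcases hs : σ (Sum.inr j) with i | j'
          · exact absurd hs (hcon j i)
          · exact ⟨j', rfl⟩
        exact (Equiv.Perm.perm_mapsTo_inl_iff_mapsTo_inr σ).mpr hr
      obtain ⟨j, i, hij⟩ := this
      rw [hβ _ ⟨j, i, by rw [hij]⟩, mul_zero, mul_zero]
  rw [Finset.sum_congr rfl fun σ _ => this σ, Finset.sum_ite_mem, Finset.univ_inter,
    Finset.sum_const, nsmul_eq_mul]

/-- A form of degree `k` whose exterior product with all forms of complementary degree vanishes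
is zero. -/
theorem eq_zero_of_wedge_eq_zero (h : k + l = n) (e : Module.Basis (Fin n) ℝ V)
    (α : V [⋀^Fin k]→ₗ[ℝ] ℝ) (hα : ∀ β : V [⋀^Fin l]→ₗ[ℝ] ℝ, wedge h α β = 0) : α = 0 := by
  classical
  refine e.ext_alternating fun I hI => ?_
  have hc : Fintype.card (Fin l) = Fintype.card ((Set.range I)ᶜ : Set (Fin n)) := by
    rw [Fintype.card_compl_set, Set.card_range_of_injective hI]
    simp; omega
  -- The index tuple `I` is completed by its complement to an enumeration of the basis. With `β` the
  -- determinant of the complementary coordinates, `α ∧ β` on the enumerated basis is a nonzero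
  -- multiple of `α(e_I)`.
  let u : Fin k ⊕ Fin l ≃ Fin n :=
    ((Equiv.ofInjective I hI).sumCongr (Fintype.equivOfCardEq hc)).trans
      (Equiv.Set.sumCompl (Set.range I))
  have hu : ∀ i, u (Sum.inl i) = I i := fun i => by simp [u]
  let b := e.reindex u.symm
  let v : Fin n → V := fun i => b ((sumFinEquiv h).symm i)
  let β : V [⋀^Fin l]→ₗ[ℝ] ℝ := Matrix.detRowAlternating.compLinearMap
    (LinearMap.pi fun j => b.coord (Sum.inr j))
  have hβ1 : ∀ w : Fin l → V, (∃ (j : Fin l) (i : Fin k), w j = v (sumFinEquiv h (Sum.inl i))) →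
      β w = 0 := by
    rintro w ⟨j, i, hji⟩
    refine Matrix.det_eq_zero_of_row_eq_zero j fun j' => ?_
    simp [hji, v]
  have hβ2 : β (fun j => v (sumFinEquiv h (Sum.inr j))) = 1 := by
    refine Eq.trans ?_ (Matrix.det_one (n := Fin l) (R := ℝ))
    refine congrArg Matrix.det ?_
    ext j j'
    simp [v, Matrix.one_apply, Finsupp.single_apply]
  obtain ⟨c, hc, hw⟩ := exists_wedge_eq_mul h α β v hβ1
  rw [hα, hβ2, mul_one, AlternatingMap.zero_apply, eq_comm, mul_eq_zero] at hw
  have := hw.resolve_left hc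
  simp only [v, Equiv.symm_apply_apply, b, Module.Basis.reindex_apply, Equiv.symm_symm, hu] at this
  simpa using this

/-- If `α` and `β` both vanish as soon as all their arguments lie in the kernel of a linear form
`φ`, then `α ∧ β = 0` (morally, both are multiples of `φ`). -/
theorem wedge_eq_zero_of_ker [FiniteDimensional ℝ V] (hn : Module.finrank ℝ V = n) (h : k + l = n)
    (φ : V →ₗ[ℝ] ℝ) (α : V [⋀^Fin k]→ₗ[ℝ] ℝ) (β : V [⋀^Fin l]→ₗ[ℝ] ℝ)
    (hα : ∀ w, (∀ i, φ (w i) = 0) → α w = 0) (hβ : ∀ w, (∀ i, φ (w i) = 0) → β w = 0) :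
    wedge h α β = 0 := by
  classical
  -- A basis with at most one vector outside `ker φ`. Among distinct basis vectors the exceptional
  -- one can be an argument of only one factor, so in every term the other factor vanishes.
  obtain ⟨b, hb⟩ : ∃ b : Module.Basis (Fin n) ℝ V, ∀ i j, φ (b i) ≠ 0 → φ (b j) ≠ 0 → i = j := by
    by_cases hφ : φ = 0
    · exact ⟨Module.finBasisOfFinrankEq ℝ V hn, fun i j hi => by simp [hφ] at hi⟩
    · obtain ⟨w, hw⟩ : ∃ w, φ w ≠ 0 := by
        by_contra! hcon
        exact hφ (LinearMap.ext hcon)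
      let c := Module.finBasis ℝ (LinearMap.ker φ)
      let d := Module.Basis.mkFinCons w c
        (fun t x hx hs => by
          have := congrArg φ hs
          rw [map_add, map_smul, LinearMap.mem_ker.mp hx, map_zero, add_zero, smul_eq_mul] at this
          exact (mul_eq_zero.mp this).resolve_right hw)
        (fun z => ⟨-(φ z / φ w), by simp [hw]⟩)
      have hd : ∀ i, φ (d i) ≠ 0 → i = 0 := by
        intro i
        refine Fin.cases (fun _ => rfl) (fun j hj => ?_) i
        refine absurd ?_ hj
        simp [d, Module.Basis.coe_mkFinCons]
      have hcard : Module.finrank ℝ (LinearMap.ker φ) + 1 = n := by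
        rw [← hn, Module.finrank_eq_card_basis d, Fintype.card_fin]
      refine ⟨d.reindex (finCongr hcard), fun i j hi hj => ?_⟩
      rw [Module.Basis.reindex_apply] at hi hj
      exact (finCongr hcard).symm.injective ((hd _ hi).trans (hd _ hj).symm)
  refine b.ext_alternating fun I hI => ?_
  refine mul_left_cancel₀ (factorial_mul_ne_zero k l) ?_
  rw [factorial_mul_wedge, AlternatingMap.zero_apply, mul_zero]
  refine Finset.sum_eq_zero fun σ _ => ?_
  by_cases hs : ∃ i, φ (b (I (sumFinEquiv h (σ (Sum.inl i))))) ≠ 0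
  · obtain ⟨i, hi⟩ := hs
    rw [hβ, mul_zero, mul_zero]
    intro j
    by_contra hj
    have := (sumFinEquiv h).injective (hI (hb _ _ hi hj))
    exact absurd (σ.injective this) (by simp)
  · push Not at hs
    rw [hα _ hs, zero_mul, mul_zero]

end WedgeAlgebra

/-! ### Forms on `ℝⁿ`: nondegeneracy of the exterior product and Stokes' theorem. -/

section EuclideanForms

set_option maxSynthPendingDepth 5

variable {k l n : ℕ}

/-- Alternating `k`-forms on `ℝⁿ`. -/
abbrev EuclForm (n k : ℕ) : Type := EuclideanSpace ℝ (Fin n) [⋀^Fin k]→L[ℝ] ℝ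

instance finiteDimensional_continuousAlternatingMap :
    FiniteDimensional ℝ (EuclForm n k) := by
  let f : (EuclForm n k) →ₗ[ℝ] ((Fin k → Fin n) → ℝ) :=
    { toFun := fun a I => a fun i => EuclideanSpace.basisFun (Fin n) ℝ (I i)
      map_add' := fun _ _ => rfl
      map_smul' := fun _ _ => rfl }
  refine Module.Finite.of_injective f fun a b hab => ?_
  refine ContinuousAlternatingMap.toAlternatingMap_injective ?_
  refine (EuclideanSpace.basisFun (Fin n) ℝ).toBasis.ext_alternating fun I _ => ?_
  simpa [f] using congrFun hab I

/-- Expanding all arguments in the standard basis exhibits the form as a polynomial in the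
coordinates. -/
theorem exists_continuous_toAlternatingMap_eq
    (a : EuclideanSpace ℝ (Fin n) [⋀^Fin k]→ₗ[ℝ] ℝ) :
    ∃ a' : EuclForm n k, a'.toAlternatingMap = a := by
  let e := EuclideanSpace.basisFun (Fin n) ℝ
  have h : ∀ v, a v = ∑ I : Fin k → Fin n, (∏ i, v i (I i)) * a (fun i => e (I i)) := by
    intro v
    have hv : v = fun i => ∑ j, v i j • e j := by
      funext i
      simpa [e] using ((e.sum_repr (v i)).symm)
    conv_lhs => rw [hv]
    refine (a.toMultilinearMap.map_sum fun i j => v i j • e j).trans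
      (Finset.sum_congr rfl fun I _ => ?_)
    exact a.toMultilinearMap.map_smul_univ (fun i => v i (I i)) fun i => e (I i)
  refine ⟨{ a with cont := ?_ }, rfl⟩
  refine Continuous.congr ?_ fun v => (h v).symm
  fun_prop

/-- The coefficient of the exterior product of two constant forms on Euclidean space with respect
to the standard volume form, as a continuous bilinear form. -/
def wedgeCLM (h : k + l = n) : (EuclForm n k) →L[ℝ]
    (EuclForm n l) →L[ℝ] ℝ :=
  LinearMap.toContinuousBilinearMap (LinearMap.mk₂ ℝ
    (fun a b => wedge h a.toAlternatingMap b.toAlternatingMap (EuclideanSpace.basisFun (Fin n) ℝ))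
    (fun a a' b => congrArg (fun f => f (EuclideanSpace.basisFun (Fin n) ℝ))
      (wedge_add_left h a.toAlternatingMap a'.toAlternatingMap b.toAlternatingMap))
    (fun c a b => congrArg (fun f => f (EuclideanSpace.basisFun (Fin n) ℝ))
      (wedge_smul_left h c a.toAlternatingMap b.toAlternatingMap))
    (fun a b b' => congrArg (fun f => f (EuclideanSpace.basisFun (Fin n) ℝ))
      (wedge_add_right h a.toAlternatingMap b.toAlternatingMap b'.toAlternatingMap))
    (fun c a b => congrArg (fun f => f (EuclideanSpace.basisFun (Fin n) ℝ))
      (wedge_smul_right h c a.toAlternatingMap b.toAlternatingMap)))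

theorem wedgeCLM_apply (h : k + l = n) (a : EuclForm n k)
    (b : EuclForm n l) :
    wedgeCLM h a b =
      wedge h a.toAlternatingMap b.toAlternatingMap (EuclideanSpace.basisFun (Fin n) ℝ) := rfl

/-- A top degree form is determined by its value on the standard basis, so nothing is lost by
recording this value only. -/
theorem wedgeCLM_injective (h : k + l = n) : Function.Injective (wedgeCLM (n := n) h) := by
  refine (injective_iff_map_eq_zero _).mpr fun a ha => ?_
  refine ContinuousAlternatingMap.toAlternatingMap_injective ?_
  refine eq_zero_of_wedge_eq_zero h (EuclideanSpace.basisFun (Fin n) ℝ).toBasis _ fun β => ?_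
  obtain ⟨b, rfl⟩ := exists_continuous_toAlternatingMap_eq β
  rw [AlternatingMap.eq_smul_basis_det (EuclideanSpace.basisFun (Fin n) ℝ).toBasis
    (wedge h a.toAlternatingMap b.toAlternatingMap), OrthonormalBasis.coe_toBasis,
    ← wedgeCLM_apply, ha]
  simp

/-- Injectivity for `(k, l)` and for `(l, k)` forces both spaces of forms to have equal dimension,
and an injective map into a dual space of the same dimension is onto. -/
theorem wedgeCLM_surjective (h : k + l = n) : Function.Surjective (wedgeCLM (n := n) h) := by
  have key : ∀ {k l : ℕ} (h : k + l = n),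
      Module.finrank ℝ (EuclForm n k) ≤
        Module.finrank ℝ (EuclForm n l) := by
    intro k l h
    have h1 := LinearMap.finrank_le_finrank_of_injective
      (f := (wedgeCLM (n := n) h).toLinearMap) (wedgeCLM_injective h)
    rwa [← (LinearMap.toContinuousLinearMap (𝕜 := ℝ)
      (E := (EuclForm n l)) (F' := ℝ)).finrank_eq,
      Subspace.dual_finrank_eq] at h1
  have hinj : Function.Injective (wedgeCLM (n := n) h).toLinearMap := wedgeCLM_injective h
  refine (LinearMap.injective_iff_surjective_of_finrank_eq_finrank ?_).mp hinj
  rw [← (LinearMap.toContinuousLinearMap (𝕜 := ℝ)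
      (E := (EuclForm n l)) (F' := ℝ)).finrank_eq,
      Subspace.dual_finrank_eq]
  exact le_antisymm (key h) (key ((add_comm l k).trans h))

/-- `T(A, B) = alt(A) ∧ alt(B)`; for `A = Dη` and `B = Dζ` this is `dη ∧ dζ`. -/
def wedgeAltCLM (h : (k + 1) + (l + 1) = n) :
    (EuclideanSpace ℝ (Fin n) →L[ℝ] EuclForm n k) →L[ℝ]
    (EuclideanSpace ℝ (Fin n) →L[ℝ] EuclForm n l) →L[ℝ] ℝ :=
  (wedgeCLM h).bilinearComp (ContinuousAlternatingMap.alternatizeUncurryFinCLM ℝ _ _)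
    (ContinuousAlternatingMap.alternatizeUncurryFinCLM ℝ _ _)

theorem wedgeAltCLM_fderiv (h : (k + 1) + (l + 1) = n)
    (η : EuclideanSpace ℝ (Fin n) → EuclForm n k)
    (ζ : EuclideanSpace ℝ (Fin n) → EuclForm n l)
    (y : EuclideanSpace ℝ (Fin n)) :
    wedgeAltCLM h (fderiv ℝ η y) (fderiv ℝ ζ y) = wedgeCLM h (extDeriv η y) (extDeriv ζ y) := rfl

/-- The alternatization of `φ ⊗ a` is `φ ∧ a`, and the product of two multiples of `φ` vanishes. -/
theorem wedgeAltCLM_smulRight_self (h : (k + 1) + (l + 1) = n)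
    (φ : StrongDual ℝ (EuclideanSpace ℝ (Fin n)))
    (a : EuclForm n k)
    (b : EuclForm n l) :
    wedgeAltCLM h (φ.smulRight a) (φ.smulRight b) = 0 := by
  have hz : ∀ {m : ℕ} (c : EuclForm n m)
      (w : Fin (m + 1) → EuclideanSpace ℝ (Fin n)), (∀ i, φ (w i) = 0) →
      (ContinuousAlternatingMap.alternatizeUncurryFin (φ.smulRight c)).toAlternatingMap w = 0 := by
    intro m c w hw
    refine (ContinuousAlternatingMap.alternatizeUncurryFin_apply (φ.smulRight c) w).trans ?_
    simp [hw]
  have := wedge_eq_zero_of_ker (finrank_euclideanSpace_fin (𝕜 := ℝ)) h φ.toLinearMap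
    (ContinuousAlternatingMap.alternatizeUncurryFin (φ.smulRight a)).toAlternatingMap
    (ContinuousAlternatingMap.alternatizeUncurryFin (φ.smulRight b)).toAlternatingMap (hz a) (hz b)
  exact congrArg (fun f => f (EuclideanSpace.basisFun (Fin n) ℝ)) this

/-- Polarization of the preceding identity. This antisymmetry is what kills the second derivatives
in Stokes' theorem. -/
theorem wedgeAltCLM_smulRight_swap (h : (k + 1) + (l + 1) = n)
    (φ ψ : StrongDual ℝ (EuclideanSpace ℝ (Fin n)))
    (a : EuclForm n k)
    (b : EuclForm n l) :
    wedgeAltCLM h (φ.smulRight a) (ψ.smulRight b) =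
      -wedgeAltCLM h (ψ.smulRight a) (φ.smulRight b) := by
  have h1 := wedgeAltCLM_smulRight_self h (φ + ψ) a b
  have e1 : (φ + ψ).smulRight a = φ.smulRight a + ψ.smulRight a := by ext; simp [add_mul]
  have e2 : (φ + ψ).smulRight b = φ.smulRight b + ψ.smulRight b := by ext; simp [add_mul]
  simp only [e1, e2, map_add, add_apply, wedgeAltCLM_smulRight_self] at h1
  linarith

theorem eq_sum_proj_smulRight {F : Type*} [NormedAddCommGroup F] [NormedSpace ℝ F]
    (A : EuclideanSpace ℝ (Fin n) →L[ℝ] F) :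
    A = ∑ i, (EuclideanSpace.proj i : StrongDual ℝ (EuclideanSpace ℝ (Fin n))).smulRight
      (A (EuclideanSpace.basisFun (Fin n) ℝ i)) := by
  refine ContinuousLinearMap.coe_injective
    ((EuclideanSpace.basisFun (Fin n) ℝ).toBasis.ext fun j => ?_)
  simp

/-- Stokes' theorem for `d(η ∧ dζ) = dη ∧ dζ` on Euclidean space. -/
theorem integral_wedge_extDeriv_extDeriv (h : (k + 1) + (l + 1) = n)
    {η : EuclideanSpace ℝ (Fin n) → EuclForm n k}
    {ζ : EuclideanSpace ℝ (Fin n) → EuclForm n l}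
    (hη : ContDiff ℝ ∞ η) (hη' : HasCompactSupport η) (hζ : ContDiff ℝ ∞ ζ) :
    ∫ y, wedgeCLM h (extDeriv η y) (extDeriv ζ y) = 0 := by
  simp_rw [← wedgeAltCLM_fderiv]
  let e := EuclideanSpace.basisFun (Fin n) ℝ
  -- `t i j` is the coefficient with which `∂ᵢη` and `∂ⱼζ` enter `dη ∧ dζ`; it is antisymmetric in
  -- `i` and `j`.
  let t : Fin n → Fin n → (EuclForm n k) →L[ℝ]
      (EuclForm n l) →L[ℝ] ℝ := fun i j =>
    (wedgeAltCLM h).bilinearComp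
      (ContinuousLinearMap.smulRightL ℝ _ _ (EuclideanSpace.proj i))
      (ContinuousLinearMap.smulRightL ℝ _ _ (EuclideanSpace.proj j))
  have ht : ∀ i j a b, t i j a b = -t j i a b := fun i j a b =>
    wedgeAltCLM_smulRight_swap h (EuclideanSpace.proj i) (EuclideanSpace.proj j) a b
  have hT : ∀ y, wedgeAltCLM h (fderiv ℝ η y) (fderiv ℝ ζ y) =
      ∑ i, ∑ j, t i j (fderiv ℝ η y (e i)) (fderiv ℝ ζ y (e j)) := by
    intro y
    conv_lhs => rw [eq_sum_proj_smulRight (fderiv ℝ η y), eq_sum_proj_smulRight (fderiv ℝ ζ y)]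
    simp only [map_sum, sum_apply]
    rw [Finset.sum_comm]
    rfl
  have hη1 : ∀ i, ContDiff ℝ ∞ fun y => fderiv ℝ η y (e i) := fun i =>
    (hη.fderiv_right (m := ∞) (by simp)).clm_apply contDiff_const
  have hζ1 : ∀ i, ContDiff ℝ ∞ fun y => fderiv ℝ ζ y (e i) := fun i =>
    (hζ.fderiv_right (m := ∞) (by simp)).clm_apply contDiff_const
  have hη2 : ∀ i, HasCompactSupport fun y => fderiv ℝ η y (e i) := fun i =>
    (hη'.fderiv (𝕜 := ℝ)).comp_left (g := fun A : _ →L[ℝ] _ => A (e i)) rfl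
  have hζ2 : ∀ i j, Continuous fun y => fderiv ℝ (fun z => fderiv ℝ ζ z (e j)) y (e i) :=
    fun i j => (((hζ1 j).fderiv_right (m := ∞) (by simp)).clm_apply contDiff_const).continuous
  have hint : ∀ (B : (EuclForm n k) →L[ℝ]
      (EuclForm n l) →L[ℝ] ℝ)
      {f : EuclideanSpace ℝ (Fin n) → EuclForm n k}
      {g : EuclideanSpace ℝ (Fin n) → EuclForm n l},
      Continuous f → HasCompactSupport f → Continuous g →
      Integrable (fun y => B (f y) (g y)) volume := by
    intro B f g hf hf' hg
    refine Continuous.integrable_of_hasCompactSupport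
      (B.continuous₂.comp₂ hf hg) (hf'.mono' ?_)
    refine fun y hy => subset_tsupport _ fun h0 => hy ?_
    simp [h0]
  -- The derivative `∂ᵢ` is moved from `η` to `∂ⱼζ`. Compact support of `η` alone makes all the
  -- products integrable.
  have hparts : ∀ i j, ∫ y, t i j (fderiv ℝ η y (e i)) (fderiv ℝ ζ y (e j)) =
      -∫ y, t i j (η y) (fderiv ℝ (fun z => fderiv ℝ ζ z (e j)) y (e i)) := by
    intro i j
    rw [eq_neg_iff_add_eq_zero, ← eq_neg_iff_add_eq_zero.mp
      (integral_bilinear_fderiv_right_eq_neg_left_of_integrable (B := t i j) (v := e i)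
        (f := η) (g := fun y => fderiv ℝ ζ y (e j)) (μ := volume) ?_ ?_ ?_ ?_ ?_), add_comm]
    · exact hint _ (hη1 i).continuous (hη2 i) (hζ1 j).continuous
    · exact hint _ hη.continuous hη' (hζ2 i j)
    · exact hint _ hη.continuous hη' (hζ1 j).continuous
    · exact fun y _ => (hη.differentiable (by simp)).differentiableAt
    · exact fun y _ => ((hζ1 j).differentiable (by simp)).differentiableAt
  have hsymm : ∀ y i j, fderiv ℝ (fun z => fderiv ℝ ζ z (e j)) y (e i) =
      fderiv ℝ (fun z => fderiv ℝ ζ z (e i)) y (e j) := by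
    intro y i j
    have hd : DifferentiableAt ℝ (fderiv ℝ ζ) y :=
      ((hζ.fderiv_right (m := ∞) (by simp)).differentiable (by simp)).differentiableAt
    have hs : IsSymmSndFDerivAt ℝ ζ y := hζ.contDiffAt.isSymmSndFDerivAt
      (by rw [minSmoothness_of_isRCLikeNormedField]; exact ENat.LEInfty.out)
    rw [fderiv_clm_apply hd (differentiableAt_const _),
      fderiv_clm_apply hd (differentiableAt_const _)]
    simpa using hs.eq (e i) (e j)
  -- Antisymmetric coefficients are contracted with symmetric second derivatives, so the sum equals
  -- its own negative.
  have hzero : ∀ y, ∑ i, ∑ j,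
      t i j (η y) (fderiv ℝ (fun z => fderiv ℝ ζ z (e j)) y (e i)) = 0 := by
    intro y
    refine self_eq_neg.mp ?_
    conv_lhs => rw [Finset.sum_comm]
    simp only [← Finset.sum_neg_distrib]
    refine Finset.sum_congr rfl fun i _ => Finset.sum_congr rfl fun j _ => ?_
    rw [ht, hsymm y]
  simp_rw [hT]
  rw [integral_finsetSum _ fun i _ => integrable_finsetSum _ fun j _ =>
    hint _ (hη1 i).continuous (hη2 i) (hζ1 j).continuous]
  simp_rw [integral_finsetSum Finset.univ fun j _ =>
    hint (t _ j) (hη1 _).continuous (hη2 _) (hζ1 j).continuous, hparts, Finset.sum_neg_distrib]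
  simp_rw [← integral_finsetSum Finset.univ fun j _ =>
    hint (t _ j) hη.continuous hη' (hζ2 _ j)]
  rw [← integral_finsetSum Finset.univ fun i _ => integrable_finsetSum _ fun j _ =>
    hint (t i j) hη.continuous hη' (hζ2 i j)]
  simp [hzero]

end EuclideanForms

/-! ### Transformation of forms, differentials and Gram matrices under changes of charts. -/

section Charts

variable {n : ℕ} {M : Type*} [TopologicalSpace M] [ChartedSpace (EuclideanSpace ℝ (Fin n)) M]
  {k l m : ℕ}

variable (n) in
/-- The change of coordinates from the preferred chart at `x₀` to the one at `x₁`. -/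
def chartChange (x₀ x₁ : M) : EuclideanSpace ℝ (Fin n) → EuclideanSpace ℝ (Fin n) :=
  extChartAt (𝓡 n) x₁ ∘ (extChartAt (𝓡 n) x₀).symm

variable (n) in
/-- The coordinate expression of a form in the preferred chart at `x₀`, as a form on `ℝⁿ`. -/
def chartForm [IsManifold (𝓡 n) ∞ M] (α : FormField n M k) (x₀ : M) :
    EuclideanSpace ℝ (Fin n) → EuclForm n k :=
  fun y => inChart α x₀ ((extChartAt (𝓡 n) x₀).symm y)

theorem chartChange_apply {x₀ x : M} (x₁ : M)
    (h₀ : x ∈ (chartAt (EuclideanSpace ℝ (Fin n)) x₀).source) :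
    chartChange n x₀ x₁ (extChartAt (𝓡 n) x₀ x) = extChartAt (𝓡 n) x₁ x := by
  rw [chartChange, Function.comp_apply,
    (extChartAt (𝓡 n) x₀).left_inv (by rwa [extChartAt_source])]

variable [IsManifold (𝓡 n) ∞ M]

theorem contDiffAt_chartChange {x₀ x₁ x : M}
    (h₀ : x ∈ (chartAt (EuclideanSpace ℝ (Fin n)) x₀).source)
    (h₁ : x ∈ (chartAt (EuclideanSpace ℝ (Fin n)) x₁).source) :
    ContDiffAt ℝ ∞ (chartChange n x₀ x₁) (extChartAt (𝓡 n) x₀ x) := by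
  rw [← contMDiffAt_iff_contDiffAt]
  have hx : (extChartAt (𝓡 n) x₀).symm (extChartAt (𝓡 n) x₀ x) = x :=
    (extChartAt (𝓡 n) x₀).left_inv (by rwa [extChartAt_source])
  have h2 : ContMDiffAt 𝓘(ℝ, EuclideanSpace ℝ (Fin n)) (𝓡 n) ∞ (extChartAt (𝓡 n) x₀).symm
      (extChartAt (𝓡 n) x₀ x) :=
    (contMDiffOn_extChartAt_symm x₀).contMDiffAt ((isOpen_extChartAt_target x₀).mem_nhds
      ((extChartAt (𝓡 n) x₀).map_source (by rwa [extChartAt_source])))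
  exact ContMDiffAt.comp _ (hx.symm ▸ contMDiffAt_extChartAt' h₁) h2

/-- The cocycle of the tangent bundle is by construction the derivative of the change of
coordinates. The transformation rules for forms and for the metric both follow from this. -/
theorem symmL_eq_comp_fderiv_chartChange {x₀ x₁ x : M}
    (h₀ : x ∈ (chartAt (EuclideanSpace ℝ (Fin n)) x₀).source)
    (h₁ : x ∈ (chartAt (EuclideanSpace ℝ (Fin n)) x₁).source) (v : EuclideanSpace ℝ (Fin n)) :
    (trivializationAt (EuclideanSpace ℝ (Fin n)) (TangentSpace (𝓡 n) : M → Type _) x₀).symmL ℝ x v =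
      (trivializationAt (EuclideanSpace ℝ (Fin n)) (TangentSpace (𝓡 n) : M → Type _) x₁).symmL ℝ x
        (fderiv ℝ (chartChange n x₀ x₁) (extChartAt (𝓡 n) x₀ x) v) := by
  have hd : fderiv ℝ (chartChange n x₀ x₁) (extChartAt (𝓡 n) x₀ x) =
      tangentCoordChange (𝓡 n) x₀ x₁ x := by
    rw [tangentCoordChange_def, modelWithCornersSelf_coe, Set.range_id, fderivWithin_univ]
    rfl
  rw [hd, TangentBundle.symmL_trivializationAt_eq_core h₀,
    TangentBundle.symmL_trivializationAt_eq_core h₁]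
  refine (tangentCoordChange_comp (I := 𝓡 n) ?_).symm
  simp [h₀, h₁]

theorem inChart_eq_comp_fderiv_chartChange (α : FormField n M k) {x₀ x₁ x : M}
    (h₀ : x ∈ (chartAt (EuclideanSpace ℝ (Fin n)) x₀).source)
    (h₁ : x ∈ (chartAt (EuclideanSpace ℝ (Fin n)) x₁).source) :
    inChart α x₀ x = (inChart α x₁ x).compContinuousLinearMap
      (fderiv ℝ (chartChange n x₀ x₁) (extChartAt (𝓡 n) x₀ x)) := by
  ext v
  exact congrArg (α x) (funext fun i => symmL_eq_comp_fderiv_chartChange h₀ h₁ (v i))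

omit [IsManifold (𝓡 n) ∞ M] in
theorem eventually_extChartAt_symm_mem {x₀ x : M} {U : Set M} (hU : U ∈ 𝓝 x)
    (h₀ : x ∈ (chartAt (EuclideanSpace ℝ (Fin n)) x₀).source) :
    ∀ᶠ y in 𝓝 (extChartAt (𝓡 n) x₀ x), y ∈ (extChartAt (𝓡 n) x₀).target ∧
      (extChartAt (𝓡 n) x₀).symm y ∈ U := by
  have h₀' : x ∈ (extChartAt (𝓡 n) x₀).source := by rwa [extChartAt_source]
  refine Filter.Eventually.and
    ((isOpen_extChartAt_target x₀).mem_nhds ((extChartAt (𝓡 n) x₀).map_source h₀')) ?_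
  refine (continuousAt_extChartAt_symm' h₀').preimage_mem_nhds ?_
  rwa [(extChartAt (𝓡 n) x₀).left_inv h₀']

/-- The pullback rule is needed on a neighbourhood, not only at a point, because it is going to be
differentiated. -/
theorem chartForm_eventuallyEq (α : FormField n M k) {x₀ x₁ x : M}
    (h₀ : x ∈ (chartAt (EuclideanSpace ℝ (Fin n)) x₀).source)
    (h₁ : x ∈ (chartAt (EuclideanSpace ℝ (Fin n)) x₁).source) :
    chartForm n α x₀ =ᶠ[𝓝 (extChartAt (𝓡 n) x₀ x)] fun y =>
      (chartForm n α x₁ (chartChange n x₀ x₁ y)).compContinuousLinearMap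
        (fderiv ℝ (chartChange n x₀ x₁) y) := by
  filter_upwards [eventually_extChartAt_symm_mem
    ((chartAt (EuclideanSpace ℝ (Fin n)) x₁).open_source.mem_nhds h₁) h₀] with y hy
  have hy₀ : (extChartAt (𝓡 n) x₀).symm y ∈ (chartAt (EuclideanSpace ℝ (Fin n)) x₀).source := by
    rw [← extChartAt_source (𝓡 n)]; exact (extChartAt (𝓡 n) x₀).map_target hy.1
  have := inChart_eq_comp_fderiv_chartChange α hy₀ hy.2
  rw [(extChartAt (𝓡 n) x₀).right_inv hy.1] at this
  rw [chartForm, this, chartForm, chartChange, Function.comp_apply,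
    (extChartAt (𝓡 n) x₁).left_inv (by rw [extChartAt_source]; exact hy.2)]

theorem IsSmoothForm.contDiffOn_chartForm {α : FormField n M k} (hα : IsSmoothForm α) (x₀ : M) :
    ContDiffOn ℝ ∞ (chartForm n α x₀) (extChartAt (𝓡 n) x₀).target := by
  rw [← contMDiffOn_iff_contDiffOn]
  refine (hα x₀).comp (contMDiffOn_extChartAt_symm x₀) fun y hy => ?_
  rw [← extChartAt_source (𝓡 n)]
  exact (extChartAt (𝓡 n) x₀).map_target hy

theorem IsSmoothForm.contDiffAt_chartForm {α : FormField n M k} (hα : IsSmoothForm α) {x₀ x : M}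
    (h₀ : x ∈ (chartAt (EuclideanSpace ℝ (Fin n)) x₀).source) :
    ContDiffAt ℝ ∞ (chartForm n α x₀) (extChartAt (𝓡 n) x₀ x) :=
  (hα.contDiffOn_chartForm x₀).contDiffAt ((isOpen_extChartAt_target x₀).mem_nhds
    ((extChartAt (𝓡 n) x₀).map_source (by rwa [extChartAt_source])))

/-- The exterior differential may be computed in any chart. -/
theorem inChart_extD {α : FormField n M k} (hα : IsSmoothForm α) {x₀ x : M}
    (h₀ : x ∈ (chartAt (EuclideanSpace ℝ (Fin n)) x₀).source) :
    inChart (extD α) x₀ x = extDeriv (chartForm n α x₀) (extChartAt (𝓡 n) x₀ x) := by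
  have hx := mem_chart_source (EuclideanSpace ℝ (Fin n)) x
  have hτ := chartChange_apply (n := n) x h₀
  -- `extD` uses the chart centred at `x` itself; the exterior derivative commutes with pullback by
  -- the change to the chart at `x₀`.
  rw [(chartForm_eventuallyEq α h₀ hx).extDeriv_eq,
    extDeriv_pullback (r := ∞) (by rw [hτ]; exact hα.differentiableAt x)
      (contDiffAt_chartChange h₀ hx)
      (by rw [minSmoothness_of_isRCLikeNormedField]; exact ENat.LEInfty.out), hτ]
  ext v
  refine congrArg (extDeriv (chartForm n α x) (extChartAt (𝓡 n) x x)) (funext fun i => ?_)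
  refine (congrArg _ (symmL_eq_comp_fderiv_chartChange h₀ hx (v i))).trans ?_
  exact Trivialization.continuousLinearMapAt_symmL _ (FiberBundle.mem_baseSet_trivializationAt' x) _

theorem continuousOn_inChart_extD {α : FormField n M k} (hα : IsSmoothForm α) (x₀ : M) :
    ContinuousOn (inChart (extD α) x₀) (chartAt (EuclideanSpace ℝ (Fin n)) x₀).source := by
  refine ContinuousOn.congr ?_ fun x hx => inChart_extD hα hx
  intro x hx
  refine ContinuousAt.continuousWithinAt ?_
  have h1 : ContinuousAt (extDeriv (chartForm n α x₀)) (extChartAt (𝓡 n) x₀ x) :=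
    (ContinuousAlternatingMap.alternatizeUncurryFinCLM ℝ (EuclideanSpace ℝ (Fin n))
      ℝ).continuous.continuousAt.comp
      ((hα.contDiffAt_chartForm hx).fderiv_right (m := 0) (by simp)).continuousAt
  exact ContinuousAt.comp (f := extChartAt (𝓡 n) x₀) h1
    (continuousAt_extChartAt' (by rwa [extChartAt_source]))

theorem extD_eq_zero_of_notMem {α : FormField n M k} {K : Set M} (hK : IsClosed K)
    (hα : ∀ x ∉ K, α x = 0) {x : M} (hx : x ∉ K) : extD α x = 0 := by
  have h : chartForm n α x =ᶠ[𝓝 (extChartAt (𝓡 n) x x)] fun _ => 0 := by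
    filter_upwards [eventually_extChartAt_symm_mem (hK.isOpen_compl.mem_nhds hx)
      (mem_chart_source (EuclideanSpace ℝ (Fin n)) x)] with y hy
    rw [chartForm, inChart, hα _ hy.2]
    rfl
  have h0 : extDeriv (chartForm n α x) (extChartAt (𝓡 n) x x) = 0 := by
    rw [h.extDeriv_eq, extDeriv, fderiv_fun_const]
    exact map_zero (ContinuousAlternatingMap.alternatizeUncurryFinCLM ℝ _ _)
  unfold extD
  rw [show (fun y => inChart α x ((extChartAt (𝓡 n) x).symm y)) = chartForm n α x from rfl, h0]
  rfl

variable [RiemannianBundle (fun x : M => TangentSpace (𝓡 n) x)]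

/-- The Gram matrices satisfy `G₀ = Aᵀ G₁ A` with `A` the Jacobian matrix. The square root of this
identity is the Jacobian factor of the change of variables formula. -/
theorem det_chartGram_eq {x₀ x₁ x : M}
    (h₀ : x ∈ (chartAt (EuclideanSpace ℝ (Fin n)) x₀).source)
    (h₁ : x ∈ (chartAt (EuclideanSpace ℝ (Fin n)) x₁).source) :
    (chartGram (n := n) x₀ x).det =
      (fderiv ℝ (chartChange n x₀ x₁) (extChartAt (𝓡 n) x₀ x)).det ^ 2 *
        (chartGram (n := n) x₁ x).det := by
  let e := EuclideanSpace.basisFun (Fin n) ℝ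
  set D := fderiv ℝ (chartChange n x₀ x₁) (extChartAt (𝓡 n) x₀ x)
  let A : Matrix (Fin n) (Fin n) ℝ := LinearMap.toMatrix e.toBasis e.toBasis D.toLinearMap
  have hf : ∀ i, chartFrame x₀ x i = ∑ j, A j i • chartFrame x₁ x j := by
    intro i
    have hD : D (e i) = ∑ j, A j i • e j := by
      have := (e.toBasis.sum_repr (D (e i))).symm
      simpa [A, LinearMap.toMatrix_apply] using this
    refine (symmL_eq_comp_fderiv_chartChange h₀ h₁ (e i)).trans ?_
    rw [show fderiv ℝ (chartChange n x₀ x₁) (extChartAt (𝓡 n) x₀ x) (e i) = D (e i) from rfl, hD,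
      map_sum]
    simp_rw [map_smul]
    rfl
  have hG : chartGram (n := n) x₀ x = A.transpose * chartGram (n := n) x₁ x * A := by
    ext i j
    rw [chartGram, Matrix.of_apply, hf i, hf j, sum_inner]
    simp only [inner_sum, real_inner_smul_left, real_inner_smul_right, Matrix.mul_apply,
      Matrix.transpose_apply, chartGram, Matrix.of_apply, Finset.sum_mul]
    rw [Finset.sum_comm]
    refine Finset.sum_congr rfl fun a _ => Finset.sum_congr rfl fun b _ => by ring
  have hA : A.det = D.det := LinearMap.det_toMatrix e.toBasis D.toLinearMap
  rw [hG, Matrix.det_mul, Matrix.det_mul, Matrix.det_transpose, hA]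
  ring

end Charts

/-! ### Volume forms and norms of alternating forms on an inner product space. -/

section InnerProduct

variable {n k : ℕ} {V : Type*} [NormedAddCommGroup V] [InnerProductSpace ℝ V]
  [FiniteDimensional ℝ V] [Fact (Module.finrank ℝ V = n)]

/-- With `P` the matrix of `v` in an orthonormal basis, the Gram matrix is `PᵀP` and the volume form
is `± det P`. -/
theorem volumeForm_sq_eq_det_gram (o : Orientation ℝ V (Fin n)) (v : Fin n → V) :
    o.volumeForm v ^ 2 = (Matrix.of fun i j => inner ℝ (v i) (v j)).det := by
  let e : OrthonormalBasis (Fin n) ℝ V := (stdOrthonormalBasis ℝ V).reindex (finCongr Fact.out)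
  rw [show (Matrix.of fun i j => inner ℝ (v i) (v j)) = Matrix.gram ℝ v from rfl,
    Matrix.gram_eq_conjTranspose_mul e v, Matrix.det_mul, Matrix.det_conjTranspose, star_trivial,
    ← sq, ← sq_abs, o.volumeForm_robust' e, sq_abs]
  rfl

theorem abs_volumeForm_pos (o : Orientation ℝ V (Fin n)) (b : Module.Basis (Fin n) ℝ V) :
    0 < |o.volumeForm b| := by
  let e : OrthonormalBasis (Fin n) ℝ V := (stdOrthonormalBasis ℝ V).reindex (finCongr Fact.out)
  rw [o.volumeForm_robust' e]
  exact abs_pos.mpr (e.toBasis.isUnit_det b).ne_zero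

omit [FiniteDimensional ℝ V] in
theorem volumeForm_orthonormalBasis_sq (o : Orientation ℝ V (Fin n))
    (e : OrthonormalBasis (Fin n) ℝ V) : o.volumeForm e ^ 2 = 1 := by
  rw [← sq_abs, o.abs_volumeForm_apply_of_orthonormal e, one_pow]

-- The top form `θ` is `f` times the volume form with `f = θ(e) vol(e)`, as `vol(e)² = 1`. This
-- frees `wedgeDensity` from its orthonormal basis: it can be computed in any frame.
omit [FiniteDimensional ℝ V] in
theorem apply_mul_volumeForm (o : Orientation ℝ V (Fin n)) (e : OrthonormalBasis (Fin n) ℝ V)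
    (θ : V [⋀^Fin n]→ₗ[ℝ] ℝ) (v : Fin n → V) :
    θ e * o.volumeForm e * o.volumeForm v = θ v := by
  rw [θ.eq_smul_basis_det e.toBasis, o.volumeForm.eq_smul_basis_det e.toBasis]
  have h := volumeForm_orthonormalBasis_sq o e
  simp only [AlternatingMap.smul_apply, smul_eq_mul, OrthonormalBasis.coe_toBasis]
  have hd : e.toBasis.det e = 1 := by simpa using e.toBasis.det_self
  rw [hd]
  linear_combination (θ e * e.toBasis.det v) * h

theorem abs_volumeForm_eq_sqrt (o : Orientation ℝ V (Fin n)) (v : Fin n → V) :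
    |o.volumeForm v| = √(Matrix.of fun i j => inner ℝ (v i) (v j)).det := by
  rw [← volumeForm_sq_eq_det_gram o, Real.sqrt_sq_eq_abs]

theorem volumeForm_pos_iff_orientation_eq (o : Orientation ℝ V (Fin n))
    (b : Module.Basis (Fin n) ℝ V) : 0 < o.volumeForm b ↔ b.orientation = o := by
  let e : OrthonormalBasis (Fin n) ℝ V := (stdOrthonormalBasis ℝ V).reindex (finCongr Fact.out)
  by_cases he : e.toBasis.orientation = o
  · rw [o.volumeForm_robust e he, ← e.toBasis.orientation_eq_iff_det_pos b, he, eq_comm]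
  · have h1 := e.toBasis.orientation_eq_iff_det_pos b
    have h2 : e.toBasis.det b ≠ 0 := (e.toBasis.isUnit_det b).ne_zero
    have h3 : o = -e.toBasis.orientation := (e.toBasis.orientation_ne_iff_eq_neg o).mp (Ne.symm he)
    rw [o.volumeForm_robust_neg e he, AlternatingMap.neg_apply, neg_pos, h3,
      ← e.toBasis.orientation_ne_iff_eq_neg b.orientation, Ne, eq_comm, h1, not_lt]
    exact ⟨le_of_lt, fun h => lt_of_le_of_ne h h2⟩

variable {E : Type*} [NormedAddCommGroup E] [NormedSpace ℝ E]

-- Each value `α(e_i)` is a value of the pulled back form on the vectors `T⁻¹ e_{i_a}`, of norm at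
-- most `r`. There are `n^k` such values, and the division by `k!` is simply dropped.
omit [FiniteDimensional ℝ V] [Fact (Module.finrank ℝ V = n)] in
theorem sqrt_sum_sq_le_of_norm_symm_le (e : OrthonormalBasis (Fin n) ℝ V) (T : E ≃L[ℝ] V)
    {r : ℝ} (hr : 0 ≤ r) (hT : ∀ v, ‖T.symm v‖ ≤ r * ‖v‖) (α : V [⋀^Fin k]→L[ℝ] ℝ) :
    √((∑ i : Fin k → Fin n, α (fun a => e (i a)) ^ 2) / (k.factorial : ℝ)) ≤
      √((n : ℝ) ^ k) * r ^ k * ‖α.compContinuousLinearMap (T : E →L[ℝ] V)‖ := by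
  set N := ‖α.compContinuousLinearMap (T : E →L[ℝ] V)‖
  have hN : 0 ≤ N := norm_nonneg _
  have h1 : ∀ i : Fin k → Fin n, α (fun a => e (i a)) ^ 2 ≤ (r ^ k * N) ^ 2 := by
    intro i
    have : α (fun a => e (i a)) =
        α.compContinuousLinearMap (T : E →L[ℝ] V) (fun a => T.symm (e (i a))) := by
      simp [Function.comp_def]
    rw [← sq_abs, this, ← Real.norm_eq_abs]
    refine pow_le_pow_left₀ (norm_nonneg _) ?_ 2
    refine (ContinuousAlternatingMap.le_opNorm _ _).trans ?_
    rw [mul_comm]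
    refine mul_le_mul_of_nonneg_right ?_ hN
    refine (Finset.prod_le_prod (fun _ _ => norm_nonneg _) fun a _ => hT (e (i a))).trans ?_
    simp
  have h2 : (∑ i : Fin k → Fin n, α (fun a => e (i a)) ^ 2) / (k.factorial : ℝ) ≤
      (n : ℝ) ^ k * (r ^ k * N) ^ 2 := by
    refine (div_le_self (Finset.sum_nonneg fun _ _ => sq_nonneg _)
      (by exact_mod_cast Nat.one_le_iff_ne_zero.mpr k.factorial_ne_zero)).trans ?_
    refine (Finset.sum_le_sum fun i _ => h1 i).trans ?_
    simp
  refine (Real.sqrt_le_sqrt h2).trans (le_of_eq ?_)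
  rw [Real.sqrt_mul (by positivity), Real.sqrt_sq (by positivity), mul_assoc]

-- Expanding each `T v_a` in the orthonormal basis gives `n^k` terms, each bounded through `|⟨e_j, T
-- v_a⟩| ≤ r ‖v_a‖` and `|α(e_i)| ≤ √S`. The constants are crude, as only the equivalence of norms
-- is wanted.
omit [FiniteDimensional ℝ V] [Fact (Module.finrank ℝ V = n)] in
theorem norm_comp_le_of_norm_le (e : OrthonormalBasis (Fin n) ℝ V) (T : E ≃L[ℝ] V)
    {r : ℝ} (hr : 0 ≤ r) (hT : ∀ v, ‖T v‖ ≤ r * ‖v‖) (α : V [⋀^Fin k]→L[ℝ] ℝ) :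
    ‖α.compContinuousLinearMap (T : E →L[ℝ] V)‖ ≤ r ^ k * ((n : ℝ) ^ k * √(k.factorial : ℝ)) *
    √((∑ i : Fin k → Fin n, α (fun a => e (i a)) ^ 2) / (k.factorial : ℝ)) := by
  set S := ∑ i : Fin k → Fin n, α (fun a => e (i a)) ^ 2
  have hS : √(S / (k.factorial : ℝ)) = √S / √(k.factorial : ℝ) :=
    Real.sqrt_div' _ (Nat.cast_nonneg _)
  have hk : 0 < √(k.factorial : ℝ) := Real.sqrt_pos.mpr (by exact_mod_cast k.factorial_pos)
  have h0 : r ^ k * ((n : ℝ) ^ k * √(k.factorial : ℝ)) * √(S / (k.factorial : ℝ)) =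
      r ^ k * ((n : ℝ) ^ k * √S) := by
    rw [hS]; field_simp
  rw [h0]
  refine ContinuousAlternatingMap.opNorm_le_bound (_) (mul_nonneg (pow_nonneg hr k) (by positivity))
    fun v => ?_
  have hv : (fun a => T (v a)) = fun a => ∑ j, inner ℝ (e j) (T (v a)) • e j := by
    funext a
    exact (e.sum_repr' (T (v a))).symm
  have hexp : α.compContinuousLinearMap (T : E →L[ℝ] V) v =
      ∑ i : Fin k → Fin n, (∏ a, inner ℝ (e (i a)) (T (v a))) * α (fun a => e (i a)) := by
    change α (fun a => T (v a)) = _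
    rw [hv]
    refine (α.toMultilinearMap.map_sum fun a j => inner ℝ (e j) (T (v a)) • e j).trans
      (Finset.sum_congr rfl fun i _ => ?_)
    exact α.toMultilinearMap.map_smul_univ (fun a => inner ℝ (e (i a)) (T (v a)))
      fun a => e (i a)
  rw [hexp]
  refine (norm_sum_le _ _).trans ?_
  have hterm : ∀ i : Fin k → Fin n,
      ‖(∏ a, inner ℝ (e (i a)) (T (v a))) * α (fun a => e (i a))‖ ≤
        r ^ k * (∏ a, ‖v a‖) * √S := by
    intro i
    rw [norm_mul, norm_prod]
    refine mul_le_mul ?_ ?_ (norm_nonneg _)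
      (mul_nonneg (pow_nonneg hr k) (Finset.prod_nonneg fun _ _ => norm_nonneg _))
    · have : ∀ a, ‖inner ℝ (e (i a)) (T (v a))‖ ≤ r * ‖v a‖ := fun a => by
        refine (norm_inner_le_norm _ _).trans ?_
        rw [e.norm_eq_one, one_mul]
        exact hT _
      refine (Finset.prod_le_prod (fun _ _ => norm_nonneg _) fun a _ => this a).trans ?_
      simp [Finset.prod_mul_distrib]
    · rw [Real.norm_eq_abs]
      exact Real.abs_le_sqrt (Finset.single_le_sum (f := fun i : Fin k → Fin n =>
        α (fun a => e (i a)) ^ 2) (fun _ _ => sq_nonneg _) (Finset.mem_univ i))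
  refine (Finset.sum_le_sum fun i _ => hterm i).trans (le_of_eq ?_)
  simp
  ring

end InnerProduct

/-! ### The Riemannian measure in charts. -/

section Volume

theorem measurableSet_extChartAt_target {n : ℕ} {M : Type*} [TopologicalSpace M]
    [ChartedSpace (EuclideanSpace ℝ (Fin n)) M] (x₀ : M) :
    MeasurableSet (extChartAt (𝓡 n) x₀).target :=
  (isOpen_extChartAt_target (I := 𝓡 n) x₀).measurableSet

theorem measurableSet_extChartAt_target_inter {n : ℕ} {M : Type*} [TopologicalSpace M]
    [ChartedSpace (EuclideanSpace ℝ (Fin n)) M] [MeasurableSpace M] [BorelSpace M] (x₀ : M)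
    {A : Set M} (hA : MeasurableSet A) :
    MeasurableSet ((extChartAt (𝓡 n) x₀).target ∩ (extChartAt (𝓡 n) x₀).symm ⁻¹' A) := by
  rw [← Subtype.image_preimage_coe]
  exact (measurableSet_extChartAt_target x₀).subtype_image
    ((continuousOn_extChartAt_symm (I := 𝓡 n) x₀).domRestrict.measurable hA)

variable {n : ℕ} {M : Type*} [TopologicalSpace M] [ChartedSpace (EuclideanSpace ℝ (Fin n)) M]
  [IsManifold (𝓡 n) ∞ M] [RiemannianBundle (fun x : M => TangentSpace (𝓡 n) x)]
  [IsContMDiffRiemannianBundle (𝓡 n) ∞ (EuclideanSpace ℝ (Fin n))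
    (fun x : M => TangentSpace (𝓡 n) x)]

variable (n) in
/-- The density `√det(g_{ij})` of the Riemannian measure in the preferred chart at `x₀`. -/
def chartDensity (x₀ : M) (y : EuclideanSpace ℝ (Fin n)) : ℝ :=
  √(chartGram (n := n) x₀ ((extChartAt (𝓡 n) x₀).symm y)).det

theorem continuousOn_chartDensity (x₀ : M) :
    ContinuousOn (chartDensity n x₀) (extChartAt (𝓡 n) x₀).target := by
  refine Real.continuous_sqrt.comp_continuousOn
    ((Continuous.matrix_det continuous_id).comp_continuousOn
      ((continuousOn_chartGram (n := n) x₀).comp (continuousOn_extChartAt_symm x₀) ?_))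
  intro y hy
  rw [← extChartAt_source (𝓡 n)]
  exact (extChartAt (𝓡 n) x₀).map_target hy

theorem aemeasurable_chartDensity (x₀ : M) :
    AEMeasurable (fun y => ENNReal.ofReal (chartDensity n x₀ y))
      (volume.restrict (extChartAt (𝓡 n) x₀).target) :=
  ((continuousOn_chartDensity x₀).aemeasurable (measurableSet_extChartAt_target x₀)).ennreal_ofReal

variable [MeasurableSpace M] [BorelSpace M]

omit [IsContMDiffRiemannianBundle (𝓡 n) ∞ (EuclideanSpace ℝ (Fin n))
    (fun x : M => TangentSpace (𝓡 n) x)] in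
theorem aemeasurable_extChartAt_symm (x₀ : M) :
    AEMeasurable (extChartAt (𝓡 n) x₀).symm
      ((volume.restrict (extChartAt (𝓡 n) x₀).target).withDensity fun y =>
        ENNReal.ofReal (chartDensity n x₀ y)) :=
  ((continuousOn_extChartAt_symm x₀).aemeasurable (measurableSet_extChartAt_target x₀)).mono_ac
    (withDensity_absolutelyContinuous _ _)

theorem chartVolume_apply (x₀ : M) {A : Set M} (hA : MeasurableSet A) :
    chartVolume (n := n) x₀ A =
      ∫⁻ y in (extChartAt (𝓡 n) x₀).target ∩ (extChartAt (𝓡 n) x₀).symm ⁻¹' A,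
        ENNReal.ofReal (chartDensity n x₀ y) := by
  refine (Measure.map_apply_of_aemeasurable (aemeasurable_extChartAt_symm x₀) hA).trans ?_
  rw [withDensity_apply', Measure.restrict_restrict' (measurableSet_extChartAt_target x₀),
    Set.inter_comm]

/-- This is the change of variables formula; the Jacobian is absorbed by the transformation law of
`√det(g_{ij})`. -/
theorem chartVolume_congr {x₀ x₁ : M} {A : Set M} (hA : MeasurableSet A)
    (h₀ : A ⊆ (chartAt (EuclideanSpace ℝ (Fin n)) x₀).source)
    (h₁ : A ⊆ (chartAt (EuclideanSpace ℝ (Fin n)) x₁).source) :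
    chartVolume (n := n) x₀ A = chartVolume (n := n) x₁ A := by
  rw [chartVolume_apply x₀ hA, chartVolume_apply x₁ hA]
  set S := (extChartAt (𝓡 n) x₀).target ∩ (extChartAt (𝓡 n) x₀).symm ⁻¹' A
  have hS : MeasurableSet S := measurableSet_extChartAt_target_inter x₀ hA
  have hSm : ∀ y ∈ S, ∃ x ∈ A, extChartAt (𝓡 n) x₀ x = y := fun y hy =>
    ⟨_, hy.2, (extChartAt (𝓡 n) x₀).right_inv hy.1⟩
  have hinj : Set.InjOn (chartChange n x₀ x₁) S := by
    intro y hy z hz hyz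
    obtain ⟨a, ha, rfl⟩ := hSm y hy
    obtain ⟨b, hb, rfl⟩ := hSm z hz
    rw [chartChange_apply x₁ (h₀ ha), chartChange_apply x₁ (h₀ hb)] at hyz
    rw [(extChartAt (𝓡 n) x₁).injOn (by rw [extChartAt_source]; exact h₁ ha)
      (by rw [extChartAt_source]; exact h₁ hb) hyz]
  have himage : (extChartAt (𝓡 n) x₁).target ∩ (extChartAt (𝓡 n) x₁).symm ⁻¹' A =
      chartChange n x₀ x₁ '' S := by
    ext z
    constructor
    · rintro ⟨hz, hzA⟩
      have hz' := h₀ hzA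
      refine ⟨extChartAt (𝓡 n) x₀ ((extChartAt (𝓡 n) x₁).symm z), ⟨?_, ?_⟩, ?_⟩
      · exact (extChartAt (𝓡 n) x₀).map_source (by rwa [extChartAt_source])
      · rw [Set.mem_preimage, (extChartAt (𝓡 n) x₀).left_inv (by rwa [extChartAt_source])]
        exact hzA
      · rw [chartChange_apply x₁ hz', (extChartAt (𝓡 n) x₁).right_inv hz]
    · rintro ⟨y, hy, rfl⟩
      obtain ⟨a, ha, rfl⟩ := hSm y hy
      have ha' : a ∈ (extChartAt (𝓡 n) x₁).source := by rw [extChartAt_source]; exact h₁ ha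
      rw [chartChange_apply x₁ (h₀ ha)]
      refine ⟨(extChartAt (𝓡 n) x₁).map_source ha', ?_⟩
      rwa [Set.mem_preimage, (extChartAt (𝓡 n) x₁).left_inv ha']
  rw [himage, lintegral_image_eq_lintegral_abs_det_fderiv_mul volume hS
    (f' := fderiv ℝ (chartChange n x₀ x₁)) ?_ hinj]
  · refine setLIntegral_congr_fun hS fun y hy => ?_
    obtain ⟨a, ha, rfl⟩ := hSm y hy
    have e0 : (extChartAt (𝓡 n) x₀).symm (extChartAt (𝓡 n) x₀ a) = a :=
      (extChartAt (𝓡 n) x₀).left_inv (by rw [extChartAt_source]; exact h₀ ha)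
    have e1 : (extChartAt (𝓡 n) x₁).symm (extChartAt (𝓡 n) x₁ a) = a :=
      (extChartAt (𝓡 n) x₁).left_inv (by rw [extChartAt_source]; exact h₁ ha)
    rw [chartChange_apply x₁ (h₀ ha), chartDensity, chartDensity, e0, e1,
      ← ENNReal.ofReal_mul (abs_nonneg _), det_chartGram_eq (h₀ ha) (h₁ ha),
      Real.sqrt_mul (sq_nonneg _), Real.sqrt_sq_eq_abs]
  · intro y hy
    obtain ⟨a, ha, rfl⟩ := hSm y hy
    exact ((contDiffAt_chartChange (h₀ ha) (h₁ ha)).differentiableAt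
      (by simp)).hasFDerivAt.hasFDerivWithinAt

theorem chartVolume_compl_source (x₀ : M) :
    chartVolume (n := n) x₀ (chartAt (EuclideanSpace ℝ (Fin n)) x₀).sourceᶜ = 0 := by
  have hU := (chartAt (EuclideanSpace ℝ (Fin n)) x₀).open_source.measurableSet
  rw [chartVolume_apply x₀ hU.compl]
  convert setLIntegral_empty (μ := (volume : Measure (EuclideanSpace ℝ (Fin n)))) _
  ext y
  simp only [Set.mem_inter_iff, Set.mem_preimage, Set.mem_compl_iff, Set.mem_empty_iff_false,
    iff_false, not_and, not_not]
  intro hy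
  rw [← extChartAt_source (𝓡 n)]
  exact (extChartAt (𝓡 n) x₀).map_target hy

/-- On the domain of a chart, the Riemannian measure is given by the density `√det(g_{ij})`. -/
theorem riemannianVolume_restrict_source (x₀ : M) :
    (riemannianVolume n M).restrict (chartAt (EuclideanSpace ℝ (Fin n)) x₀).source =
      chartVolume (n := n) x₀ := by
  set U := (chartAt (EuclideanSpace ℝ (Fin n)) x₀).source
  have hU : MeasurableSet U := (chartAt (EuclideanSpace ℝ (Fin n)) x₀).open_source.measurableSet
  have hr : (chartVolume (n := n) x₀).restrict U = chartVolume (n := n) x₀ :=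
    Measure.restrict_eq_self_of_ae_mem (chartVolume_compl_source x₀)
  -- Inside the two chart domains the measures agree, and `chartVolume x₁` does not charge the
  -- complement of its own domain.
  have h1 : ∀ x₁ : M, (chartVolume (n := n) x₁).restrict U ≤ chartVolume (n := n) x₀ := by
    intro x₁
    set U₁ := (chartAt (EuclideanSpace ℝ (Fin n)) x₁).source
    have hU₁ : MeasurableSet U₁ :=
      (chartAt (EuclideanSpace ℝ (Fin n)) x₁).open_source.measurableSet
    have hr₁ : (chartVolume (n := n) x₁).restrict U₁ = chartVolume (n := n) x₁ :=
      Measure.restrict_eq_self_of_ae_mem (chartVolume_compl_source x₁)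
    refine Measure.le_iff.mpr fun A hA => ?_
    rw [← hr₁, Measure.restrict_apply hA, Measure.restrict_apply (hA.inter hU),
      chartVolume_congr (x₁ := x₀) ((hA.inter hU).inter hU₁) Set.inter_subset_right
        (Set.inter_subset_left.trans Set.inter_subset_right)]
    exact measure_mono (Set.inter_subset_left.trans Set.inter_subset_left)
  refine le_antisymm ?_ ?_
  -- A supremum of measures is not computed set by set, but it lies below any common upper bound.
  -- This sum dominates every chart measure, and its second term disappears on `U`.
  · have h2 : riemannianVolume n M ≤
        chartVolume (n := n) x₀ + (riemannianVolume n M).restrict Uᶜ := by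
      refine iSup_le fun x₁ => ?_
      rw [← Measure.restrict_add_restrict_compl (μ := chartVolume (n := n) x₁) hU]
      exact add_le_add (h1 x₁) (Measure.restrict_mono le_rfl
        (le_iSup (fun x : M => chartVolume (n := n) x) x₁))
    refine (Measure.restrict_mono (s := U) le_rfl h2).trans ?_
    rw [Measure.restrict_add, hr, Measure.restrict_restrict hU, Set.inter_compl_self,
      Measure.restrict_empty, add_zero]
  · rw [← hr]
    exact Measure.restrict_mono le_rfl (le_iSup (fun x : M => chartVolume (n := n) x) x₀)

/-- The continuous density is bounded near a point, here by its value there plus one, and the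
coordinate neighbourhood can be taken inside a unit ball. Together with second countability this
yields `σ`-finiteness, on which the duality of Lebesgue spaces rests. -/
instance isLocallyFiniteMeasure_riemannianVolume :
    IsLocallyFiniteMeasure (riemannianVolume n M) where
  finiteAtNhds x := by
    have hx : x ∈ (extChartAt (𝓡 n) x).source := mem_extChartAt_source x
    have ht : (extChartAt (𝓡 n) x).target ∈ 𝓝 (extChartAt (𝓡 n) x x) :=
      (isOpen_extChartAt_target x).mem_nhds ((extChartAt (𝓡 n) x).map_source hx)
    have hc := ((continuousOn_chartDensity x).continuousAt ht).eventually_lt_const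
      (lt_add_one (chartDensity n x (extChartAt (𝓡 n) x x)))
    set c := chartDensity n x (extChartAt (𝓡 n) x x) + 1
    obtain ⟨V, hV, hVo, hxV⟩ := eventually_nhds_iff.mp
      (hc.and (Metric.ball_mem_nhds (extChartAt (𝓡 n) x x) one_pos))
    let N : Set M := (chartAt (EuclideanSpace ℝ (Fin n)) x).source ∩ extChartAt (𝓡 n) x ⁻¹' V
    have hN : IsOpen N := by
      have := (continuousOn_extChartAt (I := 𝓡 n) x).isOpen_inter_preimage
        (isOpen_extChartAt_source x) hVo
      rwa [extChartAt_source] at this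
    refine ⟨N, hN.mem_nhds ⟨mem_chart_source _ x, hxV⟩, ?_⟩
    have h1 : riemannianVolume n M N = chartVolume (n := n) x N := by
      rw [← riemannianVolume_restrict_source, Measure.restrict_apply hN.measurableSet]
      congr 1
      exact (Set.inter_eq_left.mpr Set.inter_subset_left).symm
    rw [h1, chartVolume_apply x hN.measurableSet]
    have hsub : (extChartAt (𝓡 n) x).target ∩ (extChartAt (𝓡 n) x).symm ⁻¹' N ⊆ V := by
      rintro y ⟨hy, -, hyV⟩
      rwa [Set.mem_preimage, (extChartAt (𝓡 n) x).right_inv hy] at hyV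
    calc _ ≤ ∫⁻ y in V, ENNReal.ofReal (chartDensity n x y) := lintegral_mono_set hsub
      _ ≤ ∫⁻ y in V, ENNReal.ofReal c :=
        setLIntegral_mono measurable_const fun y hy =>
          ENNReal.ofReal_le_ofReal (hV y hy).1.le
      _ = ENNReal.ofReal c * volume V := by simp
      _ < ⊤ := ENNReal.mul_lt_top ENNReal.ofReal_lt_top
        ((measure_mono fun y hy => (hV y hy).2).trans_lt measure_ball_lt_top)

theorem integral_chartVolume (x₀ : M) {f : M → ℝ}
    (hf : AEStronglyMeasurable f (chartVolume (n := n) x₀)) :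
    ∫ x, f x ∂(chartVolume (n := n) x₀) = ∫ y in (extChartAt (𝓡 n) x₀).target,
      chartDensity n x₀ y * f ((extChartAt (𝓡 n) x₀).symm y) := by
  have h1 := integral_map (aemeasurable_extChartAt_symm x₀) hf
  refine h1.trans ?_
  rw [integral_withDensity_eq_integral_toReal_smul₀ (aemeasurable_chartDensity x₀)
    (Filter.Eventually.of_forall fun _ => ENNReal.ofReal_lt_top)]
  simp only [smul_eq_mul]
  refine integral_congr_ae (Filter.Eventually.of_forall fun y => ?_)
  simp only
  rw [ENNReal.toReal_ofReal (show 0 ≤ chartDensity n x₀ y from Real.sqrt_nonneg _)]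

end Volume

/-! ### Duality of Lebesgue spaces. -/

section LpDual

open ContinuousLinearMap

variable {α : Type*} [MeasurableSpace α] {μ : Measure α} {p q : ℝ≥0∞} [Fact (1 ≤ p)] [Fact (1 ≤ q)]

open Classical in
/-- The signed measure `A ↦ F(1_A)` defined by a functional on `L^q` of a finite measure. -/
def dualSignedMeasure [IsFiniteMeasure μ] (hq : q ≠ ⊤) (F : Lp ℝ q μ →L[ℝ] ℝ) :
    SignedMeasure α where
  measureOf' A := if hA : MeasurableSet A then
    F (indicatorConstLp q hA (measure_ne_top μ A) (1 : ℝ)) else 0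
  empty' := by simp
  not_measurable' A hA := by simp [hA]
  m_iUnion' f hf hd := by
    have hU := MeasurableSet.iUnion hf
    have hs : ∀ s : Finset ℕ, MeasurableSet (⋃ i ∈ s, f i) := fun s =>
      Finset.measurableSet_biUnion s fun i _ => hf i
    simp only [hf, hU, dite_true]
    have hsum : ∀ s : Finset ℕ,
        ∑ i ∈ s, F (indicatorConstLp q (hf i) (measure_ne_top μ (f i)) (1 : ℝ)) =
          F (indicatorConstLp q (hs s) (measure_ne_top μ _) (1 : ℝ)) := by
      intro s
      induction s using Finset.induction_on with
      | empty => simp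
      | insert a s ha ih =>
        rw [Finset.sum_insert ha, ih, ← map_add, ← indicatorConstLp_disjoint_union (hf a) (hs s)
          (measure_ne_top μ _) (measure_ne_top μ _)]
        · simp only [Finset.set_biUnion_insert]
        · rw [Set.disjoint_iUnion₂_right]
          exact fun i hi => hd (fun h => ha (h ▸ hi))
    rw [HasSum, SummationFilter.unconditional_filter]
    simp_rw [hsum]
    -- As `q` is finite, indicators converge in `L^q` once the measures of the symmetric differences
    -- tend to zero; here these are bounded by tails of a convergent series.
    refine (F.continuous.tendsto _).comp (tendsto_indicatorConstLp_set hq ?_)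
    have hfin : ∑' i, μ (f i) ≠ ⊤ := by
      rw [← measure_iUnion hd hf]; exact measure_ne_top μ _
    refine tendsto_of_tendsto_of_tendsto_of_le_of_le tendsto_const_nhds
      (ENNReal.tendsto_tsum_compl_atTop_zero hfin) (fun _ => zero_le) fun s => ?_
    refine (measure_mono ?_).trans (measure_iUnion_le (fun b : { x // x ∉ s } => f b))
    rintro x (⟨hx, hx'⟩ | ⟨hx, hx'⟩)
    · simp only [Set.mem_iUnion] at hx hx'
      obtain ⟨i, -, hi⟩ := hx
      exact absurd ⟨i, hi⟩ hx'
    · simp only [Set.mem_iUnion, not_exists] at hx hx' ⊢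
      obtain ⟨i, hi⟩ := hx
      exact ⟨⟨i, fun h => hx' i h hi⟩, hi⟩

theorem dualSignedMeasure_apply [IsFiniteMeasure μ] (hq : q ≠ ⊤) (F : Lp ℝ q μ →L[ℝ] ℝ)
    {A : Set α} (hA : MeasurableSet A) : dualSignedMeasure hq F A =
      F (indicatorConstLp q hA (measure_ne_top μ A) (1 : ℝ)) := by
  classical exact dif_pos hA

/-- A functional on `L^q` of a finite measure has an integrable density, which represents it on
simple functions. -/
theorem exists_density_of_finite [IsFiniteMeasure μ] (hq : q ≠ ⊤) (F : Lp ℝ q μ →L[ℝ] ℝ) :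
    ∃ h : α → ℝ, Measurable h ∧ Integrable h μ ∧ ∀ s : SimpleFunc α ℝ,
      F ((s.memLp_of_isFiniteMeasure q μ).toLp s) = ∫ x, s x * h x ∂μ := by
  set ν := dualSignedMeasure hq F
  have hq0 : q ≠ 0 := (zero_lt_one.trans_le Fact.out).ne'
  -- The indicator of a null set is zero in `L^q`, so Radon–Nikodym supplies the density.
  have hν : ν ≪ᵥ μ.toENNRealVectorMeasure := by
    refine VectorMeasure.AbsolutelyContinuous.mk fun A hA h0 => ?_
    rw [Measure.toENNRealVectorMeasure_apply_measurable hA] at h0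
    rw [dualSignedMeasure_apply hq F hA]
    have : indicatorConstLp q hA (measure_ne_top μ A) (1 : ℝ) = 0 := by
      rw [← norm_eq_zero, norm_indicatorConstLp hq0 hq, Measure.real, h0]
      have : q.toReal ≠ 0 := (ENNReal.toReal_pos hq0 hq).ne'
      simp [this]
    rw [this, map_zero]
  have hd := (SignedMeasure.absolutelyContinuous_iff_withDensityᵥ_rnDeriv_eq ν μ).mp hν
  have hi := SignedMeasure.integrable_rnDeriv ν μ
  refine ⟨ν.rnDeriv μ, SignedMeasure.measurable_rnDeriv ν μ, hi, fun s => ?_⟩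
  have hbdd : ∀ s : SimpleFunc α ℝ, Integrable (fun x => s x * ν.rnDeriv μ x) μ := fun s => by
    obtain ⟨C, hC⟩ := s.exists_forall_norm_le
    exact hi.bdd_mul s.aestronglyMeasurable (Filter.Eventually.of_forall hC)
  induction s using SimpleFunc.induction with
  | const c hs =>
    rename_i A
    have h1 : (SimpleFunc.memLp_of_isFiniteMeasure (SimpleFunc.piecewise A hs
        (SimpleFunc.const α c) (SimpleFunc.const α 0)) q μ).toLp _ =
        c • indicatorConstLp q hs (measure_ne_top μ A) (1 : ℝ) := by
      rw [indicatorConstLp, ← MemLp.toLp_const_smul]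
      refine MemLp.toLp_congr _ _ (Filter.Eventually.of_forall fun x => ?_)
      by_cases hx : x ∈ A <;> simp [hx]
    rw [h1, map_smul, ← dualSignedMeasure_apply hq F hs]
    change c • ν A = _
    conv_lhs => rw [← hd, withDensityᵥ_apply hi hs]
    rw [smul_eq_mul, ← integral_const_mul, ← integral_indicator hs]
    refine integral_congr_ae (Filter.Eventually.of_forall fun x => ?_)
    by_cases hx : x ∈ A <;> simp [hx]
  | add hdisj hf hg =>
    rename_i f g
    have h1 : (SimpleFunc.memLp_of_isFiniteMeasure (f + g) q μ).toLp _ =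
        (f.memLp_of_isFiniteMeasure q μ).toLp _ + (g.memLp_of_isFiniteMeasure q μ).toLp _ :=
      MemLp.toLp_add _ _
    rw [h1, map_add, hf, hg, ← integral_add (hbdd f) (hbdd g)]
    simp [add_mul]

/-- For simple `φ ≤ |h|^(p-1)` put `I = ∫ φ |h|`. Testing `F` on `φ sgn h` gives `I ≤ ‖F‖ ‖φ‖_q`,
while `(p-1)(q-1) = 1` gives `‖φ‖_q^q ≤ ∫ φ |h| = I`. Hence `I^(1/p) ≤ ‖F‖`, and the supremum over
`φ` bounds `∫ |h|^p` by `‖F‖^p`. -/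
theorem memLp_density_of_finite [IsFiniteMeasure μ] [p.HolderConjugate q] (hp : p ≠ ⊤)
    (hq : q ≠ ⊤) (F : Lp ℝ q μ →L[ℝ] ℝ) {h : α → ℝ} (hm : Measurable h) (hi : Integrable h μ)
    (hF : ∀ s : SimpleFunc α ℝ,
      F ((s.memLp_of_isFiniteMeasure q μ).toLp s) = ∫ x, s x * h x ∂μ) : MemLp h p μ := by
  have hp0 : p ≠ 0 := (zero_lt_one.trans_le Fact.out).ne'
  have hq0 : q ≠ 0 := (zero_lt_one.trans_le Fact.out).ne'
  have hpq : p.toReal.HolderConjugate q.toReal := ENNReal.HolderConjugate.toReal_of_ne_top hp hq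
  refine ⟨hm.aestronglyMeasurable, ?_⟩
  rw [eLpNorm_lt_top_iff_lintegral_rpow_enorm_lt_top hp0 hp]
  have hpow : ∀ (t : ℝ≥0∞) (r : ℝ), 1 ≤ r → t ^ r = t * t ^ (r - 1) := fun t r hr => by
    conv_lhs => rw [← add_sub_cancel 1 r]
    rw [ENNReal.rpow_add_of_nonneg _ _ zero_le_one (sub_nonneg.mpr hr), ENNReal.rpow_one]
  -- it suffices to bound the integrals of simple functions below `|h|^{p-1}` against `|h|`
  have hsimple : ∀ φ : SimpleFunc α NNReal, (∀ x, (φ x : ℝ≥0∞) ≤ ‖h x‖ₑ ^ (p.toReal - 1)) →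
      ∫⁻ x, φ x * ‖h x‖ₑ ∂μ ≤ ENNReal.ofReal ‖F‖ ^ p.toReal := by
    intro φ hφ
    set I := ∫⁻ x, φ x * ‖h x‖ₑ ∂μ
    let sg : SimpleFunc α ℝ := SimpleFunc.piecewise {x | 0 ≤ h x}
      (measurableSet_le measurable_const hm)
      (SimpleFunc.const α 1) (SimpleFunc.const α (-1))
    have hsg : ∀ x, sg x * h x = ‖h x‖ := by
      intro x
      by_cases hx : 0 ≤ h x
      · simp [sg, hx, abs_of_nonneg hx]
      · simp [sg, hx, abs_of_neg (not_le.mp hx)]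
    have hsg1 : ∀ x, ‖sg x‖ₑ = 1 := by
      intro x
      by_cases hx : 0 ≤ h x <;> simp [sg, hx]
    let s : SimpleFunc α ℝ := φ.map (fun t : NNReal => (t : ℝ)) * sg
    have hs : ∀ x, s x * h x = φ x * ‖h x‖ := fun x => by
      rw [← hsg]; simp [s, mul_assoc]
    have hsn : ∀ x, ‖s x‖ₑ = φ x := fun x => by
      simp [s, enorm_mul, hsg1]
    have hI : I = ENNReal.ofReal (∫ x, s x * h x ∂μ) := by
      obtain ⟨C, hC⟩ := s.exists_forall_norm_le
      rw [ofReal_integral_eq_lintegral_ofReal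
        (hi.bdd_mul s.aestronglyMeasurable (Filter.Eventually.of_forall hC))
        (Filter.Eventually.of_forall fun x => by
          beta_reduce; rw [hs]; exact mul_nonneg (φ x).coe_nonneg (norm_nonneg _))]
      refine lintegral_congr fun x => ?_
      rw [hs, ENNReal.ofReal_mul (φ x).coe_nonneg, ENNReal.ofReal_coe_nnreal, ofReal_norm]
    -- Finiteness, available because `φ` is bounded and `h` integrable, allows the cancellation of
    -- `I^(1/q)` below.
    have hItop : I ≠ ⊤ := by rw [hI]; exact ENNReal.ofReal_ne_top
    have hnorm : eLpNorm s q μ ≤ I ^ (1 / q.toReal) := by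
      rw [eLpNorm_eq_lintegral_rpow_enorm_toReal hq0 hq]
      refine ENNReal.rpow_le_rpow (lintegral_mono fun x => ?_) (by positivity)
      rw [hsn]
      calc (φ x : ℝ≥0∞) ^ q.toReal = φ x * (φ x : ℝ≥0∞) ^ (q.toReal - 1) :=
              hpow _ _ hpq.symm.lt.le
          _ ≤ φ x * (‖h x‖ₑ ^ (p.toReal - 1)) ^ (q.toReal - 1) := by
              gcongr
              · exact hpq.symm.sub_one_pos.le
              · exact hφ x
          _ = φ x * ‖h x‖ₑ := by
              rw [← ENNReal.rpow_mul]
              have : (p.toReal - 1) * (q.toReal - 1) = 1 := by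
                have := hpq.mul_eq_add
                linarith
              rw [this, ENNReal.rpow_one]
    have hle : I ≤ ENNReal.ofReal ‖F‖ * I ^ (1 / q.toReal) := by
      have hI' : I = ENNReal.ofReal (F ((s.memLp_of_isFiniteMeasure q μ).toLp s)) := by
        rw [hI, hF]
      refine hI'.le.trans ?_
      refine (ENNReal.ofReal_le_ofReal ((le_abs_self _).trans (F.le_opNorm _))).trans ?_
      rw [ENNReal.ofReal_mul (norm_nonneg _), Lp.norm_toLp, ENNReal.ofReal_toReal
        (s.memLp_of_isFiniteMeasure q μ).eLpNorm_ne_top]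
      gcongr
    rcases eq_or_ne I 0 with h0 | h0
    · rw [h0]; exact zero_le
    · have hIq0 : I ^ (1 / q.toReal) ≠ 0 := by simp [h0, hItop]
      have hIqt : I ^ (1 / q.toReal) ≠ ⊤ := by simp [h0, hItop]
      have hsplit : I = I ^ (1 / p.toReal) * I ^ (1 / q.toReal) := by
        rw [← ENNReal.rpow_add _ _ h0 hItop, one_div, one_div, hpq.inv_add_inv_eq_one,
          ENNReal.rpow_one]
      have h2 : I ^ (1 / p.toReal) ≤ ENNReal.ofReal ‖F‖ := by
        refine (ENNReal.mul_le_mul_iff_left hIq0 hIqt).mp ?_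
        rwa [← hsplit]
      calc I = (I ^ (1 / p.toReal)) ^ p.toReal := by
            rw [← ENNReal.rpow_mul, one_div, inv_mul_cancel₀ hpq.pos.ne', ENNReal.rpow_one]
        _ ≤ _ := ENNReal.rpow_le_rpow h2 hpq.nonneg
  have hkey : ∫⁻ x, ‖h x‖ₑ ^ p.toReal ∂μ ≤ ENNReal.ofReal ‖F‖ ^ p.toReal := by
    -- Moving one factor `|h|` into the measure makes the supremum over simple functions run over `φ
    -- ≤ |h|^(p-1)`.
    have h1 : ∫⁻ x, ‖h x‖ₑ ^ p.toReal ∂μ =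
        ∫⁻ x, ‖h x‖ₑ ^ (p.toReal - 1) ∂(μ.withDensity fun x => ‖h x‖ₑ) := by
      rw [lintegral_withDensity_eq_lintegral_mul_non_measurable _ hm.enorm
        (Filter.Eventually.of_forall fun x => enorm_lt_top)]
      refine lintegral_congr fun x => ?_
      rw [Pi.mul_apply]
      exact hpow _ _ hpq.lt.le
    rw [h1, lintegral_eq_nnreal]
    refine iSup₂_le fun φ hφ => ?_
    rw [← SimpleFunc.lintegral_eq_lintegral,
      lintegral_withDensity_eq_lintegral_mul_non_measurable _ hm.enorm
        (Filter.Eventually.of_forall fun x => enorm_lt_top)]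
    refine le_trans (le_of_eq (lintegral_congr fun x => ?_)) (hsimple φ hφ)
    simp [mul_comm]
  exact hkey.trans_lt (ENNReal.rpow_lt_top_of_nonneg hpq.nonneg ENNReal.ofReal_ne_top)

/-- Duality of `L^p` spaces for finite measures. -/
theorem lpPairing_mul_surjective_of_finite [IsFiniteMeasure μ] [p.HolderConjugate q] (hp : p ≠ ⊤)
    (hq : q ≠ ⊤) : Function.Surjective (lpPairing μ p q (ContinuousLinearMap.mul ℝ ℝ)) := by
  intro F
  obtain ⟨h, hm, hi, hF⟩ := exists_density_of_finite hq F
  have hL := memLp_density_of_finite hp hq F hm hi hF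
  refine ⟨hL.toLp h, ?_⟩
  ext f
  induction f using Lp.induction hq with
  | indicatorConst c hs hμs =>
    rename_i A
    have h1 : (Lp.simpleFunc.indicatorConst q hs hμs.ne c : Lp ℝ q μ) =
        (SimpleFunc.memLp_of_isFiniteMeasure (SimpleFunc.piecewise A hs
        (SimpleFunc.const α c) (SimpleFunc.const α 0)) q μ).toLp _ := by
      rw [Lp.simpleFunc.coe_indicatorConst, indicatorConstLp]
      refine MemLp.toLp_congr _ _ (Filter.Eventually.of_forall fun x => ?_)
      by_cases hx : x ∈ A <;> simp [hx]
    rw [h1, hF, lpPairing_eq_integral]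
    refine integral_congr_ae ?_
    filter_upwards [hL.coeFn_toLp, (SimpleFunc.memLp_of_isFiniteMeasure (SimpleFunc.piecewise A hs
        (SimpleFunc.const α c) (SimpleFunc.const α 0)) q μ).coeFn_toLp] with x hx hx'
    rw [hx, hx', ContinuousLinearMap.mul_apply', mul_comm]
  | add hf hg hd ihf ihg => rw [map_add, map_add, ihf, ihg]
  | isClosed => exact isClosed_eq (ContinuousLinearMap.continuous _) F.continuous

/-- Multiplication by `g^(1/r)` is thus an isometry from `L^r(gμ)` to `L^r(μ)`, by which the
`σ`-finite case reduces to the finite one. -/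
theorem eLpNorm_withDensity_eq {E : Type*} [NormedAddCommGroup E] [NormedSpace ℝ E]
    {g : α → NNReal} (hg : Measurable g) {r : ℝ≥0∞} (hr0 : r ≠ 0) (hr : r ≠ ⊤) (t : α → E) :
    eLpNorm t r (μ.withDensity fun x => g x) =
      eLpNorm (fun x => (g x : ℝ) ^ (1 / r.toReal) • t x) r μ := by
  have hr' : 0 < r.toReal := ENNReal.toReal_pos hr0 hr
  rw [eLpNorm_eq_lintegral_rpow_enorm_toReal hr0 hr, eLpNorm_eq_lintegral_rpow_enorm_toReal hr0 hr,
    lintegral_withDensity_eq_lintegral_mul_non_measurable _ hg.coe_nnreal_ennreal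
      (Filter.Eventually.of_forall fun x => ENNReal.coe_lt_top)]
  congr 1
  refine lintegral_congr fun x => ?_
  rw [Pi.mul_apply, enorm_smul, ENNReal.mul_rpow_of_nonneg _ _ hr'.le]
  congr 1
  rw [← NNReal.coe_rpow, Real.enorm_of_nonneg (NNReal.coe_nonneg _), ENNReal.ofReal_coe_nnreal,
    ENNReal.coe_rpow_of_nonneg _ (by positivity), ← ENNReal.rpow_mul, one_div,
    inv_mul_cancel₀ hr'.ne', ENNReal.rpow_one]

/-- Duality of `L^p` spaces for `σ`-finite measures. -/
theorem lpPairing_mul_surjective [SigmaFinite μ] [p.HolderConjugate q] (hp : p ≠ ⊤) (hq : q ≠ ⊤) :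
    Function.Surjective (lpPairing μ p q (ContinuousLinearMap.mul ℝ ℝ)) := by
  intro F
  have hp0 : p ≠ 0 := (zero_lt_one.trans_le Fact.out).ne'
  have hq0 : q ≠ 0 := (zero_lt_one.trans_le Fact.out).ne'
  have hpq : p.toReal.HolderConjugate q.toReal := ENNReal.HolderConjugate.toReal_of_ne_top hp hq
  -- A strictly positive density with finite integral: `m` is finite and has the same null sets as
  -- `μ`.
  obtain ⟨g, hg0, hgm, hg1⟩ := exists_pos_lintegral_lt_of_sigmaFinite μ one_ne_zero
  set m := μ.withDensity fun x => (g x : ℝ≥0∞)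
  have : IsFiniteMeasure m := isFiniteMeasure_withDensity (hg1.trans ENNReal.one_lt_top).ne
  have hμm : μ ≪ m := withDensity_absolutelyContinuous' hgm.coe_nnreal_ennreal.aemeasurable
    (Filter.Eventually.of_forall fun x => ENNReal.coe_ne_zero.mpr (hg0 x).ne')
  have hmμ : m ≪ μ := withDensity_absolutelyContinuous _ _
  have hw : ∀ c : ℝ, Measurable fun x => (g x : ℝ) ^ c := fun c =>
    hgm.coe_nnreal_real.pow_const c
  have hto : ∀ {r : ℝ≥0∞} (_ : r ≠ 0) (_ : r ≠ ⊤) {t : α → ℝ}, MemLp t r m →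
      MemLp (fun x => (g x : ℝ) ^ (1 / r.toReal) • t x) r μ := fun hr0 hr t ht =>
    ⟨(hw _).aestronglyMeasurable.smul (ht.1.mono_ac hμm),
      (eLpNorm_withDensity_eq hgm hr0 hr t) ▸ ht.2⟩
  let T : Lp ℝ q m →L[ℝ] Lp ℝ q μ := LinearMap.mkContinuous
    { toFun := fun t => (hto hq0 hq (Lp.memLp t)).toLp _
      map_add' := fun s t => by
        rw [← MemLp.toLp_add]
        refine MemLp.toLp_congr _ _ ?_
        filter_upwards [hμm.ae_le (Lp.coeFn_add s t)] with x hx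
        simp only [hx, Pi.add_apply, smul_add]
      map_smul' := fun c t => by
        rw [RingHom.id_apply, ← MemLp.toLp_const_smul]
        refine MemLp.toLp_congr _ _ ?_
        filter_upwards [hμm.ae_le (Lp.coeFn_smul c t)] with x hx
        simp only [hx, Pi.smul_apply, smul_comm c] } 1
    (fun t => by
      rw [one_mul]
      refine le_of_eq ?_
      change ‖(hto hq0 hq (Lp.memLp t)).toLp _‖ = _
      rw [Lp.norm_toLp, ← eLpNorm_withDensity_eq hgm hq0 hq, Lp.norm_def])
  obtain ⟨v, hv⟩ := lpPairing_mul_surjective_of_finite (p := p) hp hq (F.comp T)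
  have hu := hto hp0 hp (Lp.memLp v)
  refine ⟨hu.toLp _, ?_⟩
  ext f
  have hinv : ∀ x, (g x : ℝ) ^ (1 / q.toReal) * (g x : ℝ) ^ (-(1 / q.toReal)) = 1 := fun x => by
    rw [← Real.rpow_add (NNReal.coe_pos.mpr (hg0 x)), add_neg_cancel, Real.rpow_zero]
  have ht : MemLp (fun x => (g x : ℝ) ^ (-(1 / q.toReal)) * f x) q m := by
    refine ⟨((hw _).aestronglyMeasurable.mul (Lp.memLp f).1).mono_ac hmμ, ?_⟩
    rw [eLpNorm_withDensity_eq hgm hq0 hq]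
    simp only [smul_eq_mul, ← mul_assoc, hinv, one_mul]
    exact (Lp.memLp f).2
  have hTf : T (ht.toLp _) = f := by
    refine Lp.ext ((hto hq0 hq (Lp.memLp (ht.toLp _))).coeFn_toLp.trans ?_)
    filter_upwards [hμm.ae_le ht.coeFn_toLp] with x hx
    rw [hx, smul_eq_mul, ← mul_assoc, hinv, one_mul]
  have h1 : F f = lpPairing m p q (ContinuousLinearMap.mul ℝ ℝ) v (ht.toLp _) := by
    rw [hv, ContinuousLinearMap.comp_apply, hTf]
  rw [h1, lpPairing_eq_integral, lpPairing_eq_integral,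
    integral_withDensity_eq_integral_smul hgm]
  refine integral_congr_ae ?_
  filter_upwards [hu.coeFn_toLp, hμm.ae_le ht.coeFn_toLp] with x hx hx'
  rw [hx, hx']
  -- The weights match because `1 - 1/q = 1/p`.
  have hone : (g x : ℝ) * (g x : ℝ) ^ (-(1 / q.toReal)) = (g x : ℝ) ^ (1 / p.toReal) := by
    have h2 := hpq.inv_add_inv_eq_one
    have h3 : 1 / p.toReal = 1 + -(1 / q.toReal) := by rw [one_div, one_div]; linarith
    rw [h3, Real.rpow_add (NNReal.coe_pos.mpr (hg0 x)), Real.rpow_one]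
  rw [NNReal.smul_def, ContinuousLinearMap.mul_apply', ContinuousLinearMap.mul_apply', smul_eq_mul,
    smul_eq_mul, ← hone]
  ring

/-- Duality of `L^p` spaces of functions with values in finite dimensional spaces. -/
theorem lpPairing_surjective [SigmaFinite μ] [p.HolderConjugate q] (hp : p ≠ ⊤) (hq : q ≠ ⊤)
    {E F : Type*} [NormedAddCommGroup E] [NormedSpace ℝ E] [NormedAddCommGroup F] [NormedSpace ℝ F]
    [FiniteDimensional ℝ F] (B : E →L[ℝ] F →L[ℝ] ℝ) (hB : Function.Surjective B) :
    Function.Surjective (lpPairing μ p q B) := by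
  intro Λ
  let b := Module.finBasis ℝ F
  let c : ∀ i, F →L[ℝ] ℝ := fun i => LinearMap.toContinuousLinearMap (b.coord i)
  choose a ha using fun i => hB (c i)
  -- The restriction of `Λ` to functions with values in the line of `bᵢ` is a scalar functional,
  -- represented by `uᵢ`. Since `B aᵢ` is the `i`-th coordinate, `∑ uᵢ aᵢ` represents `Λ`.
  choose u hu using fun i => lpPairing_mul_surjective (p := p) (q := q) hp hq
    (Λ.comp ((ContinuousLinearMap.toSpanSingleton ℝ (b i)).compLpL q μ))
  refine ⟨∑ i, (ContinuousLinearMap.toSpanSingleton ℝ (a i)).compLpL p μ (u i), ?_⟩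
  ext f
  have hf : f = ∑ i, (ContinuousLinearMap.toSpanSingleton ℝ (b i)).compLpL q μ
      ((c i).compLpL q μ f) := by
    refine Lp.ext ?_
    have h1 : ∀ i, ((ContinuousLinearMap.toSpanSingleton ℝ (b i)).compLpL q μ
        ((c i).compLpL q μ f) : α → F) =ᵐ[μ] fun x => c i (f x) • b i := fun i => by
      filter_upwards [(ContinuousLinearMap.toSpanSingleton ℝ (b i)).coeFn_compLpL
        ((c i).compLpL q μ f), (c i).coeFn_compLpL f] with x hx hx'
      rw [hx, hx', ContinuousLinearMap.toSpanSingleton_apply]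
    filter_upwards [Lp.coeFn_finsetSum Finset.univ fun i =>
      (ContinuousLinearMap.toSpanSingleton ℝ (b i)).compLpL q μ ((c i).compLpL q μ f),
      ae_all_iff.mpr h1] with x hx hx'
    rw [hx, Finset.sum_apply]
    simp only [hx']
    exact (b.sum_repr (f x)).symm
  conv_rhs => rw [hf]
  rw [map_sum, map_sum, sum_apply]
  refine Finset.sum_congr rfl fun i _ => ?_
  have h2 := DFunLike.congr_fun (hu i) ((c i).compLpL q μ f)
  rw [ContinuousLinearMap.comp_apply] at h2
  rw [← h2, lpPairing_eq_integral, lpPairing_eq_integral]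
  refine integral_congr_ae ?_
  filter_upwards [(ContinuousLinearMap.toSpanSingleton ℝ (a i)).coeFn_compLpL (u i),
    (c i).coeFn_compLpL f] with x hx hx'
  rw [hx, hx', ContinuousLinearMap.toSpanSingleton_apply, map_smul, smul_apply, ha, smul_eq_mul,
    ContinuousLinearMap.mul_apply']

end LpDual

/-! ### Annihilators and quotients of Banach spaces in duality. -/

section Duality

variable {X Y : Type*} [NormedAddCommGroup X] [NormedSpace ℝ X] [NormedAddCommGroup Y]
  [NormedSpace ℝ Y]

/-- Hahn–Banach in the quotient by the closure: a nonzero class is detected by a functional, whose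
pullback vanishes on `S`. -/
theorem mem_topologicalClosure_of_forall_dual (S : Submodule ℝ X) {x : X}
    (h : ∀ f : StrongDual ℝ X, (∀ s ∈ S, f s = 0) → f x = 0) : x ∈ S.topologicalClosure := by
  have hcl : IsClosed (S.topologicalClosure : Set X) := S.isClosed_topologicalClosure
  by_contra hx
  have hne : (Submodule.Quotient.mk x : X ⧸ S.topologicalClosure) ≠ 0 := by
    rwa [Ne, Submodule.Quotient.mk_eq_zero]
  obtain ⟨f, hf⟩ := SeparatingDual.exists_ne_zero (R := ℝ) hne
  refine hf (h (f.comp S.topologicalClosure.mkQL) fun s hs => ?_)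
  have : (Submodule.Quotient.mk s : X ⧸ S.topologicalClosure) = 0 := by
    rw [Submodule.Quotient.mk_eq_zero]
    exact S.le_topologicalClosure hs
  change f (Submodule.Quotient.mk s) = 0
  rw [this, map_zero]

/-- Two spaces in duality by a bilinear form `B` which represents all continuous functionals, with
subspaces `EX`, `EY` that are mutually orthogonal: the quotients of the annihilators by the closures
of these subspaces are in duality as well. -/
theorem exists_annihilator_quotient_equiv_dual (B : X →L[ℝ] Y →L[ℝ] ℝ) {C : ℝ}
    (hC : 0 ≤ C) (hB : ∀ F : StrongDual ℝ Y, ∃ x, ‖x‖ ≤ C * ‖F‖ ∧ B x = F)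
    (hB' : ∀ G : StrongDual ℝ X, ∃ y, ∀ x, B x y = G x)
    {EX ZX : Submodule ℝ X} {EY ZY : Submodule ℝ Y}
    (hZX : ∀ x, x ∈ ZX ↔ ∀ e ∈ EY, B x e = 0) (hZY : ∀ y, y ∈ ZY ↔ ∀ e ∈ EX, B e y = 0)
    (hE : ∀ e ∈ EX, ∀ e' ∈ EY, B e e' = 0) :
    ∃ Φ : (ZX ⧸ EX.topologicalClosure.submoduleOf ZX) ≃L[ℝ]
        StrongDual ℝ (ZY ⧸ EY.topologicalClosure.submoduleOf ZY),
      ∀ (x : ZX) (y : ZY), Φ (Submodule.Quotient.mk x) (Submodule.Quotient.mk y) = B x y := by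
  -- Annihilating a subspace is the same as annihilating its closure; hence the pairing descends to
  -- the quotients.
  have hclY : ∀ x ∈ ZX, ∀ e ∈ EY.topologicalClosure, B x e = 0 := fun x hx e he => by
    have : EY.topologicalClosure ≤ (B x).ker :=
      EY.topologicalClosure_minimal (fun e he => (hZX x).mp hx e he) (B x).isClosed_ker
    exact this he
  have hclX : ∀ y ∈ ZY, ∀ e ∈ EX.topologicalClosure, B e y = 0 := fun y hy e he => by
    have : EX.topologicalClosure ≤ (B.flip y).ker :=
      EX.topologicalClosure_minimal (fun e he => (hZY y).mp hy e he) (B.flip y).isClosed_ker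
    exact this he
  have hYZ : EY ≤ ZY := fun e' he' => (hZY e').mpr fun e he => hE e he e' he'
  set NY := EY.topologicalClosure.submoduleOf ZY
  set NX := EX.topologicalClosure.submoduleOf ZX
  let φ₀ : ZX →ₗ[ℝ] StrongDual ℝ (ZY ⧸ NY) :=
    { toFun := fun x => NY.liftQL ((B x).comp ZY.subtypeL) fun y hy => hclY x x.2 y hy
      map_add' := fun x x' => by
        ext y
        induction y using Submodule.Quotient.induction_on with
        | H y => exact congrArg (fun f => f (y : Y)) (B.map_add (x : X) x')
      map_smul' := fun c x => by
        ext y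
        induction y using Submodule.Quotient.induction_on with
        | H y => exact congrArg (fun f => f (y : Y)) (B.map_smul c (x : X)) }
  have hφ₀ : ∀ (x : ZX) (y : ZY), φ₀ x (Submodule.Quotient.mk y) = B x y := fun x y => rfl
  let φ : (ZX ⧸ NX) →ₗ[ℝ] StrongDual ℝ (ZY ⧸ NY) := NX.liftQ φ₀ fun x hx => by
    rw [LinearMap.mem_ker]
    ext y
    induction y using Submodule.Quotient.induction_on with
    | H y => exact hclX y y.2 x hx
  have hφ : ∀ (x : ZX) (y : ZY), φ (Submodule.Quotient.mk x) (Submodule.Quotient.mk y) = B x y :=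
    fun x y => rfl
  have hinj : Function.Injective φ := by
    rw [← LinearMap.ker_eq_bot, LinearMap.ker_eq_bot']
    intro z hz
    induction z using Submodule.Quotient.induction_on with
    | H x =>
      rw [Submodule.Quotient.mk_eq_zero]
      -- A functional `G` vanishing on `EX` is pairing with some `y`, necessarily in `ZY`; the class
      -- of `x` acts by zero on that `y`.
      change (x : X) ∈ EX.topologicalClosure
      refine mem_topologicalClosure_of_forall_dual EX fun G hG => ?_
      obtain ⟨y, hy⟩ := hB' G
      have hyZ : y ∈ ZY := (hZY y).mpr fun e he => by rw [hy, hG e he]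
      rw [← hy, ← hφ x ⟨y, hyZ⟩, hz]
      rfl
  have hsurj : ∀ F : StrongDual ℝ (ZY ⧸ NY), ∃ z : ZX ⧸ NX, ‖z‖ ≤ C * ‖F‖ ∧ φ z = F := by
    intro F
    obtain ⟨G, hG, hGn⟩ := exists_extension_norm_eq ZY (F.comp NY.mkQL)
    have hGF : ‖G‖ ≤ ‖F‖ := by
      rw [hGn]
      refine ContinuousLinearMap.opNorm_le_bound _ (norm_nonneg F) fun y => ?_
      exact (F.le_opNorm _).trans
        (mul_le_mul_of_nonneg_left (Submodule.Quotient.norm_mk_le _ y) (norm_nonneg F))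
    obtain ⟨x, hx, rfl⟩ := hB G
    -- The extension vanishes on `EY`: by `hE` this space lies in `ZY`, where the extension agrees
    -- with `F`, and there its classes are zero.
    have hxZ : x ∈ ZX := (hZX x).mpr fun e he => by
      have h0 : (Submodule.Quotient.mk ⟨e, hYZ he⟩ : ZY ⧸ NY) = 0 := by
        rw [Submodule.Quotient.mk_eq_zero]
        exact EY.le_topologicalClosure he
      have := hG ⟨e, hYZ he⟩
      rw [this]
      change F (Submodule.Quotient.mk _) = 0
      rw [h0, map_zero]
    refine ⟨Submodule.Quotient.mk ⟨x, hxZ⟩, ?_, ?_⟩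
    · exact (Submodule.Quotient.norm_mk_le _ _).trans
        (hx.trans (mul_le_mul_of_nonneg_left hGF hC))
    · ext y
      induction y using Submodule.Quotient.induction_on with
      | H y => exact hG y
  let e : (ZX ⧸ NX) ≃ₗ[ℝ] StrongDual ℝ (ZY ⧸ NY) := LinearEquiv.ofBijective φ
    ⟨hinj, fun F => (hsurj F).imp fun _ h => h.2⟩
  have hbound : ∀ z, ‖e z‖ ≤ ‖B‖ * ‖z‖ := by
    intro z
    refine ContinuousLinearMap.opNorm_le_bound _ (by positivity) fun w => ?_
    -- The quotient norm is an infimum, so representatives with norms within `δ` of it are used, and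
    -- `δ` tends to zero.
    refine le_of_forall_pos_le_add fun ε hε => ?_
    have hlim : Filter.Tendsto (fun δ : ℝ => ‖B‖ * (‖z‖ + δ) * (‖w‖ + δ)) (𝓝[>] 0)
        (𝓝 (‖B‖ * (‖z‖ + 0) * (‖w‖ + 0))) := by
      refine Filter.Tendsto.mono_left (Continuous.tendsto (by fun_prop) 0) nhdsWithin_le_nhds
    rw [add_zero, add_zero] at hlim
    obtain ⟨δ, hδ, hδ0⟩ := ((hlim.eventually (gt_mem_nhds (lt_add_of_pos_right _ hε))).and
      self_mem_nhdsWithin).exists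
    obtain ⟨x, rfl, hx⟩ := Submodule.Quotient.norm_mk_lt z hδ0
    obtain ⟨y, rfl, hy⟩ := Submodule.Quotient.norm_mk_lt w hδ0
    refine le_trans ?_ hδ.le
    calc ‖B x y‖ ≤ ‖B‖ * ‖x‖ * ‖y‖ := B.le_opNorm₂ _ _
      _ ≤ _ := by gcongr
  -- The norm control in `hB` bounds the inverse directly, without completeness of the quotients.
  have hbound' : ∀ F, ‖e.symm F‖ ≤ C * ‖F‖ := fun F => by
    obtain ⟨z, hz, rfl⟩ := hsurj F
    have : e.symm (φ z) = z := e.symm_apply_apply z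
    rwa [this]
  exact ⟨{ e with
    continuous_toFun := AddMonoidHomClass.continuous_of_bound e ‖B‖ hbound
    continuous_invFun := AddMonoidHomClass.continuous_of_bound e.symm C hbound' },
    fun x y => hφ x y⟩

end Duality

/-! ### Volume of the image of an orthonormal basis. -/

section VolumeBounds

set_option linter.unusedSectionVars false

variable {n : ℕ} {V E : Type*} [NormedAddCommGroup V] [InnerProductSpace ℝ V]
  [FiniteDimensional ℝ V] [Fact (Module.finrank ℝ V = n)] [NormedAddCommGroup E]
  [InnerProductSpace ℝ E] [FiniteDimensional ℝ E] [Fact (Module.finrank ℝ E = n)]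

theorem volumeForm_comp (o : Orientation ℝ V (Fin n)) (b : Module.Basis (Fin n) ℝ E)
    (S : E →ₗ[ℝ] V) (w : Fin n → E) :
    o.volumeForm (fun i => S (w i)) = o.volumeForm (fun i => S (b i)) * b.det w := by
  have h := (o.volumeForm.compLinearMap S).eq_smul_basis_det b
  have := congrArg (fun f => f w) h
  simpa [AlternatingMap.compLinearMap_apply, Function.comp_def] using this

/-- Hadamard's inequality. -/
theorem abs_volumeForm_comp_le (o : Orientation ℝ V (Fin n)) (b : OrthonormalBasis (Fin n) ℝ E)
    (S : E →ₗ[ℝ] V) {r : ℝ} (hS : ∀ v, ‖S v‖ ≤ r * ‖v‖) :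
    |o.volumeForm (fun i => S (b i))| ≤ r ^ n := by
  refine (o.abs_volumeForm_apply_le _).trans ?_
  calc ∏ i, ‖S (b i)‖ ≤ ∏ _i : Fin n, r := by
        refine Finset.prod_le_prod (fun _ _ => norm_nonneg _) fun i _ => ?_
        simpa using hS (b i)
    _ = r ^ n := by simp

/-- For an orthonormal basis `e` of `V`, `vol(S b) · det_b(S⁻¹ e) = vol(e) = ±1`, and Hadamard's
inequality for `S⁻¹` bounds the determinant by `r^n`. -/
theorem one_le_pow_mul_abs_volumeForm_comp (o : Orientation ℝ V (Fin n))
    (b : OrthonormalBasis (Fin n) ℝ E) (S : E ≃ₗ[ℝ] V) {r : ℝ}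
    (hS : ∀ v, ‖S.symm v‖ ≤ r * ‖v‖) :
    1 ≤ r ^ n * |o.volumeForm (fun i => S (b i))| := by
  let e : OrthonormalBasis (Fin n) ℝ V := (stdOrthonormalBasis ℝ V).reindex (finCongr Fact.out)
  have h1 := volumeForm_comp o b.toBasis S.toLinearMap (fun i => S.symm (e i))
  simp only [LinearEquiv.coe_coe, LinearEquiv.apply_symm_apply, OrthonormalBasis.coe_toBasis] at h1
  have h2 := o.abs_volumeForm_apply_of_orthonormal e
  have h3 := abs_volumeForm_comp_le b.toBasis.orientation e S.symm.toLinearMap hS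
  rw [Orientation.volumeForm_robust _ b rfl] at h3
  rw [show (⇑e) = fun i => e i from rfl, h1, abs_mul] at h2
  rw [← h2, mul_comm (r ^ n)]
  exact mul_le_mul_of_nonneg_left h3 (abs_nonneg _)

end VolumeBounds

/-! ### Measurable frames with uniform bounds. -/

section Frames

variable {n : ℕ} {M : Type*} [TopologicalSpace M] [ChartedSpace (EuclideanSpace ℝ (Fin n)) M]
  [IsManifold (𝓡 n) ∞ M] [RiemannianBundle (fun x : M => TangentSpace (𝓡 n) x)]

/-- A (discontinuous) measurable frame of the tangent bundle, with uniform bounds and locally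
constant orientation on a countable measurable partition of `M`. -/
structure BoundedFrame [MeasurableSpace M] (o : ManifoldOrientation n M) where
  /-- The centre of the chart in which the frame is constant around `x`. -/
  center : M → M
  countable_range : (Set.range center).Countable
  measurableSet_fiber (c : M) : MeasurableSet (center ⁻¹' {c})
  mem_source (x : M) : x ∈ (chartAt (EuclideanSpace ℝ (Fin n)) (center x)).source
  /-- The coordinates of the frame in the chart around `c`. -/
  coord (c : M) : EuclideanSpace ℝ (Fin n) ≃L[ℝ] EuclideanSpace ℝ (Fin n)
  /-- The frame, as an isomorphism from the model space to the tangent space. -/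
  frame (x : M) : EuclideanSpace ℝ (Fin n) ≃L[ℝ] TangentSpace (𝓡 n) x
  frame_apply (x : M) (v : EuclideanSpace ℝ (Fin n)) :
    frame x v = (trivializationAt (EuclideanSpace ℝ (Fin n))
      (TangentSpace (𝓡 n) : M → Type _) (center x)).symmL ℝ x (coord (center x) v)
  norm_frame_le (x : M) (v : EuclideanSpace ℝ (Fin n)) : ‖frame x v‖ ≤ 2 * ‖v‖
  norm_frame_symm_le (x : M) (v : TangentSpace (𝓡 n) x) : ‖(frame x).symm v‖ ≤ 2 * ‖v‖
  volume_pos_iff (x y : M) (h : center x = center y) :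
    0 < (o.at' x).volumeForm (fun i => frame x (EuclideanSpace.basisFun (Fin n) ℝ i)) ↔
      0 < (o.at' y).volumeForm (fun i => frame y (EuclideanSpace.basisFun (Fin n) ℝ i))

variable [IsContMDiffRiemannianBundle (𝓡 n) ∞ (EuclideanSpace ℝ (Fin n))
    (fun x : M => TangentSpace (𝓡 n) x)]

/-- The linear isomorphism `E ≃ E` which makes the frame of the chart at `c` orthonormal at `c`. -/
def orthonormalCoord (n : ℕ) {M : Type*} [TopologicalSpace M]
    [ChartedSpace (EuclideanSpace ℝ (Fin n)) M] [IsManifold (𝓡 n) ∞ M]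
    [RiemannianBundle (fun x : M => TangentSpace (𝓡 n) x)] (c : M) :
    EuclideanSpace ℝ (Fin n) ≃L[ℝ] EuclideanSpace ℝ (Fin n) :=
  (tangentONB c).repr.symm.toContinuousLinearEquiv.trans
    ((trivializationAt (EuclideanSpace ℝ (Fin n))
      (TangentSpace (𝓡 n) : M → Type _) c).continuousLinearEquivAt ℝ c
        (FiberBundle.mem_baseSet_trivializationAt' c))

/-- The frame which is constant in the chart at `c`, and orthonormal at `c`. -/
def frameAt {c x : M} (hx : x ∈ (trivializationAt (EuclideanSpace ℝ (Fin n))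
      (TangentSpace (𝓡 n) : M → Type _) c).baseSet) :
    EuclideanSpace ℝ (Fin n) ≃L[ℝ] TangentSpace (𝓡 n) x :=
  (orthonormalCoord n c).trans ((trivializationAt (EuclideanSpace ℝ (Fin n))
      (TangentSpace (𝓡 n) : M → Type _) c).continuousLinearEquivAt ℝ x hx).symm

/-- At `c` the frame is an isometry, so by continuity of the metric it and its inverse have norm at
most `2` nearby. The proposition `P` does not depend on `x`: it says whether the frame is positive
for the orientation that is constant near `c`. -/
theorem eventually_frameAt_bounds (o : ManifoldOrientation n M) (c : M) :
    ∃ P : Prop, ∀ᶠ x in 𝓝 c, ∃ hx : x ∈ (trivializationAt (EuclideanSpace ℝ (Fin n))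
      (TangentSpace (𝓡 n) : M → Type _) c).baseSet,
      (∀ v, ‖frameAt hx v‖ ≤ 2 * ‖v‖) ∧ (∀ v, ‖(frameAt hx).symm v‖ ≤ 2 * ‖v‖) ∧
      (0 < (o.at' x).volumeForm (fun i => frameAt hx (EuclideanSpace.basisFun (Fin n) ℝ i)) ↔
        P) := by
  have : IsContinuousRiemannianBundle (EuclideanSpace ℝ (Fin n))
      (fun x : M => TangentSpace (𝓡 n) x) := by
    obtain ⟨g, hg, hg'⟩ := ‹IsContMDiffRiemannianBundle (𝓡 n) ∞ (EuclideanSpace ℝ (Fin n))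
      (fun x : M => TangentSpace (𝓡 n) x)›.exists_contMDiff
    exact ⟨g, hg.continuous, hg'⟩
  obtain ⟨o', ho'⟩ := o.locally_constant c
  let b := (EuclideanSpace.basisFun (Fin n) ℝ).toBasis
  refine ⟨(b.map (orthonormalCoord n c).toLinearEquiv).orientation = o', ?_⟩
  have hc := FiberBundle.mem_baseSet_trivializationAt' (F := EuclideanSpace ℝ (Fin n))
    (E := (TangentSpace (𝓡 n) : M → Type _)) c
  filter_upwards [ho', (trivializationAt (EuclideanSpace ℝ (Fin n))
      (TangentSpace (𝓡 n) : M → Type _) c).open_baseSet.mem_nhds hc,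
    eventually_norm_symmL_trivializationAt_self_comp_lt (EuclideanSpace ℝ (Fin n))
      (fun x : M => TangentSpace (𝓡 n) x) c one_lt_two,
    eventually_norm_symmL_trivializationAt_comp_self_lt (EuclideanSpace ℝ (Fin n))
      (fun x : M => TangentSpace (𝓡 n) x) c one_lt_two] with x h1 hx h2 h3
  refine ⟨hx, fun v => ?_, fun v => ?_, ?_⟩
  · have h4 := ContinuousLinearMap.le_of_opNorm_le _ h3.le ((tangentONB c).repr.symm v)
    rw [LinearIsometryEquiv.norm_map] at h4
    refine le_trans (le_of_eq (congrArg norm ?_)) h4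
    rw [ContinuousLinearMap.comp_apply, frameAt, orthonormalCoord]
    simp only [ContinuousLinearEquiv.trans_apply]
    rw [Trivialization.symm_continuousLinearEquivAt_eq,
      Trivialization.coe_continuousLinearEquivAt_eq]
    rfl
  · have h4 := ContinuousLinearMap.le_of_opNorm_le _ h2.le v
    refine le_trans (le_of_eq ?_) h4
    rw [← LinearIsometryEquiv.norm_map (tangentONB c).repr.symm]
    refine congrArg norm ?_
    rw [ContinuousLinearMap.comp_apply,
      ← Trivialization.symm_continuousLinearEquivAt_eq _ hc,
      ← Trivialization.coe_continuousLinearEquivAt_eq _ hx]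
    exact (tangentONB c).repr.symm_apply_apply _
  · have h4 := volumeForm_pos_iff_orientation_eq (o.at' x)
      (b.map (frameAt hx).toLinearEquiv)
    have h5 : ⇑(b.map (frameAt hx).toLinearEquiv) =
        fun i => frameAt hx (EuclideanSpace.basisFun (Fin n) ℝ i) := by
      funext i; simp [b]
    rw [h5] at h4
    let G := (trivializationAt (EuclideanSpace ℝ (Fin n))
        (TangentSpace (𝓡 n) : M → Type _) c).continuousLinearEquivAt ℝ x hx
    have h6 : (b.map (frameAt hx).toLinearEquiv).map G.toLinearEquiv =
        b.map (orthonormalCoord n c).toLinearEquiv := by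
      ext1 i
      exact G.apply_symm_apply (orthonormalCoord n c (b i))
    rw [h4, ← h1 hx, ← h6, Module.Basis.orientation_map (b.map (frameAt hx).toLinearEquiv)]
    exact (Orientation.map (Fin n) G.toLinearEquiv).injective.eq_iff.symm

/-- A global continuous frame need not exist, but measurability suffices for Lebesgue spaces.
Countably many good neighbourhoods cover `M`, and each point uses the first one containing it. -/
theorem nonempty_boundedFrame [SecondCountableTopology M] [MeasurableSpace M] [BorelSpace M]
    (o : ManifoldOrientation n M) : Nonempty (BoundedFrame o) := by
  classical
  choose P hP using eventually_frameAt_bounds o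
  choose W hW hWo hWm using fun c => eventually_nhds_iff.mp (hP c)
  rcases isEmpty_or_nonempty M with hM | hM
  · exact ⟨{
      center := id
      countable_range := Set.to_countable _
      measurableSet_fiber := fun c => isEmptyElim c
      mem_source := fun c => isEmptyElim c
      coord := orthonormalCoord n
      frame := fun c => isEmptyElim c
      frame_apply := fun c => isEmptyElim c
      norm_frame_le := fun c => isEmptyElim c
      norm_frame_symm_le := fun c => isEmptyElim c
      volume_pos_iff := fun c => isEmptyElim c }⟩
  obtain ⟨s, hs, hs'⟩ := TopologicalSpace.countable_cover_nhds
    (fun c : M => (hWo c).mem_nhds (hWm c))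
  have hne : s.Nonempty := by
    by_contra h
    rw [Set.not_nonempty_iff_eq_empty] at h
    subst h
    obtain ⟨x⟩ := hM
    have := hs'.symm ▸ Set.mem_univ x
    simp at this
  obtain ⟨f, rfl⟩ := hs.exists_eq_range hne
  have hex : ∀ x, ∃ k, x ∈ W (f k) := fun x => by
    have : x ∈ ⋃ c ∈ Set.range f, W c := hs' ▸ Set.mem_univ x
    simpa using this
  let N : M → ℕ := fun x => Nat.find (hex x)
  have hN : Measurable N := measurable_find hex fun k => (hWo (f k)).measurableSet
  have hNW : ∀ x, x ∈ W (f (N x)) := fun x => Nat.find_spec (hex x)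
  choose hx h1 h2 h3 using fun x => hW (f (N x)) x (hNW x)
  exact ⟨{
    center := fun x => f (N x)
    countable_range := (Set.countable_range f).mono (Set.range_comp_subset_range N f)
    measurableSet_fiber := fun c =>
      hN (MeasurableSet.of_discrete (s := f ⁻¹' {c}))
    mem_source := hx
    coord := orthonormalCoord n
    frame := fun x => frameAt (hx x)
    frame_apply := fun x v =>
      congrFun (Trivialization.symm_continuousLinearEquivAt_eq _ (hx x)) _
    norm_frame_le := h1
    norm_frame_symm_le := h2
    volume_pos_iff := fun x y h => by rw [h3 x, h3 y, h] }⟩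

end Frames

/-! ### Forms in a bounded frame. -/

section Coordinates

set_option linter.unusedSectionVars false

variable {n : ℕ} {M : Type*} [TopologicalSpace M] [ChartedSpace (EuclideanSpace ℝ (Fin n)) M]
  [IsManifold (𝓡 n) ∞ M] [MeasurableSpace M] [BorelSpace M]
  [RiemannianBundle (fun x : M => TangentSpace (𝓡 n) x)] {k l : ℕ} {o : ManifoldOrientation n M}

/-- The expression of a differential form in a frame. -/
def BoundedFrame.coords (A : BoundedFrame o) (α : FormField n M k) (x : M) : EuclForm n k :=
  (α x).compContinuousLinearMap (A.frame x : EuclideanSpace ℝ (Fin n) →L[ℝ] TangentSpace (𝓡 n) x)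

theorem BoundedFrame.coords_eq (A : BoundedFrame o) (α : FormField n M k) (x : M) :
    A.coords α x = (inChart α (A.center x) x).compContinuousLinearMap
      (A.coord (A.center x) : EuclideanSpace ℝ (Fin n) →L[ℝ] EuclideanSpace ℝ (Fin n)) := by
  ext v
  exact congrArg (α x) (funext fun i => A.frame_apply x (v i))

theorem BoundedFrame.inChart_eq (A : BoundedFrame o) (α : FormField n M k) {x₀ x : M}
    (h₀ : x ∈ (chartAt (EuclideanSpace ℝ (Fin n)) x₀).source) :
    inChart α x₀ x = (A.coords α x).compContinuousLinearMap
      (((A.coord (A.center x)).symm : EuclideanSpace ℝ (Fin n) →L[ℝ] EuclideanSpace ℝ (Fin n)) ∘L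
        fderiv ℝ (chartChange n x₀ (A.center x)) (extChartAt (𝓡 n) x₀ x)) := by
  rw [A.coords_eq, inChart_eq_comp_fderiv_chartChange α h₀ (A.mem_source x)]
  ext v
  simp [Function.comp_def]

theorem BoundedFrame.aestronglyMeasurable_iff (A : BoundedFrame o) {β : Type*}
    [TopologicalSpace β] [TopologicalSpace.PseudoMetrizableSpace β] {f : M → β} {μ : Measure M} :
    AEStronglyMeasurable f μ ↔
      ∀ c, AEStronglyMeasurable f (μ.restrict (A.center ⁻¹' {c})) := by
  refine ⟨fun h c => h.restrict, fun h => ?_⟩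
  have := A.countable_range.to_subtype
  have hU : ⋃ c : Set.range A.center, A.center ⁻¹' {c.1} = Set.univ := by
    ext x; simp
  rw [← Measure.restrict_univ (μ := μ), ← hU, aestronglyMeasurable_iUnion_iff]
  exact fun c => h c

theorem continuous_compContinuousLinearMap_uncurry :
    Continuous fun q : (EuclideanSpace ℝ (Fin n) →L[ℝ] EuclideanSpace ℝ (Fin n)) × EuclForm n k =>
      q.2.compContinuousLinearMap q.1 := by
  have h : Continuous fun q : (EuclideanSpace ℝ (Fin n) →L[ℝ] EuclideanSpace ℝ (Fin n)) ×
      EuclForm n k => ContinuousAlternatingMap.compContinuousLinearMapCLM (F := ℝ) (𝕜 := ℝ)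
        (ι := Fin k) q.1 :=
    ContinuousAlternatingMap.continuous_compContinuousLinearMapCLM.comp continuous_fst
  exact h.clm_apply continuous_snd

/-- On a fibre of `center` the frame coordinates and the expression in the chart at `c` differ by a
fixed linear map. Passing to another chart composes with a derivative depending continuously on the
point. -/
theorem BoundedFrame.isMeasurableForm_iff (A : BoundedFrame o) (α : FormField n M k) :
    IsMeasurableForm α ↔ AEStronglyMeasurable (A.coords α) (riemannianVolume n M) := by
  constructor
  · intro h
    rw [A.aestronglyMeasurable_iff]
    intro c
    have hsub : A.center ⁻¹' {c} ⊆ (chartAt (EuclideanSpace ℝ (Fin n)) c).source := by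
      rintro x rfl; exact A.mem_source x
    have h1 : AEStronglyMeasurable (fun x => (inChart α c x).compContinuousLinearMap
        (A.coord c : EuclideanSpace ℝ (Fin n) →L[ℝ] EuclideanSpace ℝ (Fin n)))
        ((riemannianVolume n M).restrict (A.center ⁻¹' {c})) :=
      (ContinuousAlternatingMap.compContinuousLinearMapCLM
        (A.coord c : EuclideanSpace ℝ (Fin n) →L[ℝ] EuclideanSpace ℝ (Fin n))).continuous
        |>.comp_aestronglyMeasurable ((h c).mono_set hsub)
    refine h1.congr ?_
    filter_upwards [ae_restrict_mem (A.measurableSet_fiber c)] with x hx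
    obtain rfl : A.center x = c := hx
    exact (A.coords_eq α x).symm
  · intro h x₀
    set U := (chartAt (EuclideanSpace ℝ (Fin n)) x₀).source
    have hU : MeasurableSet U := (chartAt (EuclideanSpace ℝ (Fin n)) x₀).open_source.measurableSet
    rw [A.aestronglyMeasurable_iff]
    intro c
    rw [Measure.restrict_restrict (A.measurableSet_fiber c)]
    set V := (chartAt (EuclideanSpace ℝ (Fin n)) c).source
    have hV : MeasurableSet V := (chartAt (EuclideanSpace ℝ (Fin n)) c).open_source.measurableSet
    have hsub : A.center ⁻¹' {c} ∩ U ⊆ U ∩ V := by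
      rintro x ⟨rfl, hx⟩; exact ⟨hx, A.mem_source x⟩
    have hD : ContinuousOn (fun x => ((A.coord c).symm :
          EuclideanSpace ℝ (Fin n) →L[ℝ] EuclideanSpace ℝ (Fin n)) ∘L
        fderiv ℝ (chartChange n x₀ c) (extChartAt (𝓡 n) x₀ x)) (U ∩ V) := by
      refine continuousOn_const.clm_comp fun x hx => ContinuousAt.continuousWithinAt ?_
      have h1 := ((contDiffAt_chartChange hx.1 hx.2).fderiv_right (m := 0) (by simp)).continuousAt
      exact h1.comp (f := extChartAt (𝓡 n) x₀)
        (continuousAt_extChartAt' (by rw [extChartAt_source]; exact hx.1))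
    have h1 := continuous_compContinuousLinearMap_uncurry.comp_aestronglyMeasurable
      (((hD.aestronglyMeasurable (hU.inter hV)).mono_set (μ := riemannianVolume n M) hsub).prodMk
        (h.restrict (s := A.center ⁻¹' {c} ∩ U)))
    refine h1.congr ?_
    filter_upwards [ae_restrict_mem ((A.measurableSet_fiber c).inter hU)] with x hx
    obtain rfl : A.center x = c := hx.1
    exact (A.inChart_eq α hx.2).symm

/-- The constant in the comparison of norms of forms and of their coordinates. -/
def frameConst (n k : ℕ) : ℝ :=
  max (√((n : ℝ) ^ k) * 2 ^ k) (2 ^ k * ((n : ℝ) ^ k * √(k.factorial : ℝ)))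

theorem frameConst_nonneg (n k : ℕ) : 0 ≤ frameConst n k :=
  le_max_of_le_left (by positivity)

theorem BoundedFrame.formNorm_le (A : BoundedFrame o) (α : FormField n M k) (x : M) :
    formNorm (α x) ≤ frameConst n k * ‖A.coords α x‖ :=
  (sqrt_sum_sq_le_of_norm_symm_le (tangentONB x) (A.frame x) zero_le_two
    (A.norm_frame_symm_le x) (α x)).trans
    (mul_le_mul_of_nonneg_right (le_max_left _ _) (norm_nonneg _))

theorem BoundedFrame.norm_coords_le (A : BoundedFrame o) (α : FormField n M k) (x : M) :
    ‖A.coords α x‖ ≤ frameConst n k * formNorm (α x) :=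
  (norm_comp_le_of_norm_le (tangentONB x) (A.frame x) zero_le_two
    (A.norm_frame_le x) (α x)).trans
    (mul_le_mul_of_nonneg_right (le_max_right _ _) (formNorm_nonneg _))

/-- The volume of the frame. -/
def BoundedFrame.vol (A : BoundedFrame o) (x : M) : ℝ :=
  (o.at' x).volumeForm (fun i => A.frame x (EuclideanSpace.basisFun (Fin n) ℝ i))

theorem BoundedFrame.abs_vol_le (A : BoundedFrame o) (x : M) : |A.vol x| ≤ 2 ^ n := by
  have : Fact (Module.finrank ℝ (EuclideanSpace ℝ (Fin n)) = n) := ⟨finrank_euclideanSpace_fin⟩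
  exact abs_volumeForm_comp_le (o.at' x) (EuclideanSpace.basisFun (Fin n) ℝ)
    (A.frame x).toLinearEquiv.toLinearMap (A.norm_frame_le x)

theorem BoundedFrame.one_le_abs_vol (A : BoundedFrame o) (x : M) : 1 ≤ 2 ^ n * |A.vol x| := by
  have : Fact (Module.finrank ℝ (EuclideanSpace ℝ (Fin n)) = n) := ⟨finrank_euclideanSpace_fin⟩
  exact one_le_pow_mul_abs_volumeForm_comp (o.at' x) (EuclideanSpace.basisFun (Fin n) ℝ)
    (A.frame x).toLinearEquiv (A.norm_frame_symm_le x)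

theorem BoundedFrame.vol_ne_zero (A : BoundedFrame o) (x : M) : A.vol x ≠ 0 := fun h => by
  have := A.one_le_abs_vol x
  rw [h, abs_zero, mul_zero] at this
  linarith

/-- On each fibre of `center` this is a continuous function, which gives the measurability of `vol`
once its sign is known to be constant there. -/
theorem BoundedFrame.abs_vol_eq (A : BoundedFrame o) (x : M) :
    |A.vol x| = √(chartGram (n := n) (A.center x) x).det *
      |(EuclideanSpace.basisFun (Fin n) ℝ).toBasis.det
        fun i => A.coord (A.center x) (EuclideanSpace.basisFun (Fin n) ℝ i)| := by
  have : Fact (Module.finrank ℝ (EuclideanSpace ℝ (Fin n)) = n) := ⟨finrank_euclideanSpace_fin⟩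
  have h := volumeForm_comp (o.at' x) (EuclideanSpace.basisFun (Fin n) ℝ).toBasis
    ((trivializationAt (EuclideanSpace ℝ (Fin n))
      (TangentSpace (𝓡 n) : M → Type _) (A.center x)).symmL ℝ x).toLinearMap
    (fun i => A.coord (A.center x) (EuclideanSpace.basisFun (Fin n) ℝ i))
  have h1 : A.vol x = _ := (congrArg (o.at' x).volumeForm
    (funext fun i => A.frame_apply x (EuclideanSpace.basisFun (Fin n) ℝ i))).trans h
  rw [h1, abs_mul, abs_volumeForm_eq_sqrt]
  simp only [OrthonormalBasis.coe_toBasis]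
  rfl

/-- Evaluate `α ∧ β = f · vol` on the frame and divide by its volume. The weight is attached to the
second factor so that a constant bilinear form remains. -/
theorem wedgeDensity_eq_coords (A : BoundedFrame o) (h : k + l = n) (α : FormField n M k)
    (β : FormField n M l) (x : M) :
    wedgeDensity o h α β x = wedgeCLM h (A.coords α x) ((A.vol x)⁻¹ • A.coords β x) := by
  have h1 := apply_mul_volumeForm (o.at' x) (tangentONB x)
    (wedge h (α x).toAlternatingMap (β x).toAlternatingMap)
    (fun i => A.frame x (EuclideanSpace.basisFun (Fin n) ℝ i))
  have h2 : wedgeCLM h (A.coords α x) (A.coords β x) =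
      wedge h (α x).toAlternatingMap (β x).toAlternatingMap
        (fun i => A.frame x (EuclideanSpace.basisFun (Fin n) ℝ i)) :=
    congrArg (fun f => f (EuclideanSpace.basisFun (Fin n) ℝ))
      (wedge_compLinearMap h (A.frame x).toLinearEquiv.toLinearMap (α x).toAlternatingMap
        (β x).toAlternatingMap)
  rw [map_smul, smul_eq_mul, h2, ← h1, mul_comm]
  exact (mul_inv_cancel_right₀ (A.vol_ne_zero x) _).symm

variable [IsContMDiffRiemannianBundle (𝓡 n) ∞ (EuclideanSpace ℝ (Fin n))
    (fun x : M => TangentSpace (𝓡 n) x)]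

theorem BoundedFrame.aestronglyMeasurable_vol (A : BoundedFrame o) (μ : Measure M) :
    AEStronglyMeasurable A.vol μ := by
  rw [A.aestronglyMeasurable_iff]
  intro c
  have hsub : A.center ⁻¹' {c} ⊆ (chartAt (EuclideanSpace ℝ (Fin n)) c).source := by
    rintro x rfl; exact A.mem_source x
  have hc : ContinuousOn (fun x => √(chartGram (n := n) c x).det *
      |(EuclideanSpace.basisFun (Fin n) ℝ).toBasis.det
        fun i => A.coord c (EuclideanSpace.basisFun (Fin n) ℝ i)|)
      (chartAt (EuclideanSpace ℝ (Fin n)) c).source :=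
    (Real.continuous_sqrt.comp_continuousOn ((Continuous.matrix_det continuous_id).comp_continuousOn
      (continuousOn_chartGram (n := n) c))).mul continuousOn_const
  have h1 := (hc.aestronglyMeasurable (μ := μ)
    (chartAt (EuclideanSpace ℝ (Fin n)) c).open_source.measurableSet).mono_set hsub
  by_cases hp : ∃ y, A.center y = c ∧ 0 < A.vol y
  · refine h1.congr ?_
    filter_upwards [ae_restrict_mem (A.measurableSet_fiber c)] with x hx
    obtain ⟨y, hy, hy'⟩ := hp
    obtain rfl : A.center x = c := hx
    rw [← A.abs_vol_eq, abs_of_pos (show 0 < A.vol x from (A.volume_pos_iff x y hy.symm).mpr hy')]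
  · refine h1.neg.congr ?_
    filter_upwards [ae_restrict_mem (A.measurableSet_fiber c)] with x hx
    obtain rfl : A.center x = c := hx
    have hx' : A.vol x ≤ 0 := not_lt.mp fun h => hp ⟨x, rfl, h⟩
    rw [Pi.neg_apply, ← A.abs_vol_eq, abs_of_nonpos hx', neg_neg]

end Coordinates

/-! ### Spaces of integrable forms as Lebesgue spaces of vector valued functions. -/

section LpCoordinates

set_option linter.unusedSectionVars false

variable {n : ℕ} {M : Type*} [TopologicalSpace M] [ChartedSpace (EuclideanSpace ℝ (Fin n)) M]
  [IsManifold (𝓡 n) ∞ M] [SecondCountableTopology M] [MeasurableSpace M] [BorelSpace M]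
  [RiemannianBundle (fun x : M => TangentSpace (𝓡 n) x)]
  [IsContMDiffRiemannianBundle (𝓡 n) ∞ (EuclideanSpace ℝ (Fin n))
    (fun x : M => TangentSpace (𝓡 n) x)] {k l : ℕ} {o : ManifoldOrientation n M}
  {p : ℝ≥0∞}

theorem BoundedFrame.norm_smul_coords_le (A : BoundedFrame o) {w : M → ℝ} {b : ℝ}
    (hb : ∀ x, |w x| ≤ b) (α : FormField n M k) (x : M) :
    ‖w x • A.coords α x‖ ≤ b * frameConst n k * ‖formNorm (α x)‖ := by
  rw [norm_smul, Real.norm_eq_abs, Real.norm_of_nonneg (formNorm_nonneg _), mul_assoc]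
  exact mul_le_mul (hb x) (A.norm_coords_le α x) (norm_nonneg _) ((abs_nonneg _).trans (hb x))

theorem BoundedFrame.formNorm_le_norm_smul_coords (A : BoundedFrame o) {w : M → ℝ} {b : ℝ}
    (hb : ∀ x, 1 ≤ b * |w x|) (α : FormField n M k) (x : M) :
    ‖formNorm (α x)‖ ≤ b * frameConst n k * ‖w x • A.coords α x‖ := by
  rw [norm_smul, Real.norm_of_nonneg (formNorm_nonneg _), Real.norm_eq_abs]
  calc formNorm (α x) ≤ 1 * (frameConst n k * ‖A.coords α x‖) := by
        rw [one_mul]; exact A.formNorm_le α x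
    _ ≤ (b * |w x|) * (frameConst n k * ‖A.coords α x‖) :=
        mul_le_mul_of_nonneg_right (hb x) (mul_nonneg (frameConst_nonneg n k) (norm_nonneg _))
    _ = _ := by ring

theorem BoundedFrame.memLp_smul_coords (A : BoundedFrame o) {w : M → ℝ} {b : ℝ}
    (hw : AEStronglyMeasurable w (riemannianVolume n M)) (hb : ∀ x, |w x| ≤ b)
    (α : PreLpForms n M k p) :
    MemLp (fun x => w x • A.coords α.form x) p (riemannianVolume n M) :=
  α.memLp.of_le_mul (hw.smul ((A.isMeasurableForm_iff _).mp α.2.1))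
    (Filter.Eventually.of_forall fun x => A.norm_smul_coords_le hb α.form x)

/-- The isomorphism of `L^p(M, Λᵏ)` with a space of vector valued functions which is given by the
coordinates in a bounded frame, multiplied by a weight. -/
theorem BoundedFrame.exists_lpEquiv [Fact (1 ≤ p)] (A : BoundedFrame o) {w : M → ℝ} {b : ℝ}
    (hw : AEStronglyMeasurable w (riemannianVolume n M)) (hb : ∀ x, |w x| ≤ b)
    (hb' : ∀ x, 1 ≤ b * |w x|) :
    ∃ Θ : LpForms n M k p ≃L[ℝ] Lp (EuclForm n k) p (riemannianVolume n M),
      ∀ α : PreLpForms n M k p, Θ (toLpForms α) =ᵐ[riemannianVolume n M]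
        fun x => w x • A.coords α.form x := by
  set μ := riemannianVolume n M
  -- The bounds on `w` say nothing about the sign of `b` when `M` is empty.
  set C := max b 0 * frameConst n k
  have hC : 0 ≤ C := mul_nonneg (le_max_right _ _) (frameConst_nonneg n k)
  have hm := fun α => (A.memLp_smul_coords (k := k) (p := p) hw hb α)
  let T₀ : PreLpForms n M k p →ₗ[ℝ] Lp (EuclForm n k) p μ :=
    { toFun := fun α => (hm α).toLp _
      map_add' := fun α β => by
        rw [← MemLp.toLp_add]
        refine MemLp.toLp_congr _ _ (Filter.Eventually.of_forall fun x => ?_)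
        exact smul_add (w x) (A.coords α.form x) (A.coords β.form x)
      map_smul' := fun c α => by
        rw [RingHom.id_apply, ← MemLp.toLp_const_smul]
        refine MemLp.toLp_congr _ _ (Filter.Eventually.of_forall fun x => ?_)
        exact smul_comm (w x) c (A.coords α.form x) }
  have hT₀ : ∀ α, T₀ α = (hm α).toLp _ := fun α => rfl
  have hub : ∀ α, ‖T₀ α‖ ≤ C * ‖α‖ := fun α => by
    rw [hT₀, Lp.norm_toLp, PreLpForms.norm_def]
    have := eLpNorm_le_mul_eLpNorm_of_ae_le_mul (μ := μ) (Filter.Eventually.of_forall fun x =>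
      A.norm_smul_coords_le (fun x => (hb x).trans (le_max_left _ 0)) α.form x) p
    refine (ENNReal.toReal_mono (ENNReal.mul_ne_top ENNReal.ofReal_ne_top
      α.memLp.eLpNorm_ne_top) this).trans_eq ?_
    rw [ENNReal.toReal_mul, ENNReal.toReal_ofReal hC]
  have hlb : ∀ α, ‖α‖ ≤ C * ‖T₀ α‖ := fun α => by
    rw [hT₀, Lp.norm_toLp, PreLpForms.norm_def]
    have := eLpNorm_le_mul_eLpNorm_of_ae_le_mul (μ := μ) (Filter.Eventually.of_forall fun x =>
      A.formNorm_le_norm_smul_coords (fun x => (hb' x).trans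
        (mul_le_mul_of_nonneg_right (le_max_left b 0) (abs_nonneg _))) α.form x) p
    refine (ENNReal.toReal_mono (ENNReal.mul_ne_top ENNReal.ofReal_ne_top
      (hm α).eLpNorm_ne_top) this).trans_eq ?_
    rw [ENNReal.toReal_mul, ENNReal.toReal_ofReal hC]
  have hw0 : ∀ x, w x ≠ 0 := fun x h => by
    have := hb' x
    rw [h, abs_zero, mul_zero] at this
    linarith
  have hsurj : Function.Surjective T₀ := by
    intro f
    -- Transporting `f` back by the inverse frame and dividing by the weight gives a form with the
    -- prescribed weighted coordinates.
    let α : FormField n M k := fun x => (w x)⁻¹ • (f x).compContinuousLinearMap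
      ((A.frame x).symm : TangentSpace (𝓡 n) x →L[ℝ] EuclideanSpace ℝ (Fin n))
    have hα : A.coords α = fun x => (w x)⁻¹ • f x := by
      funext x
      ext v
      simp [α, BoundedFrame.coords, Function.comp_def]
    have hα' : ∀ x, w x • A.coords α x = f x := fun x => by
      rw [hα, smul_inv_smul₀ (hw0 x)]
    have hmeas : IsMeasurableForm α := by
      rw [A.isMeasurableForm_iff, hα]
      exact hw.inv₀.smul (Lp.aestronglyMeasurable f)
    have hmem : α ∈ integrableForms n M k p := by
      refine ⟨hmeas, ?_⟩
      refine ((Lp.memLp f).of_le_mul (c := C) hmeas.aestronglyMeasurable_formNorm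
        (Filter.Eventually.of_forall fun x => ?_)).2
      have := A.formNorm_le_norm_smul_coords (fun x => (hb' x).trans
        (mul_le_mul_of_nonneg_right (le_max_left b 0) (abs_nonneg _))) α x
      rwa [hα'] at this
    let α' : PreLpForms n M k p := (⟨α, hmem⟩ : integrableForms n M k p)
    refine ⟨α', ?_⟩
    rw [hT₀]
    refine Lp.ext ((hm α').coeFn_toLp.trans (Filter.Eventually.of_forall fun x => ?_))
    exact hα' x
  let T : PreLpForms n M k p →L[ℝ] Lp (EuclForm n k) p μ := T₀.mkContinuous C hub
  let S : LpForms n M k p →L[ℝ] Lp (EuclForm n k) p μ :=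
    SeparationQuotient.liftCLM T fun x y h => (h.map T.continuous).eq
  have hS : ∀ α, S (toLpForms α) = T₀ α := fun α => rfl
  have hSl : ∀ a, ‖a‖ ≤ C * ‖S a‖ := fun a => by
    obtain ⟨α, rfl⟩ := SeparationQuotient.surjective_mk a
    exact hlb α
  have hinj : Function.Injective S := (injective_iff_map_eq_zero S).mpr fun a ha => by
    have := hSl a
    rw [ha, norm_zero, mul_zero] at this
    exact norm_le_zero_iff.mp this
  let e : LpForms n M k p ≃ₗ[ℝ] Lp (EuclForm n k) p μ := LinearEquiv.ofBijective S.toLinearMap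
    ⟨hinj, fun f => (hsurj f).elim fun α h => ⟨toLpForms α, h⟩⟩
  have hbd : ∀ f, ‖e.symm f‖ ≤ C * ‖f‖ := fun f => by
    have := hSl (e.symm f)
    rwa [show S (e.symm f) = f from e.apply_symm_apply f] at this
  refine ⟨{ e with
    continuous_toFun := S.continuous
    continuous_invFun := AddMonoidHomClass.continuous_of_bound e.symm C hbd }, fun α => ?_⟩
  exact (hm α).coeFn_toLp

end LpCoordinates

/-! ### Integrability of continuous forms and of exterior products. -/

section ContinuousForms

set_option linter.unusedSectionVars false

variable {n : ℕ} {M : Type*} [TopologicalSpace M] [ChartedSpace (EuclideanSpace ℝ (Fin n)) M]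
  [IsManifold (𝓡 n) ∞ M] [RiemannianBundle (fun x : M => TangentSpace (𝓡 n) x)] {k l : ℕ}

/-- The coordinate vector fields of a chart, as a basis. -/
theorem exists_basis_eq_chartFrame {x₀ x : M}
    (hx : x ∈ (chartAt (EuclideanSpace ℝ (Fin n)) x₀).source) :
    ∃ b : Module.Basis (Fin n) ℝ (TangentSpace (𝓡 n) x), ⇑b = chartFrame x₀ x := by
  have hx' : x ∈ (trivializationAt (EuclideanSpace ℝ (Fin n))
      (TangentSpace (𝓡 n) : M → Type _) x₀).baseSet := hx
  refine ⟨(EuclideanSpace.basisFun (Fin n) ℝ).toBasis.map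
    ((trivializationAt (EuclideanSpace ℝ (Fin n)) (TangentSpace (𝓡 n) : M → Type _)
      x₀).continuousLinearEquivAt ℝ x hx').symm.toLinearEquiv, ?_⟩
  funext i
  rw [Module.Basis.map_apply, OrthonormalBasis.coe_toBasis]
  exact congrFun (Trivialization.symm_continuousLinearEquivAt_eq _ hx') _

theorem det_chartGram_pos (o : ManifoldOrientation n M) {x₀ x : M}
    (hx : x ∈ (chartAt (EuclideanSpace ℝ (Fin n)) x₀).source) :
    0 < (chartGram (n := n) x₀ x).det := by
  obtain ⟨b, hb⟩ := exists_basis_eq_chartFrame hx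
  have h1 := abs_volumeForm_pos (o.at' x) b
  have h2 := volumeForm_sq_eq_det_gram (o.at' x) b
  rw [hb] at h1 h2
  change _ = (chartGram (n := n) x₀ x).det at h2
  rw [← h2]
  exact sq_pos_of_ne_zero (abs_pos.mp h1)

variable [IsContMDiffRiemannianBundle (𝓡 n) ∞ (EuclideanSpace ℝ (Fin n))
    (fun x : M => TangentSpace (𝓡 n) x)]

/-- The orthonormal bases in the definition of the norm are chosen pointwise and need not vary
continuously; the expression through the inverse Gram matrix does. -/
theorem continuous_formNorm (o : ManifoldOrientation n M) {α : FormField n M k}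
    (hα : ∀ x₀, ContinuousOn (inChart α x₀) (chartAt (EuclideanSpace ℝ (Fin n)) x₀).source) :
    Continuous fun x => formNorm (α x) := by
  rw [continuous_iff_continuousAt]
  intro x₀
  set U := (chartAt (EuclideanSpace ℝ (Fin n)) x₀).source
  have hU : U ∈ 𝓝 x₀ := chart_source_mem_nhds _ x₀
  refine ContinuousOn.continuousAt ?_ hU
  have hG := continuousOn_chartGram (n := n) x₀
  have hinv : ∀ i j, ContinuousOn (fun x => (chartGram (n := n) x₀ x)⁻¹ i j) U := by
    intro i j
    have hdet : ContinuousOn (fun x => (chartGram (n := n) x₀ x).det) U :=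
      (Continuous.matrix_det continuous_id).comp_continuousOn hG
    have hadj : ContinuousOn (fun x => (chartGram (n := n) x₀ x).adjugate i j) U :=
      ((Continuous.matrix_adjugate continuous_id).matrix_elem i j).comp_continuousOn hG
    refine ((hdet.inv₀ fun x hx => (det_chartGram_pos o hx).ne').mul hadj).congr fun x _ => ?_
    simp [Matrix.inv_def]
  have hev : ∀ v : Fin k → EuclideanSpace ℝ (Fin n),
      ContinuousOn (fun x => inChart α x₀ x v) U := fun v =>
    (ContinuousAlternatingMap.apply ℝ (EuclideanSpace ℝ (Fin n)) ℝ v).continuous.comp_continuousOn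
      (hα x₀)
  have hsum : ContinuousOn (fun x => ∑ i : Fin k → Fin n, ∑ j : Fin k → Fin n,
          (∏ a, (chartGram (n := n) x₀ x)⁻¹ (i a) (j a)) *
          (inChart α x₀ x (fun a => EuclideanSpace.basisFun (Fin n) ℝ (i a)) *
           inChart α x₀ x (fun a => EuclideanSpace.basisFun (Fin n) ℝ (j a)))) U :=
    continuousOn_finsetSum _ fun i _ => continuousOn_finsetSum _ fun j _ =>
      (continuousOn_finsetProd _ fun a _ => hinv _ _).mul ((hev _).mul (hev _))
  exact Real.continuous_sqrt.comp_continuousOn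
    ((hsum.congr fun x hx => sum_sq_eq_chartGram α hx).div_const _)

variable [SecondCountableTopology M] [MeasurableSpace M] [BorelSpace M]

theorem mem_integrableForms_of_continuousOn [T2Space M] (o : ManifoldOrientation n M)
    {α : FormField n M k}
    (hα : ∀ x₀, ContinuousOn (inChart α x₀) (chartAt (EuclideanSpace ℝ (Fin n)) x₀).source)
    {K : Set M} (hK : IsCompact K) (h0 : ∀ x ∉ K, α x = 0) (p : ℝ≥0∞) :
    α ∈ integrableForms n M k p := by
  refine ⟨fun x₀ => (hα x₀).aestronglyMeasurable
    (chartAt (EuclideanSpace ℝ (Fin n)) x₀).open_source.measurableSet, ?_⟩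
  refine ((continuous_formNorm o hα).memLp_of_hasCompactSupport (p := p)
    (μ := riemannianVolume n M) (HasCompactSupport.intro hK fun x hx => ?_)).2
  rw [h0 x hx, formNorm_zero]

theorem extD_mem_integrableForms [T2Space M] (o : ManifoldOrientation n M) {η : FormField n M k}
    (hη : η ∈ testForms n M k) (p : ℝ≥0∞) : extD η ∈ integrableForms n M (k + 1) p := by
  obtain ⟨hs, K, hK, h0⟩ := hη
  exact mem_integrableForms_of_continuousOn o (continuousOn_inChart_extD hs) hK
    (fun x hx => extD_eq_zero_of_notMem hK.isClosed h0 hx) p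

-- Hölder's inequality in the coordinates of a bounded frame, with the bounded weight `vol⁻¹`
-- absorbed into one factor.
set_option maxSynthPendingDepth 5 in
theorem integrable_wedgeDensity (o : ManifoldOrientation n M) (h : k + l = n) {p q : ℝ≥0∞}
    [p.HolderConjugate q] {α : FormField n M k} {β : FormField n M l}
    (hα : α ∈ integrableForms n M k p) (hβ : β ∈ integrableForms n M l q) :
    Integrable (wedgeDensity o h α β) (riemannianVolume n M) := by
  obtain ⟨A⟩ := nonempty_boundedFrame o
  have hw : AEStronglyMeasurable (fun x => (A.vol x)⁻¹) (riemannianVolume n M) :=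
    (A.aestronglyMeasurable_vol _).inv₀
  have hb : ∀ x, |(A.vol x)⁻¹| ≤ 2 ^ n := fun x => by
    rw [abs_inv]
    exact inv_le_of_inv_le₀ (by positivity) ((inv_le_iff_one_le_mul₀ (by positivity)).mpr
      ((A.one_le_abs_vol x).trans_eq (mul_comm _ _)))
  have h1 := A.memLp_smul_coords (w := fun _ => 1) (b := 1) aestronglyMeasurable_const (by simp)
    (show PreLpForms n M k p from ⟨α, hα⟩)
  have h2 := A.memLp_smul_coords hw hb (show PreLpForms n M l q from ⟨β, hβ⟩)
  simp only [one_smul] at h1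
  have h3 : wedgeDensity o h α β =
      fun x => wedgeCLM h (A.coords α x) ((A.vol x)⁻¹ • A.coords β x) :=
    funext fun x => wedgeDensity_eq_coords A h α β x
  rw [h3]
  refine Integrable.mono' ((h1.norm.integrable_mul h2.norm).const_mul ‖wedgeCLM (n := n) h‖)
    ((wedgeCLM (n := n) h).aestronglyMeasurable_comp₂ h1.1 h2.1)
    (Filter.Eventually.of_forall fun x => ?_)
  refine ((wedgeCLM (n := n) h).le_opNorm₂ _ _).trans_eq ?_
  rw [mul_assoc]
  rfl

end ContinuousForms

/-! ### Stokes' theorem on the manifold. -/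

section Stokes

set_option linter.unusedSectionVars false

variable {n : ℕ} {M : Type*} [TopologicalSpace M] [ChartedSpace (EuclideanSpace ℝ (Fin n)) M]
  [IsManifold (𝓡 n) ∞ M] {k l : ℕ}

/-- A form with compact support in the domain of a chart, extended by zero in coordinates, is
smooth. -/
theorem contDiff_indicator_chartForm {α : FormField n M k} (hα : IsSmoothForm α) {x₀ : M}
    {K : Set M} (hK : IsCompact K) (hKs : K ⊆ (extChartAt (𝓡 n) x₀).source)
    (h0 : ∀ x ∉ K, α x = 0) :
    ContDiff ℝ ∞ ((extChartAt (𝓡 n) x₀).target.indicator (chartForm n α x₀)) ∧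
      HasCompactSupport ((extChartAt (𝓡 n) x₀).target.indicator (chartForm n α x₀)) := by
  set φ := extChartAt (𝓡 n) x₀
  have hcK : IsCompact (φ '' K) :=
    hK.image_of_continuousOn ((continuousOn_extChartAt x₀).mono hKs)
  have hz : ∀ y ∉ φ '' K, φ.target.indicator (chartForm n α x₀) y = 0 := by
    intro y hy
    by_cases hyt : y ∈ φ.target
    · rw [Set.indicator_of_mem hyt, chartForm, inChart, h0 (φ.symm y) fun h => hy
        ⟨_, h, φ.right_inv hyt⟩]
      rfl
    · exact Set.indicator_of_notMem hyt _
  refine ⟨contDiff_iff_contDiffAt.mpr fun y => ?_, HasCompactSupport.intro hcK hz⟩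
  by_cases hy : y ∈ φ '' K
  · obtain ⟨x, hx, rfl⟩ := hy
    have hx' := hKs hx
    have h1 := hα.contDiffAt_chartForm (x₀ := x₀) (by rwa [← extChartAt_source (𝓡 n)])
    refine h1.congr_of_eventuallyEq ?_
    filter_upwards [(isOpen_extChartAt_target x₀).mem_nhds (φ.map_source hx')] with y hy
    exact Set.indicator_of_mem hy _
  · refine (contDiffAt_const (c := 0)).congr_of_eventuallyEq ?_
    filter_upwards [hcK.isClosed.isOpen_compl.mem_nhds hy] with y hy
    exact hz y hy

variable [RiemannianBundle (fun x : M => TangentSpace (𝓡 n) x)]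

/-- The modulus is always `√det(g_{ij})`. The sign is constant near `c` because the orientation is
constant in the chart. -/
theorem eventually_volumeForm_chartFrame (o : ManifoldOrientation n M) (c : M) :
    ∃ ε : ℝ, ∀ᶠ x in 𝓝 c, x ∈ (extChartAt (𝓡 n) c).source ∧
      (o.at' x).volumeForm (chartFrame c x) = ε * √(chartGram (n := n) c x).det := by
  obtain ⟨o', ho'⟩ := o.locally_constant c
  let b := (EuclideanSpace.basisFun (Fin n) ℝ).toBasis
  have hc := FiberBundle.mem_baseSet_trivializationAt' (F := EuclideanSpace ℝ (Fin n))
    (E := (TangentSpace (𝓡 n) : M → Type _)) c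
  have key : ∀ᶠ x in 𝓝 c, x ∈ (extChartAt (𝓡 n) c).source ∧
      (0 < (o.at' x).volumeForm (chartFrame c x) ↔ b.orientation = o') := by
    filter_upwards [ho', (trivializationAt (EuclideanSpace ℝ (Fin n))
      (TangentSpace (𝓡 n) : M → Type _) c).open_baseSet.mem_nhds hc] with x h1 hx
    let G := (trivializationAt (EuclideanSpace ℝ (Fin n))
        (TangentSpace (𝓡 n) : M → Type _) c).continuousLinearEquivAt ℝ x hx
    refine ⟨by rw [extChartAt_source]; exact hx, ?_⟩
    have h4 := volumeForm_pos_iff_orientation_eq (o.at' x) (b.map G.symm.toLinearEquiv)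
    have h5 : ⇑(b.map G.symm.toLinearEquiv) = chartFrame c x := by
      funext i
      rw [Module.Basis.map_apply, OrthonormalBasis.coe_toBasis]
      exact congrFun (Trivialization.symm_continuousLinearEquivAt_eq _ hx) _
    have h6 : (b.map G.symm.toLinearEquiv).map G.toLinearEquiv = b := by
      ext1 i
      exact G.apply_symm_apply (b i)
    rw [h5] at h4
    rw [h4, ← h1 hx]
    conv_rhs => rw [← h6, Module.Basis.orientation_map (b.map G.symm.toLinearEquiv)]
    exact (Orientation.map (Fin n) G.toLinearEquiv).injective.eq_iff.symm
  have habs : ∀ x, |(o.at' x).volumeForm (chartFrame c x)| = √(chartGram (n := n) c x).det :=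
    fun x => abs_volumeForm_eq_sqrt _ _
  by_cases hb : b.orientation = o'
  · refine ⟨1, key.mono fun x hx => ⟨hx.1, ?_⟩⟩
    rw [one_mul, ← habs, abs_of_pos (hx.2.mpr hb)]
  · refine ⟨-1, key.mono fun x hx => ⟨hx.1, ?_⟩⟩
    rw [neg_one_mul, ← habs, abs_of_nonpos (not_lt.mp fun h => hb (hx.2.mp h)), neg_neg]

theorem wedgeDensity_mul_volumeForm_chartFrame (o : ManifoldOrientation n M) (h : k + l = n)
    (α : FormField n M k) (β : FormField n M l) (c x : M) :
    wedgeDensity o h α β x * (o.at' x).volumeForm (chartFrame c x) =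
      wedgeCLM h (inChart α c x) (inChart β c x) :=
  (apply_mul_volumeForm (o.at' x) (tangentONB x)
    (wedge h (α x).toAlternatingMap (β x).toAlternatingMap) (chartFrame c x)).trans
    (congrArg (fun f => f (EuclideanSpace.basisFun (Fin n) ℝ))
      (wedge_compLinearMap h ((trivializationAt (EuclideanSpace ℝ (Fin n))
        (TangentSpace (𝓡 n) : M → Type _) c).symmL ℝ x).toLinearMap (α x).toAlternatingMap
        (β x).toAlternatingMap)).symm

variable [IsContMDiffRiemannianBundle (𝓡 n) ∞ (EuclideanSpace ℝ (Fin n))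
    (fun x : M => TangentSpace (𝓡 n) x)] [SecondCountableTopology M] [MeasurableSpace M]
    [BorelSpace M] [T2Space M]

/-- Stokes' theorem for forms supported in the domain of a chart. -/
theorem integral_wedgeDensity_extD_extD_of_subset (o : ManifoldOrientation n M)
    (h : (k + 1) + (l + 1) = n) {η : FormField n M k} {ζ : FormField n M l}
    (hη : IsSmoothForm η) (hζ : ζ ∈ testForms n M l) {c : M} {ε : ℝ} {K : Set M}
    (hK : IsCompact K) (h0 : ∀ x ∉ K, η x = 0)
    (hKc : ∀ x ∈ K, x ∈ (extChartAt (𝓡 n) c).source ∧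
      (o.at' x).volumeForm (chartFrame c x) = ε * √(chartGram (n := n) c x).det) :
    ∫ x, wedgeDensity o h (extD η) (extD ζ) x ∂(riemannianVolume n M) = 0 := by
  set φ := extChartAt (𝓡 n) c
  set μ := riemannianVolume n M
  set f := wedgeDensity o h (extD η) (extD ζ)
  have hKs : K ⊆ φ.source := fun x hx => (hKc x hx).1
  have hf0 : ∀ x ∉ K, f x = 0 := fun x hx => by
    have : f x * (o.at' x).volumeForm (chartFrame x x) = 0 := by
      rw [wedgeDensity_mul_volumeForm_chartFrame, inChart,
        extD_eq_zero_of_notMem hK.isClosed h0 hx]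
      exact congrFun (congrArg DFunLike.coe (map_zero (wedgeCLM (n := n) h))) _
    obtain ⟨b, hb⟩ := exists_basis_eq_chartFrame (mem_chart_source (EuclideanSpace ℝ (Fin n)) x)
    exact (mul_eq_zero.mp this).resolve_right
      (hb ▸ abs_pos.mp (abs_volumeForm_pos (o.at' x) b))
  have hfi : Integrable f μ := integrable_wedgeDensity o h (p := 2) (q := 2)
    (extD_mem_integrableForms o ⟨hη, K, hK, h0⟩ 2) (extD_mem_integrableForms o hζ 2)
  have h1 : ∫ x, f x ∂μ = ∫ x, f x ∂(chartVolume (n := n) c) := by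
    rw [← riemannianVolume_restrict_source, setIntegral_eq_integral_of_forall_compl_eq_zero]
    intro x hx
    exact hf0 x fun hxK => hx (by rw [← extChartAt_source (𝓡 n)]; exact hKs hxK)
  rw [h1, integral_chartVolume c (by
    rw [← riemannianVolume_restrict_source]; exact hfi.1.restrict)]
  have hcK : IsCompact (φ '' K) :=
    hK.image_of_continuousOn ((continuousOn_extChartAt c).mono hKs)
  -- The support of `ζ` may leave the chart. A cut-off equal to `1` near `φ(K)` and zero outside a
  -- compact subset of the target extends `ζ` to `ℝⁿ` without changing it where `dη` lives.
  obtain ⟨L, hL, hKL, hLt⟩ := exists_compact_between hcK (isOpen_extChartAt_target (I := 𝓡 n) c)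
    (Set.image_subset_iff.mpr fun x hx => φ.map_source (hKs hx))
  obtain ⟨χ, hχ1, hχ0, -⟩ := exists_contMDiffMap_one_nhds_of_subset_interior (n := ⊤)
    𝓘(ℝ, EuclideanSpace ℝ (Fin n)) hcK.isClosed hKL
  have hχs : ContDiff ℝ ∞ χ := χ.contMDiff.contDiff
  obtain ⟨hη1, hη2⟩ := contDiff_indicator_chartForm hη hK hKs h0
  set η' := φ.target.indicator (chartForm n η c)
  let ζ' : EuclideanSpace ℝ (Fin n) → EuclForm n l := fun y => χ y • chartForm n ζ c y
  have hζ' : ContDiff ℝ ∞ ζ' := by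
    refine contDiff_iff_contDiffAt.mpr fun y => ?_
    by_cases hy : y ∈ L
    · exact hχs.contDiffAt.smul ((hζ.1.contDiffOn_chartForm c).contDiffAt
        ((isOpen_extChartAt_target c).mem_nhds (hLt hy)))
    · refine (contDiffAt_const (c := 0)).congr_of_eventuallyEq ?_
      filter_upwards [hL.isClosed.isOpen_compl.mem_nhds hy] with z hz
      simp only [ζ', hχ0 z hz, zero_smul]
  have h2 := integral_wedge_extDeriv_extDeriv h hη1 hη2 hζ'
  have hzero : ∀ y ∉ φ '' K, extDeriv η' y = 0 := fun y hy => by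
    have : η' =ᶠ[𝓝 y] fun _ => 0 := by
      filter_upwards [hcK.isClosed.isOpen_compl.mem_nhds hy] with z hz
      by_cases hzt : z ∈ φ.target
      · change φ.target.indicator (chartForm n η c) z = 0
        rw [Set.indicator_of_mem hzt, chartForm, inChart, h0 (φ.symm z) fun h => hz
          ⟨_, h, φ.right_inv hzt⟩]
        rfl
      · exact Set.indicator_of_notMem hzt _
    rw [this.extDeriv_eq]
    ext v
    simp [extDeriv, ContinuousAlternatingMap.alternatizeUncurryFin_apply]
  have hsupp : ∀ y ∉ φ.target, wedgeCLM h (extDeriv η' y) (extDeriv ζ' y) = 0 := fun y hy => by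
    rw [hzero y fun hy' => hy (Set.image_subset_iff.mpr (fun x hx => φ.map_source (hKs hx)) hy'),
      map_zero]
    rfl
  have h3 : ∀ y ∈ φ.target, chartDensity n c y * f (φ.symm y) =
      ε * wedgeCLM h (extDeriv η' y) (extDeriv ζ' y) := by
    intro y hy
    by_cases hyK : y ∈ φ '' K
    · obtain ⟨x, hx, rfl⟩ := hyK
      obtain ⟨hxs, hv⟩ := hKc x hx
      have hx' : x ∈ (chartAt (EuclideanSpace ℝ (Fin n)) c).source := by
        rwa [← extChartAt_source (𝓡 n)]
      have e1 : extDeriv η' (φ x) = inChart (extD η) c x := by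
        rw [inChart_extD hη hx']
        refine Filter.EventuallyEq.extDeriv_eq ?_
        filter_upwards [(isOpen_extChartAt_target c).mem_nhds hy] with z hz
        exact Set.indicator_of_mem hz _
      have e2 : extDeriv ζ' (φ x) = inChart (extD ζ) c x := by
        rw [inChart_extD hζ.1 hx']
        refine Filter.EventuallyEq.extDeriv_eq ?_
        filter_upwards [Filter.eventually_of_mem (mem_nhdsSet_iff_forall.mp hχ1 (φ x) ⟨x, hx, rfl⟩)
          fun z hz => hz] with z hz
        have hz' : χ z = 1 := hz
        simp only [ζ', hz', one_smul]
      rw [e1, e2, ← wedgeDensity_mul_volumeForm_chartFrame o h, hv, φ.left_inv hxs, chartDensity,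
        show (extChartAt (𝓡 n) c).symm (φ x) = x from φ.left_inv hxs]
      -- At a point of `K` both sides of `hv` have the same positive modulus. So `√det(g_{ij})`
      -- equals `ε` times the volume of the chart frame, and the density cancels.
      have hε : ε * ε = 1 := by
        have h5 := abs_volumeForm_eq_sqrt (o.at' x) (chartFrame c x)
        change _ = √(chartGram (n := n) c x).det at h5
        have h6 := Real.sqrt_pos.mpr (det_chartGram_pos o hx')
        rw [hv, abs_mul, abs_of_pos h6] at h5
        have h7 : |ε| = 1 := by
          exact mul_right_cancel₀ h6.ne' (h5.trans (one_mul _).symm)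
        rw [← abs_mul_abs_self, h7, one_mul]
      linear_combination (-(f x * √(chartGram (n := n) c x).det)) * hε
    · have e1 : f (φ.symm y) = 0 := hf0 _ fun h => hyK ⟨_, h, φ.right_inv hy⟩
      rw [e1, hzero y hyK, map_zero, mul_zero]
      exact (mul_zero ε).symm
  rw [setIntegral_congr_fun (measurableSet_extChartAt_target c) h3, integral_const_mul,
    setIntegral_eq_integral_of_forall_compl_eq_zero hsupp, h2, mul_zero]

/-- Stokes' theorem `∫ dη ∧ dζ = 0` for smooth forms with compact support. -/
theorem integral_wedgeDensity_extD_extD (o : ManifoldOrientation n M)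
    (h : (k + 1) + (l + 1) = n) {η : FormField n M k} {ζ : FormField n M l}
    (hη : η ∈ testForms n M k) (hζ : ζ ∈ testForms n M l) :
    ∫ x, wedgeDensity o h (extD η) (extD ζ) x ∂(riemannianVolume n M) = 0 := by
  have hη' := hη
  obtain ⟨hs, K, hK, h0⟩ := hη
  choose ε hε using eventually_volumeForm_chartFrame o
  choose W hW hWo hWm using fun c => eventually_nhds_iff.mp (hε c)
  have : LocallyCompactSpace M := Manifold.locallyCompact_of_finiteDimensional (𝓡 n)
  -- Only `η` is decomposed; the identity is linear in it and `ζ` stays fixed. Compactness of `K`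
  -- leaves finitely many pieces.
  obtain ⟨ρ, hρ⟩ := SmoothPartitionOfUnity.exists_isSubordinate (𝓡 n) hK.isClosed W hWo
    (fun x _ => Set.mem_iUnion.mpr ⟨x, hWm x⟩)
  have hfin := ρ.locallyFinite.finite_nonempty_inter_compact hK
  let F := hfin.toFinset
  -- Membership in the test forms is carried along because additivity of `extD` requires smoothness.
  let P : FormField n M k → Prop := fun α => α ∈ testForms n M k ∧
    ∫ x, wedgeDensity o h (extD α) (extD ζ) x ∂(riemannianVolume n M) = 0
  have hsum : η = ∑ i ∈ F, (fun x => ρ i x • η x : FormField n M k) := by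
    funext x
    rw [Finset.sum_apply]
    by_cases hx : x ∈ K
    · rw [← Finset.sum_smul, ρ.sum_finsupport' x hx fun i hi => ?_, one_smul]
      rw [SmoothPartitionOfUnity.mem_finsupport] at hi
      exact hfin.mem_toFinset.mpr ⟨x, hi, hx⟩
    · exact (h0 x hx).trans
        (Finset.sum_eq_zero fun i _ => (congrArg (ρ i x • ·) (h0 x hx)).trans (smul_zero _)).symm
  suffices P η from this.2
  rw [hsum]
  refine Finset.sum_induction _ P (fun α β hα hβ => ⟨add_mem hα.1 hβ.1, ?_⟩) ⟨zero_mem _, ?_⟩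
    fun i _ => ?_
  · have hi : ∀ γ ∈ testForms n M k,
        Integrable (wedgeDensity o h (extD γ) (extD ζ)) (riemannianVolume n M) := fun γ hγ =>
      integrable_wedgeDensity o h (p := 2) (q := 2) (extD_mem_integrableForms o hγ 2)
        (extD_mem_integrableForms o hζ 2)
    rw [extD_add hα.1.1 hβ.1.1, wedgeDensity_add_left, integral_add' (hi α hα.1) (hi β hβ.1),
      hα.2, hβ.2, add_zero]
  · have : extD (0 : FormField n M k) = 0 := by
      simpa using extD_smul (0 : ℝ) (0 : FormField n M k)
    rw [this, wedgeDensity_zero_left]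
    simp
  · have hsm : IsSmoothForm (fun x => ρ i x • η x : FormField n M k) := fun x₀ =>
      ((ρ i).contMDiff.contMDiffOn).smul (hs x₀)
    have hK' : IsCompact (K ∩ tsupport (ρ i)) := hK.inter_right (isClosed_tsupport _)
    have h0' : ∀ x ∉ K ∩ tsupport (ρ i), ρ i x • η x = 0 := fun x hx => by
      by_cases hxK : x ∈ K
      · rw [image_eq_zero_of_notMem_tsupport fun h => hx ⟨hxK, h⟩, zero_smul]
      · rw [h0 x hxK, smul_zero]
    exact ⟨⟨hsm, _, hK', h0'⟩, integral_wedgeDensity_extD_extD_of_subset o h hsm hζ hK' h0'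
      fun x hx => hW i x (hρ i hx.2)⟩

end Stokes

/-! ### The integration pairing and its annihilators. -/

section Pairing

set_option linter.unusedSectionVars false

variable {n : ℕ} {M : Type*} [TopologicalSpace M] [ChartedSpace (EuclideanSpace ℝ (Fin n)) M]
  [IsManifold (𝓡 n) ∞ M] [SecondCountableTopology M] [MeasurableSpace M] [BorelSpace M]
  [RiemannianBundle (fun x : M => TangentSpace (𝓡 n) x)]
  [IsContMDiffRiemannianBundle (𝓡 n) ∞ (EuclideanSpace ℝ (Fin n))
    (fun x : M => TangentSpace (𝓡 n) x)] {k l : ℕ} {p q : ℝ≥0∞}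

theorem exists_wedgeDensity_comm (o : ManifoldOrientation n M) (h : k + l = n) (h' : l + k = n) :
    ∃ ε : ℝ, ε ≠ 0 ∧ ∀ (α : FormField n M k) (β : FormField n M l),
      wedgeDensity o h α β = ε • wedgeDensity o h' β α := by
  obtain ⟨A⟩ := nonempty_boundedFrame o
  obtain ⟨ε, hε, hc⟩ := exists_wedge_comm (V := EuclideanSpace ℝ (Fin n)) h h'
  refine ⟨ε, fun h0 => by simp [h0] at hε, fun α β => funext fun x => ?_⟩
  have h1 : wedgeCLM h (A.coords α x) (A.coords β x) =
      ε * wedgeCLM h' (A.coords β x) (A.coords α x) :=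
    congrArg (fun f => f (EuclideanSpace.basisFun (Fin n) ℝ))
      (hc (A.coords α x).toAlternatingMap (A.coords β x).toAlternatingMap)
  rw [Pi.smul_apply, wedgeDensity_eq_coords A, wedgeDensity_eq_coords A, map_smul, map_smul, h1,
    smul_eq_mul, smul_eq_mul, smul_eq_mul, mul_left_comm]

theorem wedgeDensity_zero_right (o : ManifoldOrientation n M) (h : k + l = n)
    (α : FormField n M k) : wedgeDensity o h α (0 : FormField n M l) = 0 := by
  obtain ⟨ε, -, hε⟩ := exists_wedgeDensity_comm o h (by rwa [add_comm])
  rw [hε, wedgeDensity_zero_left, smul_zero]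

theorem wedgeCLM_flip_surjective (h : k + l = n) :
    Function.Surjective (wedgeCLM (n := n) h).flip := by
  intro F
  have h' : l + k = n := by rwa [add_comm]
  obtain ⟨ε, hε, hc⟩ := exists_wedge_comm (V := EuclideanSpace ℝ (Fin n)) h h'
  obtain ⟨b, rfl⟩ := wedgeCLM_surjective h' F
  refine ⟨ε • b, ?_⟩
  ext a
  have h1 : wedgeCLM h a b = ε * wedgeCLM h' b a :=
    congrArg (fun f => f (EuclideanSpace.basisFun (Fin n) ℝ))
      (hc a.toAlternatingMap b.toAlternatingMap)
  rw [ContinuousLinearMap.flip_apply, map_smul, h1, smul_eq_mul, ← mul_assoc, hε, one_mul]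

/-- Integration of exterior products puts `L^p(M, Λᵏ)` and `L^q(M, Λ^{n-k})` in duality. -/
theorem exists_integral_pairing [Fact (1 ≤ p)] [Fact (1 ≤ q)] [p.HolderConjugate q] (hp : p ≠ ⊤)
    (hq : q ≠ ⊤) (o : ManifoldOrientation n M) (h : k + l = n) :
    ∃ (B : LpForms n M k p →L[ℝ] LpForms n M l q →L[ℝ] ℝ) (C : ℝ), 0 ≤ C ∧
      (∀ α β, B (toLpForms α) (toLpForms β) =
        ∫ x, wedgeDensity o h α.form β.form x ∂(riemannianVolume n M)) ∧
      (∀ F : StrongDual ℝ (LpForms n M l q), ∃ x, ‖x‖ ≤ C * ‖F‖ ∧ B x = F) ∧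
      ∀ G : StrongDual ℝ (LpForms n M k p), ∃ y, ∀ x, B x y = G x := by
  obtain ⟨A⟩ := nonempty_boundedFrame o
  have hw : AEStronglyMeasurable (fun x => (A.vol x)⁻¹) (riemannianVolume n M) :=
    (A.aestronglyMeasurable_vol _).inv₀
  have hb : ∀ x, |(A.vol x)⁻¹| ≤ 2 ^ n := fun x => by
    rw [abs_inv]
    exact inv_le_of_inv_le₀ (by positivity) ((inv_le_iff_one_le_mul₀ (by positivity)).mpr
      ((A.one_le_abs_vol x).trans_eq (mul_comm _ _)))
  have hb' : ∀ x, 1 ≤ 2 ^ n * |(A.vol x)⁻¹| := fun x => by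
    rw [abs_inv, ← div_eq_mul_inv, one_le_div (abs_pos.mpr (A.vol_ne_zero x))]
    exact A.abs_vol_le x
  -- Weight `1` in degree `k` and `vol⁻¹` in degree `l`: the integral of the exterior product
  -- becomes the pairing of functions defined by `wedgeCLM`.
  obtain ⟨Θ₁, h₁⟩ := A.exists_lpEquiv (k := k) (p := p) (w := fun _ => 1) (b := 1)
    aestronglyMeasurable_const (by simp) (by simp)
  obtain ⟨Θ₂, h₂⟩ := A.exists_lpEquiv (k := l) (p := q) hw hb hb'
  have : CompleteSpace (LpForms n M k p) :=
    (Θ₁.isUniformEmbedding.isUniformInducing.completeSpace_congr Θ₁.surjective).mpr inferInstance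
  let B₀ := (wedgeCLM (n := n) h).lpPairing (riemannianVolume n M) p q
  let B : LpForms n M k p →L[ℝ] LpForms n M l q →L[ℝ] ℝ :=
    B₀.bilinearComp (Θ₁ : LpForms n M k p →L[ℝ] _) (Θ₂ : LpForms n M l q →L[ℝ] _)
  have hB : ∀ x y, B x y = ∫ t, wedgeCLM h (Θ₁ x t) (Θ₂ y t) ∂(riemannianVolume n M) := fun x y =>
    ContinuousLinearMap.lpPairing_eq_integral _ _ _
  have hBs : Function.Surjective B := by
    intro F
    obtain ⟨f, hf⟩ := lpPairing_surjective (μ := riemannianVolume n M) hp hq (wedgeCLM (n := n) h)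
      (wedgeCLM_surjective h) (F.comp (Θ₂.symm : _ →L[ℝ] LpForms n M l q))
    refine ⟨Θ₁.symm f, ?_⟩
    ext y
    have := DFunLike.congr_fun hf (Θ₂ y)
    rw [ContinuousLinearMap.lpPairing_eq_integral] at this
    rw [hB, Θ₁.apply_symm_apply, this]
    simp
  -- The open mapping theorem turns surjectivity into a norm bound; the completeness it needs was
  -- transferred from `Lp` through `Θ₁`.
  obtain ⟨C, hC, hC'⟩ := B.exists_preimage_norm_le hBs
  refine ⟨B, C, hC.le, fun α β => ?_, fun F => ?_, fun G => ?_⟩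
  · rw [hB]
    refine integral_congr_ae ?_
    filter_upwards [h₁ α, h₂ β] with x hx hy
    rw [hx, hy, one_smul, ← wedgeDensity_eq_coords A]
  · obtain ⟨x, hx, hx'⟩ := hC' F
    exact ⟨x, hx', hx⟩
  · have : q.HolderConjugate p := ENNReal.HolderTriple.symm
    obtain ⟨f, hf⟩ := lpPairing_surjective (μ := riemannianVolume n M) hq hp
      (wedgeCLM (n := n) h).flip (wedgeCLM_flip_surjective h)
      (G.comp (Θ₁.symm : _ →L[ℝ] LpForms n M k p))
    refine ⟨Θ₂.symm f, fun x => ?_⟩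
    have := DFunLike.congr_fun hf (Θ₁ x)
    rw [ContinuousLinearMap.lpPairing_eq_integral] at this
    rw [hB, Θ₂.apply_symm_apply]
    refine this.trans ?_
    simp

variable [T2Space M]

theorem exactTestForms_le_integrableForms (o : ManifoldOrientation n M) (l : ℕ) (q : ℝ≥0∞) :
    exactTestForms n M l ≤ integrableForms n M l q := by
  cases l with
  | zero => exact bot_le
  | succ l =>
    rintro _ ⟨η, hη, rfl⟩
    exact extD_mem_integrableForms o hη q

theorem integral_wedgeDensity_exact (o : ManifoldOrientation n M) (h : k + l = n)
    {α : FormField n M k} {β : FormField n M l} (hα : α ∈ exactTestForms n M k)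
    (hβ : β ∈ exactTestForms n M l) :
    ∫ x, wedgeDensity o h α β x ∂(riemannianVolume n M) = 0 := by
  cases k with
  | zero =>
    obtain rfl : α = 0 := hα
    rw [wedgeDensity_zero_left]
    simp
  | succ k =>
    cases l with
    | zero =>
      obtain rfl : β = 0 := hβ
      rw [wedgeDensity_zero_right]
      simp
    | succ l =>
      obtain ⟨η, hη, rfl⟩ := hα
      obtain ⟨ζ, hζ, rfl⟩ := hβ
      exact integral_wedgeDensity_extD_extD o h hη hζ

variable [Fact (1 ≤ p)]

/-- The weakly closed forms are those orthogonal to the exact test forms. -/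
theorem mem_preClosedForms_iff [p.HolderConjugate q] (o : ManifoldOrientation n M) (h : k + l = n)
    (α : PreLpForms n M k p) :
    α ∈ preClosedForms o k p ↔ ∀ e ∈ exactTestForms n M l,
      ∫ x, wedgeDensity o h α.form e x ∂(riemannianVolume n M) = 0 := by
  constructor
  · intro hα e he
    cases l with
    -- In top degree there are no test forms to pair with: every form is weakly closed, and the
    -- exact test forms of degree `0` vanish.
    | zero =>
      obtain rfl : e = 0 := he
      rw [wedgeDensity_zero_right]
      simp
    | succ l =>
      obtain ⟨η, hη, rfl⟩ := he
      have h1 := (hα l (by omega) h η hη).2.2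
      rw [wedgeDensity_zero_left] at h1
      simpa using h1.symm
  · intro hα m h₁ h₂ η hη
    obtain rfl : l = m + 1 := by omega
    refine ⟨?_, integrable_wedgeDensity o h (q := q) α.2 (extD_mem_integrableForms o hη q), ?_⟩
    · rw [wedgeDensity_zero_left]
      exact integrable_zero _ _ _
    · rw [wedgeDensity_zero_left, hα _ ⟨η, hη, rfl⟩]
      simp

/-- Orthogonality passes to classes since `B` is defined on them. The factor `c` admits the same
pairing read with its arguments exchanged, where the sign of graded commutativity appears. -/
theorem mem_closedForms_iff [Fact (1 ≤ q)] [p.HolderConjugate q] (o : ManifoldOrientation n M)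
    (h : k + l = n) {B : LpForms n M k p → LpForms n M l q → ℝ} {c : ℝ} (hc : c ≠ 0)
    (hB : ∀ α β, B (toLpForms α) (toLpForms β) =
      c * ∫ x, wedgeDensity o h α.form β.form x ∂(riemannianVolume n M)) (x : LpForms n M k p) :
    x ∈ closedForms o k p ↔ ∀ e ∈ ((exactTestForms n M l).comap PreLpForms.form).map
      (toLpForms (n := n) (M := M) (k := l) (p := q)).toLinearMap, B x e = 0 := by
  constructor
  · rintro ⟨α, hα, rfl⟩ _ ⟨β, hβ, rfl⟩
    have := (mem_preClosedForms_iff (q := q) o h α).mp hα β.form hβ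
    refine (hB α β).trans ?_
    rw [this, mul_zero]
  · intro hx
    obtain ⟨α, rfl⟩ := SeparationQuotient.surjective_mk x
    refine ⟨α, (mem_preClosedForms_iff (q := q) o h α).mpr fun e he => ?_, rfl⟩
    let β : PreLpForms n M l q :=
      (⟨e, exactTestForms_le_integrableForms o l q he⟩ : integrableForms n M l q)
    have := (hB α β).symm.trans (hx (toLpForms β) ⟨β, he, rfl⟩)
    exact (mul_eq_zero.mp this).resolve_left hc

end Pairing

end RiemannianForms

end

theorem theorem1p2 {n : ℕ} {M : Type*} [TopologicalSpace M] [T2Space M] [SecondCountableTopology M]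
    [ChartedSpace (EuclideanSpace ℝ (Fin n)) M] [IsManifold (𝓡 n) ∞ M]
    [MeasurableSpace M] [BorelSpace M]
    [RiemannianBundle (fun x : M => TangentSpace (𝓡 n) x)]
    [IsContMDiffRiemannianBundle (𝓡 n) ∞ (EuclideanSpace ℝ (Fin n))
      (fun x : M => TangentSpace (𝓡 n) x)]
    (o : ManifoldOrientation n M) (k l : ℕ) (hkl : k + l = n)
    (p q : ℝ≥0∞) [Fact (1 ≤ p)] [Fact (1 ≤ q)] (hp : 1 < p) (hp' : p < ⊤)
    (hpq : 1 / p + 1 / q = 1) :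
    ∃ Φ : ReducedCompCohomology o k p ≃L[ℝ] StrongDual ℝ (ReducedCompCohomology o l q),
      ∀ (α : preClosedForms o k p) (β : preClosedForms o l q),
        Integrable (wedgeDensity o hkl α.1.form β.1.form) (riemannianVolume n M) ∧
        Φ (cohomologyClass o α) (cohomologyClass o β) =
          ∫ x, wedgeDensity o hkl α.1.form β.1.form x ∂(riemannianVolume n M) := by
  have hc : p.HolderConjugate q := ⟨by simpa using hpq⟩
  have hc' : q.HolderConjugate p := ENNReal.HolderTriple.symm
  -- An infinite `q` would force `p = 1`.
  have hq : q ≠ ⊤ := by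
    rintro rfl
    rw [ENNReal.div_top, add_zero, one_div, ENNReal.inv_eq_one] at hpq
    exact hp.ne' hpq
  have hlk : l + k = n := by rwa [add_comm]
  obtain ⟨B, C, hC, hB, hrep, hrep'⟩ := exists_integral_pairing hp'.ne hq o hkl
  obtain ⟨ε, hε, hcomm⟩ := exists_wedgeDensity_comm o hkl hlk
  obtain ⟨Φ, hΦ⟩ := exists_annihilator_quotient_equiv_dual B hC hrep hrep'
    (EX := ((exactTestForms n M k).comap PreLpForms.form).map
      (toLpForms (n := n) (M := M) (k := k) (p := p)).toLinearMap)
    (EY := ((exactTestForms n M l).comap PreLpForms.form).map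
      (toLpForms (n := n) (M := M) (k := l) (p := q)).toLinearMap)
    (ZX := closedForms o k p) (ZY := closedForms o l q)
    (mem_closedForms_iff o hkl (B := fun x y => B x y) one_ne_zero
      fun α β => by rw [hB, one_mul])
    -- The closed forms of degree `l` are tested in the second slot of `B`, hence the commutation
    -- sign `ε`.
    (mem_closedForms_iff o hlk (B := fun y x => B x y) hε fun β α => by
      rw [hB, hcomm, ← integral_const_mul]
      rfl)
    (by
      rintro _ ⟨α, hα, rfl⟩ _ ⟨β, hβ, rfl⟩
      exact (hB α β).trans (integral_wedgeDensity_exact o hkl hα hβ))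
  refine ⟨Φ, fun α β => ⟨integrable_wedgeDensity o hkl (q := q) α.1.2 β.1.2, ?_⟩⟩
  exact (hΦ ⟨toLpForms α.1, Submodule.mem_map_of_mem α.2⟩
    ⟨toLpForms β.1, Submodule.mem_map_of_mem β.2⟩).trans (hB α.1 β.1)
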